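/- **Setting.** Let $\mathfrak g=\mathfrak v\oplus\mathfrak z$ be an H-type Lie algebra: a finite-dimensional real inner product space, with $\mathfrak v\perp\mathfrak z$, $\mathfrak z\neq0$, and a Lie bracket for which $\mathfrak z$ is central, $[\mathfrak v,\mathfrak v]=\mathfrak z$, and the maps $J_\mu:\mathfrak v\to\mathfrak v$ ($\mu\in\mathfrak z^*$) defined by $\langle J_\mu x,y\rangle=\mu([x,y])$ satisfy $J_\mu^2=-|\mu|^2 I$. Put $2n=\dim\mathfrak v$, identify $\mathfrak v^*,\mathfrak z^*$ with $\mathfrak v,\mathfrak z$ by the inner product, and let $G=\mathfrak v\times\mathfrak z$ with product $(x,u)(x',u')=(x+x',u+u'+\tfrac12[x,x'])$ and Haar measure $dx\,du$. *X-ray transform.* For $\nu\in\mathfrak v^*$ with $|\nu|=1$ and $\lambda\in\mathfrak z^*\setminus\{0\}$ let $\gamma_{\nu,\lambda}(s)=\big(e^{sJ_\lambda}J_\lambda^{-1}\nu,\ \tfrac{s\lambda}{2|\lambda|^2}\big)$; the curves $g\,\gamma_{\nu,\lambda}$, $g\in G$, are the sub-Riemannian geodesics of charge $\lambda$. For $f\in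 L^1(G)$ put $I_{\nu,\lambda}f(g)=\int_{\mathbb R}f(g\,\gamma_{\nu,\lambda}(s))\,ds$, which is defined for almost every $g\in G$; $I_{\nu,\lambda}f=0$ means that it vanishes for almost every $g$. *Fourier transform.* Let $\mathcal F(\mathbb C^n)$ be the Bargmann–Fock space of entire functions $F$ on $\mathbb C^n$ with $\pi^{-n}\int|F(\zeta)|^2e^{-|\zeta|^2}d\zeta<\infty$. For $h>0$, $(z,t)\in\mathbb C^n\times\mathbb R$ let $\pi_h(z,t)F(\zeta)=e^{iht-\sqrt{h/2}\,\zeta\cdot\bar z-\frac h4|z|^2}F(\zeta+\sqrt{h/2}\,z)$. For $\mu\in\mathfrak z^*\setminus\{0\}$ fix a real-linear isometry $R_\mu=R_{\mu/|\mu|}:\mathbb C^n\to\mathfrak v$ with $J_\mu R_\mu z=|\mu|R_\mu(iz)$ for all $z$, and let $\pi_\mu(x,u)=\pi_{|\mu|}(R_\mu^{-1}x,\ \mu(u)/|\mu|)$, a unitary representation of $G$ on $\mathcal F(\mathbb C^n)$. The group Fourier transform of $f\in L^1(G)$ is the bounded operator $\mathcal F(f)(\mu)=\int_G f(g)\,\pi_\mu(g)^*\,dg$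 (weak integral) on $\mathcal F(\mathbb C^n)$. For $\Omega\subset\mathfrak z^*\setminus\{0\}$ let $L^1_\Omega(G)$ be the set of $f\in L^1(G)$ such that $\mathcal F(f)(\mu)=0$ for all $\mu\in\mathfrak z^*\setminus\{0\}$ with $\mu\notin\Omega$. For $\lambda_0\in\mathfrak z^*\setminus\{0\}$ and $\varepsilon>0$ let $C_\varepsilon(\lambda_0)=\{\lambda\in\mathfrak z^*\setminus\{0\}:|\lambda|=|\lambda_0|,\ |\lambda-\lambda_0|<\varepsilon|\lambda_0|\}$. **Theorem (Frequency-Support Theorems).** For every $\varepsilon>0$ there is a constant $c>0$, depending only on $\varepsilon$ (in particular not on $G$, $R$, $\lambda_0$ or $f$), such that the following holds in each of the two cases below. Let $f\in L^1(G)$ satisfy $I_{\nu,\lambda}f=0$ for all $\nu\in\mathfrak v^*$ with $|\nu|=1$ and all $\lambda\in Z$, where 1. $\dim\mathfrak z=1$ and $Z=\{\lambda\in\mathfrak z^*:|\lambda|\in[R,R(1+\varepsilon)]\}$ for some $R>0$; or 2. $\dim\mathfrak z>1$ and $Z=C_\varepsilon(\lambda_0)$ for some $\lambda_0\in\mathfrak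 z^*\setminus\{0\}$ with $|\lambda_0|=R$. Then $f\in L^1_\Omega(G)$ with $\Omega=\{\mu\in\mathfrak z^*\setminus\{0\}:|\mu|\le cR^2\}$; that is, $\mathcal F(f)(\mu)=0$ for all $\mu\in\mathfrak z^*$ with $|\mu|>cR^2$. -/

import Mathlib

open MeasureTheory Module

universe u w

noncomputable section

namespace HTypeXray

section Algebra

variable {V : Type u} {Z : Type w}
  [NormedAddCommGroup V] [InnerProductSpace ℝ V] [FiniteDimensional ℝ V]
  [NormedAddCommGroup Z] [InnerProductSpace ℝ Z] [FiniteDimensional ℝ Z]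

/-- For a bilinear map `B : V × V → Z` and `μ : Z`, the endomorphism `J_μ` of `V` with
`⟪J_μ x, y⟫ = ⟪μ, B x y⟫` (see `inner_Jmap`). -/
def Jmap (B : V →ₗ[ℝ] V →ₗ[ℝ] Z) (μ : Z) : V →L[ℝ] V :=
  LinearMap.toContinuousLinearMap
    { toFun := fun x => LinearMap.adjoint (B x) μ
      map_add' := fun x y => by simp
      map_smul' := fun c x => by simp }

theorem inner_Jmap (B : V →ₗ[ℝ] V →ₗ[ℝ] Z) (μ : Z) (x y : V) :
    inner ℝ (Jmap B μ x) y = inner ℝ μ (B x y) := by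
  simp [Jmap, LinearMap.adjoint_inner_left]

theorem Jmap_smul (B : V →ₗ[ℝ] V →ₗ[ℝ] Z) (c : ℝ) (μ : Z) (x : V) :
    Jmap B (c • μ) x = c • Jmap B μ x := by
  simp [Jmap]

variable (V Z) in
/-- An H-type Lie algebra `𝔤 = 𝔳 ⊕ 𝔷`, given by its horizontal layer `V = 𝔳`, its centre `Z = 𝔷`
(orthogonal to each other), and its bracket `𝔳 × 𝔳 → 𝔷`; brackets with elements of `𝔷` vanish.
The dual spaces `𝔳*` and `𝔷*` are identified with `V` and `Z` by the inner products. -/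
structure HTypeAlgebra where
  /-- The Lie bracket on the horizontal layer. -/
  bracket : V →ₗ[ℝ] V →ₗ[ℝ] Z
  /-- The bracket is alternating. -/
  bracket_self : ∀ x, bracket x x = 0
  /-- The algebra is stratified: `[𝔳, 𝔳] = 𝔷`. -/
  span_bracket : Submodule.span ℝ {u : Z | ∃ x y, bracket x y = u} = ⊤
  /-- The H-type condition `J_μ ^ 2 = -|μ| ^ 2`. -/
  J_sq : ∀ (μ : Z) (x : V), Jmap bracket μ (Jmap bracket μ x) = -(‖μ‖ ^ 2) • x

namespace HTypeAlgebra

/-- The skew map `J_μ` of an H-type algebra: `⟪J_μ x, y⟫ = ⟪μ, [x, y]⟫`. -/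
def J (D : HTypeAlgebra V Z) (μ : Z) : V →L[ℝ] V := Jmap D.bracket μ

theorem bracket_swap (D : HTypeAlgebra V Z) (x y : V) : D.bracket x y = -D.bracket y x := by
  have h := D.bracket_self (x + y)
  simp only [map_add, LinearMap.add_apply, D.bracket_self, zero_add, add_zero] at h
  rw [eq_neg_iff_add_eq_zero, add_comm]; exact h

theorem inner_J (D : HTypeAlgebra V Z) (μ : Z) (x y : V) :
    inner ℝ (D.J μ x) y = inner ℝ μ (D.bracket x y) := inner_Jmap _ _ _ _

theorem inner_J_right (D : HTypeAlgebra V Z) (μ : Z) (x y : V) :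
    inner ℝ x (D.J μ y) = -inner ℝ (D.J μ x) y := by
  rw [real_inner_comm, inner_J, inner_J, D.bracket_swap, inner_neg_right]

theorem J_J (D : HTypeAlgebra V Z) (μ : Z) (x : V) : D.J μ (D.J μ x) = -(‖μ‖ ^ 2) • x :=
  D.J_sq μ x

theorem J_smul (D : HTypeAlgebra V Z) (c : ℝ) (μ : Z) (x : V) :
    D.J (c • μ) x = c • D.J μ x := Jmap_smul _ _ _ _

/-- For a unit vector `σ`, the space `(𝔳, J_σ)` is isometric to `ℂⁿ`, where `2 n = dim 𝔳`. -/
theorem exists_frame (D : HTypeAlgebra V Z) (σ : Z) (hσ : ‖σ‖ = 1) :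
    ∃ R : EuclideanSpace ℂ (Fin (finrank ℝ V / 2)) ≃ₗᵢ[ℝ] V,
      ∀ z, D.J σ (R z) = R (Complex.I • z) := by
  have hJJ : ∀ x, D.J σ (D.J σ x) = -x := fun x => by rw [D.J_J, hσ]; simp
  let modC : Module ℂ V :=
    { smul := fun c x => c.re • x + c.im • D.J σ x
      one_smul := fun x => by
        change (1 : ℂ).re • x + (1 : ℂ).im • D.J σ x = x
        simp
      mul_smul := fun a b x => by
        change (a * b).re • x + (a * b).im • D.J σ x
          = a.re • (b.re • x + b.im • D.J σ x) + a.im • D.J σ (b.re • x + b.im • D.J σ x)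
        simp only [Complex.mul_re, Complex.mul_im, map_add, map_smul, hJJ]
        module
      smul_zero := fun a => by
        change a.re • (0 : V) + a.im • D.J σ 0 = 0
        simp
      smul_add := fun a x y => by
        change a.re • (x + y) + a.im • D.J σ (x + y)
          = (a.re • x + a.im • D.J σ x) + (a.re • y + a.im • D.J σ y)
        simp only [map_add]
        module
      add_smul := fun a b x => by
        change (a + b).re • x + (a + b).im • D.J σ x
          = (a.re • x + a.im • D.J σ x) + (b.re • x + b.im • D.J σ x)
        simp only [Complex.add_re, Complex.add_im]
        module
      zero_smul := fun x => by
        change (0 : ℂ).re • x + (0 : ℂ).im • D.J σ x = 0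
        simp }
  have smul_def : ∀ (c : ℂ) (x : V), c • x = c.re • x + c.im • D.J σ x := fun _ _ => rfl
  have hJself : ∀ x : V, inner ℝ x (D.J σ x) = 0 := fun x => by
    have h := D.inner_J_right σ x x
    rw [real_inner_comm] at h
    rw [real_inner_comm]; linarith
  have hJJi : ∀ x y : V, inner ℝ (D.J σ x) (D.J σ y) = inner ℝ x y := fun x y => by
    rw [D.inner_J_right, hJJ, inner_neg_left, neg_neg]
  have hnorm : ∀ (c : ℂ) (x : V), ‖c • x‖ = ‖c‖ * ‖x‖ := fun c x => by
    have h : ‖c • x‖ ^ 2 = (‖c‖ * ‖x‖) ^ 2 := by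
      rw [smul_def, ← real_inner_self_eq_norm_sq]
      simp only [inner_add_left, inner_add_right, real_inner_smul_left, real_inner_smul_right,
        hJself, hJJi]
      rw [real_inner_comm x (D.J σ x), hJself, real_inner_self_eq_norm_sq, mul_pow, ← Complex.normSq_eq_norm_sq,
        Complex.normSq_apply]
      ring
    exact (sq_eq_sq₀ (norm_nonneg _) (by positivity)).1 h
  let nsC : NormedSpace ℂ V :=
    { toModule := modC
      norm_smul_le := fun c x => (hnorm c x).le }
  let inC : InnerProductSpace ℂ V :=
    { toNormedSpace := nsC
      inner := fun x y => ⟨inner ℝ x y, -inner ℝ x (D.J σ y)⟩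
      norm_sq_eq_re_inner := fun x => by
        change ‖x‖ ^ 2 = inner ℝ x x
        rw [real_inner_self_eq_norm_sq]
      conj_inner_symm := fun x y => by
        apply Complex.ext
        · change inner ℝ y x = inner ℝ x y
          exact real_inner_comm _ _
        · change -(-inner ℝ y (D.J σ x)) = -inner ℝ x (D.J σ y)
          rw [D.inner_J_right σ x y, real_inner_comm]
      add_left := fun x y z => by
        apply Complex.ext
        · change inner ℝ (x + y) z = inner ℝ x z + inner ℝ y z
          exact inner_add_left _ _ _
        · change -inner ℝ (x + y) (D.J σ z) = -inner ℝ x (D.J σ z) + -inner ℝ y (D.J σ z)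
          rw [inner_add_left]; ring
      smul_left := fun x y c => by
        apply Complex.ext
        · rw [Complex.mul_re]
          change inner ℝ (c.re • x + c.im • D.J σ x) y
            = c.re * inner ℝ x y - (-c.im) * (-inner ℝ x (D.J σ y))
          rw [inner_add_left, real_inner_smul_left, real_inner_smul_left, D.inner_J_right]; ring
        · rw [Complex.mul_im]
          change -inner ℝ (c.re • x + c.im • D.J σ x) (D.J σ y)
            = c.re * (-inner ℝ x (D.J σ y)) + (-c.im) * inner ℝ x y
          rw [inner_add_left, real_inner_smul_left, real_inner_smul_left, hJJi]; ring }
  have : IsScalarTower ℝ ℂ V := ⟨fun r c x => by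
    rw [smul_def, smul_def]
    simp only [Complex.real_smul, Complex.mul_re, Complex.mul_im, Complex.ofReal_re,
      Complex.ofReal_im]
    module⟩
  have : FiniteDimensional ℂ V := Module.Finite.of_restrictScalars_finite ℝ ℂ V
  have hdim : finrank ℂ V = finrank ℝ V / 2 := by
    have h := finrank_mul_finrank ℝ ℂ V
    rw [Complex.finrank_real_complex] at h
    omega
  let b : OrthonormalBasis (Fin (finrank ℝ V / 2)) ℂ V :=
    (stdOrthonormalBasis ℂ V).reindex (finCongr hdim)
  have hreal : ∀ (r : ℝ) (z : EuclideanSpace ℂ (Fin (finrank ℝ V / 2))),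
      b.repr.symm (r • z) = r • b.repr.symm z := fun r z => by
    have : r • z = (r : ℂ) • z := by ext i; simp
    rw [this, map_smul, smul_def]; simp
  refine ⟨⟨⟨⟨⟨b.repr.symm, fun x y => map_add _ x y⟩, hreal⟩, b.repr,
    fun x => b.repr.apply_symm_apply x, fun x => b.repr.symm_apply_apply x⟩,
    fun x => b.repr.symm.norm_map x⟩, fun z => ?_⟩
  change D.J σ (b.repr.symm z) = b.repr.symm (Complex.I • z)
  rw [map_smul, smul_def]; simp

/-- A chosen orthogonal map `R_μ = R_{μ/|μ|} : ℂⁿ → 𝔳` with `J_μ = |μ| R_μ i R_μᵗ`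
(see `J_frame`). -/
def frame (D : HTypeAlgebra V Z) (μ : Z) (hμ : μ ≠ 0) :
    EuclideanSpace ℂ (Fin (finrank ℝ V / 2)) ≃ₗᵢ[ℝ] V :=
  Classical.choose (D.exists_frame (‖μ‖⁻¹ • μ) (norm_smul_inv_norm hμ))

theorem J_frame (D : HTypeAlgebra V Z) (μ : Z) (hμ : μ ≠ 0)
    (z : EuclideanSpace ℂ (Fin (finrank ℝ V / 2))) :
    D.J μ (D.frame μ hμ z) = ‖μ‖ • D.frame μ hμ (Complex.I • z) := by
  have h := Classical.choose_spec (D.exists_frame (‖μ‖⁻¹ • μ) (norm_smul_inv_norm hμ)) z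
  rw [frame, ← h, J_smul, smul_smul, mul_inv_cancel₀ (norm_ne_zero_iff.2 hμ), one_smul]

/-- The group law `(x, u)(x', u') = (x + x', u + u' + [x, x'] / 2)` of the simply connected group
`G`, identified with `𝔳 × 𝔷` by the exponential map. -/
def mul (D : HTypeAlgebra V Z) (g h : V × Z) : V × Z :=
  (g.1 + h.1, g.2 + h.2 + (1 / 2 : ℝ) • D.bracket g.1 h.1)

/-- The sub-Riemannian geodesic `γ_{ν,λ}` of charge `λ ≠ 0` and guiding centre the origin:
`γ_{ν,λ}(s) = (e^{s J_λ} J_λ⁻¹ ν, s |ν|² λ / (2 |λ|²))`. -/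
def helix (D : HTypeAlgebra V Z) (ν : V) (lam : Z) (s : ℝ) : V × Z :=
  (NormedSpace.exp (s • D.J lam) (Ring.inverse (D.J lam) ν),
    (s * ‖ν‖ ^ 2 / (2 * ‖lam‖ ^ 2)) • lam)

theorem inverse_J (D : HTypeAlgebra V Z) {lam : Z} (h : lam ≠ 0) :
    Ring.inverse (D.J lam) = -(‖lam‖ ^ 2)⁻¹ • D.J lam := by
  have hn : ‖lam‖ ^ 2 ≠ 0 := pow_ne_zero 2 (norm_ne_zero_iff.2 h)
  have h1 : D.J lam * (-(‖lam‖ ^ 2)⁻¹ • D.J lam) = 1 := by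
    ext x; simp [D.J_J, smul_smul, hn]
  have h2 : (-(‖lam‖ ^ 2)⁻¹ • D.J lam) * D.J lam = 1 := by
    ext x; simp [D.J_J, smul_smul, hn]
  exact Ring.inverse_unit ⟨D.J lam, _, h1, h2⟩

theorem exp_smul_J (D : HTypeAlgebra V Z) {lam : Z} (h : lam ≠ 0) (s : ℝ) :
    NormedSpace.exp (s • D.J lam)
      = Real.cos (‖lam‖ * s) • (1 : V →L[ℝ] V) + (Real.sin (‖lam‖ * s) / ‖lam‖) • D.J lam := by
  have hn : ‖lam‖ ≠ 0 := norm_ne_zero_iff.2 h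
  have hsq : D.J lam * D.J lam = -(‖lam‖ ^ 2) • (1 : V →L[ℝ] V) := by
    ext x; simp [D.J_J]
  let Q : ℝ → (V →L[ℝ] V) := fun s =>
    Real.cos (‖lam‖ * s) • (1 : V →L[ℝ] V) + (Real.sin (‖lam‖ * s) / ‖lam‖) • D.J lam
  have hQ : ∀ s, HasDerivAt Q (D.J lam * Q s) s := fun s => by
    have hm : HasDerivAt (fun s : ℝ => ‖lam‖ * s) ‖lam‖ s := by
      simpa using (hasDerivAt_id s).const_mul ‖lam‖
    have h1 := (hm.cos.smul_const (1 : V →L[ℝ] V)).add ((hm.sin.div_const ‖lam‖).smul_const (D.J lam))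
    have h2 : (-Real.sin (‖lam‖ * s) * ‖lam‖) • (1 : V →L[ℝ] V)
        + (Real.cos (‖lam‖ * s) * ‖lam‖ / ‖lam‖) • D.J lam = D.J lam * Q s := by
      simp only [Q, mul_add, mul_smul_comm, mul_one, hsq, smul_smul]
      rw [add_comm, mul_div_assoc, div_self hn, mul_one]
      congr 2
      field_simp
    rw [h2] at h1
    exact h1
  have hE : ∀ s : ℝ, HasDerivAt (fun s : ℝ => NormedSpace.exp (s • (-D.J lam)) * Q s) 0 s :=
    fun s => by
      have h1 := (hasDerivAt_exp_smul_const (𝕂 := ℝ) (-D.J lam) s).mul (hQ s)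
      have h2 : NormedSpace.exp (s • (-D.J lam)) * (-D.J lam) * Q s
          + NormedSpace.exp (s • (-D.J lam)) * (D.J lam * Q s) = 0 := by
        rw [mul_neg, neg_mul, mul_assoc, neg_add_cancel]
      rw [h2] at h1
      exact h1
  have hconst := is_const_of_deriv_eq_zero (fun s => (hE s).differentiableAt)
    (fun s => (hE s).deriv) s 0
  have h0 : NormedSpace.exp (s • (-D.J lam)) * Q s = 1 := by
    simpa [Q] using hconst
  have hinv : NormedSpace.exp (s • D.J lam) * NormedSpace.exp (s • (-D.J lam)) = 1 := by
    let _ : NormedAlgebra ℚ (V →L[ℝ] V) := NormedAlgebra.restrictScalars ℚ ℝ (V →L[ℝ] V)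
    rw [smul_neg, ← NormedSpace.exp_add_of_commute (Commute.refl _).neg_right]
    simp
  calc NormedSpace.exp (s • D.J lam)
      = NormedSpace.exp (s • D.J lam) * (NormedSpace.exp (s • (-D.J lam)) * Q s) := by
        rw [h0, mul_one]
    _ = Q s := by rw [← mul_assoc, hinv, one_mul]

/-- The X-ray transform `I_{ν,λ} f (x, u) = ∫ f((x, u) γ_{ν,λ}(s)) ds` over the geodesic
`(x, u) γ_{ν,λ}`. For integrable `f` and `λ ≠ 0` the integral converges absolutely for almost every
`(x, u)`. -/
def xray (D : HTypeAlgebra V Z) (f : V × Z → ℂ) (ν : V) (lam : Z) (g : V × Z) : ℂ :=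
  ∫ s : ℝ, f (D.mul g (D.helix ν lam s))

end HTypeAlgebra

end Algebra

section Fock

/-- The probability measure `π⁻ⁿ e^{-|ζ|²} dζ` on `ℂⁿ`. -/
def gaussian (n : ℕ) : Measure (EuclideanSpace ℂ (Fin n)) :=
  volume.withDensity fun ζ => ENNReal.ofReal (Real.exp (-‖ζ‖ ^ 2) / Real.pi ^ n)

theorem measurable_density (n : ℕ) : Measurable fun ζ : EuclideanSpace ℂ (Fin n) =>
    ENNReal.ofReal (Real.exp (-‖ζ‖ ^ 2) / Real.pi ^ n) := by
  fun_prop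

theorem finrank_real_euclidean (n : ℕ) : finrank ℝ (EuclideanSpace ℂ (Fin n)) = 2 * n := by
  rw [← finrank_mul_finrank ℝ ℂ (EuclideanSpace ℂ (Fin n)), Complex.finrank_real_complex]
  simp

instance isProbabilityMeasure_gaussian (n : ℕ) : IsProbabilityMeasure (gaussian n) := by
  have h := GaussianFourier.integral_rexp_neg_mul_sq_norm (V := EuclideanSpace ℂ (Fin n))
    (b := 1) one_pos
  have hr : (Real.pi / 1 : ℝ) ^ ((finrank ℝ (EuclideanSpace ℂ (Fin n)) : ℝ) / 2)
      = Real.pi ^ n := by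
    rw [finrank_real_euclidean, div_one, Nat.cast_mul, Nat.cast_ofNat,
      mul_div_cancel_left₀ _ (two_ne_zero), Real.rpow_natCast]
  rw [hr] at h
  have hpi : (0 : ℝ) < Real.pi ^ n := by positivity
  have h1 : ∫ ζ : EuclideanSpace ℂ (Fin n), Real.exp (-‖ζ‖ ^ 2) / Real.pi ^ n = 1 := by
    rw [integral_div]
    simp only [neg_mul, one_mul] at h
    rw [h, div_self hpi.ne']
  have hi : Integrable fun ζ : EuclideanSpace ℂ (Fin n) => Real.exp (-‖ζ‖ ^ 2) / Real.pi ^ n := by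
    by_contra hc
    rw [integral_undef hc] at h1
    exact zero_ne_one h1
  refine ⟨?_⟩
  rw [gaussian, withDensity_apply _ MeasurableSet.univ, Measure.restrict_univ,
    ← ofReal_integral_eq_lintegral_ofReal hi (Filter.Eventually.of_forall fun ζ => by positivity),
    h1, ENNReal.ofReal_one]

theorem volume_absolutelyContinuous_gaussian (n : ℕ) :
    (volume : Measure (EuclideanSpace ℂ (Fin n))) ≪ gaussian n := by
  refine withDensity_absolutelyContinuous' (measurable_density n).aemeasurable ?_
  refine Filter.Eventually.of_forall fun ζ => ?_
  have : 0 < Real.exp (-‖ζ‖ ^ 2) / Real.pi ^ n := by positivity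
  simpa using this

/-- The Bargmann--Fock space as a space of functions: the entire functions `F` on `ℂⁿ` with
`π⁻ⁿ ∫ |F(ζ)|² e^{-|ζ|²} dζ < ∞`. -/
def fockSubmodule (n : ℕ) : Submodule ℂ (EuclideanSpace ℂ (Fin n) → ℂ) where
  carrier := {F | Differentiable ℂ F ∧ MemLp F 2 (gaussian n)}
  add_mem' := fun ha hb => ⟨ha.1.add hb.1, ha.2.add hb.2⟩
  zero_mem' := ⟨differentiable_const 0, MemLp.zero⟩
  smul_mem' := fun c _ ha => ⟨ha.1.const_smul c, ha.2.const_smul c⟩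

/-- The Bargmann--Fock space. Its inner product is `π⁻ⁿ ∫ conj F(ζ) G(ζ) e^{-|ζ|²} dζ`
(see `inner_fock`). -/
def Fock (n : ℕ) : Type := fockSubmodule n

namespace Fock

variable {n : ℕ}

instance : AddCommGroup (Fock n) := inferInstanceAs (AddCommGroup (fockSubmodule n))

instance : Module ℂ (Fock n) := inferInstanceAs (Module ℂ (fockSubmodule n))

instance : CoeFun (Fock n) (fun _ => EuclideanSpace ℂ (Fin n) → ℂ) := ⟨fun φ => φ.1⟩

theorem differentiable (φ : Fock n) : Differentiable ℂ φ := φ.2.1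

theorem memLp (φ : Fock n) : MemLp φ 2 (gaussian n) := φ.2.2

theorem continuous (φ : Fock n) : Continuous φ := φ.differentiable.continuous

@[ext] theorem ext {φ ψ : Fock n} (h : ∀ ζ, φ ζ = ψ ζ) : φ = ψ := Subtype.ext (funext h)

@[simp] theorem add_apply (φ ψ : Fock n) (ζ : EuclideanSpace ℂ (Fin n)) :
    (φ + ψ) ζ = φ ζ + ψ ζ := rfl

@[simp] theorem sub_apply (φ ψ : Fock n) (ζ : EuclideanSpace ℂ (Fin n)) :
    (φ - ψ) ζ = φ ζ - ψ ζ := rfl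

@[simp] theorem zero_apply (ζ : EuclideanSpace ℂ (Fin n)) : (0 : Fock n) ζ = 0 := rfl

@[simp] theorem smul_apply (c : ℂ) (φ : Fock n) (ζ : EuclideanSpace ℂ (Fin n)) :
    (c • φ) ζ = c * φ ζ := rfl

/-- The inclusion of the Bargmann--Fock space into the Gaussian `L²` space. -/
def toL2 (n : ℕ) : Fock n →ₗ[ℂ] Lp ℂ 2 (gaussian n) where
  toFun φ := φ.memLp.toLp φ
  map_add' φ ψ := MemLp.toLp_add φ.memLp ψ.memLp
  map_smul' c φ := MemLp.toLp_const_smul c φ.memLp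

theorem coeFn_toL2 (φ : Fock n) : toL2 n φ =ᵐ[gaussian n] φ := MemLp.coeFn_toLp φ.memLp

theorem eq_of_ae_eq {f g : EuclideanSpace ℂ (Fin n) → ℂ} (hf : Continuous f) (hg : Continuous g)
    (h : f =ᵐ[gaussian n] g) : f = g :=
  (hf.ae_eq_iff_eq volume hg).1 ((volume_absolutelyContinuous_gaussian n).ae_eq h)

theorem toL2_injective (n : ℕ) : Function.Injective (toL2 n) := fun φ ψ h => by
  have h1 : (φ : EuclideanSpace ℂ (Fin n) → ℂ) =ᵐ[gaussian n] ψ := by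
    refine (coeFn_toL2 φ).symm.trans ?_
    rw [h]
    exact coeFn_toL2 ψ
  exact Fock.ext (congrFun (eq_of_ae_eq φ.continuous ψ.continuous h1))

instance : NormedAddCommGroup (Fock n) :=
  NormedAddCommGroup.induced (Fock n) (Lp ℂ 2 (gaussian n)) (toL2 n) (toL2_injective n)

instance : InnerProductSpace ℂ (Fock n) := InnerProductSpace.induced (toL2 n)

theorem norm_def (φ : Fock n) : ‖φ‖ = ‖toL2 n φ‖ := rfl

theorem norm_eq (φ : Fock n) : ‖φ‖ = (eLpNorm φ 2 (gaussian n)).toReal :=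
  Lp.norm_toLp _ φ.memLp

theorem inner_fock (φ ψ : Fock n) :
    inner ℂ φ ψ = ∫ ζ, starRingEnd ℂ (φ ζ) * ψ ζ ∂gaussian n := by
  change inner ℂ (toL2 n φ) (toL2 n ψ) = _
  rw [L2.inner_def]
  refine integral_congr_ae ?_
  filter_upwards [coeFn_toL2 φ, coeFn_toL2 ψ] with ζ h1 h2
  rw [h1, h2, RCLike.inner_apply']

/-- The function `π_h(z, t) F` of the variable `ζ`, where `π_h` is the Bargmann--Fock
representation of the Heisenberg group `ℂⁿ × ℝ` with parameter `h > 0`: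
`π_h(z, t) F(ζ) = e^{i h t - √(h/2) ζ · conj z - h |z|² / 4} F(ζ + √(h/2) z)`. -/
def bargmannFun (h : ℝ) (z : EuclideanSpace ℂ (Fin n)) (t : ℝ)
    (F : EuclideanSpace ℂ (Fin n) → ℂ) (ζ : EuclideanSpace ℂ (Fin n)) : ℂ :=
  Complex.exp (Complex.I * h * t - Real.sqrt (h / 2) * (∑ j, ζ j * starRingEnd ℂ (z j))
    - h / 4 * ‖z‖ ^ 2) * F (ζ + (Real.sqrt (h / 2) : ℂ) • z)

theorem sum_mul_conj (z ζ : EuclideanSpace ℂ (Fin n)) :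
    ∑ j, ζ j * starRingEnd ℂ (z j) = inner ℂ z ζ := by
  simp [PiLp.inner_apply]

theorem norm_bargmannFun {h : ℝ} (hh : 0 ≤ h) (z : EuclideanSpace ℂ (Fin n)) (t : ℝ)
    (F : EuclideanSpace ℂ (Fin n) → ℂ) (ζ : EuclideanSpace ℂ (Fin n)) :
    ‖bargmannFun h z t F ζ‖ = Real.exp (‖ζ‖ ^ 2 / 2)
      * (Real.exp (-‖ζ + (Real.sqrt (h / 2) : ℂ) • z‖ ^ 2 / 2)
        * ‖F (ζ + (Real.sqrt (h / 2) : ℂ) • z)‖) := by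
  rw [bargmannFun, norm_mul, Complex.norm_exp, ← mul_assoc, ← Real.exp_add, sum_mul_conj]
  congr 2
  have h1 : (Complex.I * h * t - Real.sqrt (h / 2) * inner ℂ z ζ - h / 4 * ‖z‖ ^ 2).re
      = - Real.sqrt (h / 2) * (inner ℂ z ζ).re - h / 4 * ‖z‖ ^ 2 := by
    have e1 : (h : ℂ) / 4 * (‖z‖ : ℂ) ^ 2 = ((h / 4 * ‖z‖ ^ 2 : ℝ) : ℂ) := by push_cast; ring
    rw [e1, Complex.sub_re, Complex.ofReal_re]
    simp
  rw [h1, @norm_add_sq ℂ, inner_smul_right, norm_smul, Complex.norm_real, Real.norm_eq_abs,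
    mul_pow, sq_abs, Real.sq_sqrt (by positivity)]
  have e2 : RCLike.re ((Real.sqrt (h / 2) : ℂ) * inner ℂ ζ z)
      = Real.sqrt (h / 2) * (inner ℂ z ζ).re := by
    rw [← inner_conj_symm ζ z, RCLike.re_eq_complex_re, Complex.re_ofReal_mul, Complex.conj_re]
  rw [e2]; ring

theorem differentiable_bargmannFun (h : ℝ) (z : EuclideanSpace ℂ (Fin n)) (t : ℝ)
    {F : EuclideanSpace ℂ (Fin n) → ℂ} (hF : Differentiable ℂ F) :
    Differentiable ℂ (bargmannFun h z t F) := by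
  unfold bargmannFun
  fun_prop

theorem eLpNorm_bargmannFun {h : ℝ} (hh : 0 ≤ h) (z : EuclideanSpace ℂ (Fin n)) (t : ℝ)
    {F : EuclideanSpace ℂ (Fin n) → ℂ} (hF : Continuous F) :
    eLpNorm (bargmannFun h z t F) 2 (gaussian n) = eLpNorm F 2 (gaussian n) := by
  have key : ∀ G : EuclideanSpace ℂ (Fin n) → ℂ, Measurable G →
      eLpNorm G 2 (gaussian n) = (∫⁻ ζ, ENNReal.ofReal
        ((Real.exp (-‖ζ‖ ^ 2 / 2) * ‖G ζ‖) ^ 2 / Real.pi ^ n)) ^ (1 / 2 : ℝ) := fun G hG => by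
    rw [eLpNorm_eq_lintegral_rpow_enorm_toReal two_ne_zero ENNReal.ofNat_ne_top, gaussian,
      lintegral_withDensity_eq_lintegral_mul _ (measurable_density n) (by fun_prop)]
    simp only [ENNReal.toReal_ofNat, Pi.mul_apply]
    congr 1
    refine lintegral_congr fun ζ => ?_
    rw [show (2 : ℝ) = ((2 : ℕ) : ℝ) by norm_num, ENNReal.rpow_natCast, ← ofReal_norm,
      ← ENNReal.ofReal_pow (norm_nonneg _), ← ENNReal.ofReal_mul (by positivity)]
    congr 1
    rw [mul_pow, ← Real.exp_nat_mul]
    push_cast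
    ring_nf
  by_cases hG : Continuous (bargmannFun h z t F)
  · rw [key _ hG.measurable, key _ hF.measurable]
    congr 1
    refine Eq.trans (lintegral_congr fun ζ => ?_) (lintegral_add_right_eq_self
      (fun ζ => ENNReal.ofReal ((Real.exp (-‖ζ‖ ^ 2 / 2) * ‖F ζ‖) ^ 2 / Real.pi ^ n))
      ((Real.sqrt (h / 2) : ℂ) • z))
    rw [norm_bargmannFun hh, ← mul_assoc, ← Real.exp_add]
    congr 3
    rw [show -‖ζ‖ ^ 2 / 2 + ‖ζ‖ ^ 2 / 2 = 0 by ring, Real.exp_zero, one_mul]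
  · exact absurd (by unfold bargmannFun; fun_prop) hG

theorem bargmannFun_mem {h : ℝ} (hh : 0 ≤ h) (z : EuclideanSpace ℂ (Fin n)) (t : ℝ)
    {F : EuclideanSpace ℂ (Fin n) → ℂ} (hF : F ∈ fockSubmodule n) :
    bargmannFun h z t F ∈ fockSubmodule n :=
  ⟨differentiable_bargmannFun h z t hF.1,
    (differentiable_bargmannFun h z t hF.1).continuous.aestronglyMeasurable, by
      rw [eLpNorm_bargmannFun hh z t hF.1.continuous]; exact hF.2.2⟩

/-- The operator `π_h(z, t)` of the Bargmann--Fock representation, acting on the Bargmann--Fock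
space. -/
def bargmann (h : ℝ) (hh : 0 ≤ h) (z : EuclideanSpace ℂ (Fin n)) (t : ℝ) :
    Fock n →ₗᵢ[ℂ] Fock n where
  toFun φ := ⟨bargmannFun h z t φ, bargmannFun_mem hh z t φ.2⟩
  map_add' φ ψ := Fock.ext fun ζ => mul_add _ _ _
  map_smul' c φ := Fock.ext fun ζ => mul_left_comm _ _ _
  norm_map' φ := by
    rw [norm_eq, norm_eq]
    exact congrArg ENNReal.toReal (eLpNorm_bargmannFun hh z t φ.continuous)

theorem bargmann_apply (h : ℝ) (hh : 0 ≤ h) (z : EuclideanSpace ℂ (Fin n)) (t : ℝ) (φ : Fock n)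
    (ζ : EuclideanSpace ℂ (Fin n)) :
    bargmann h hh z t φ ζ = bargmannFun h z t φ ζ := rfl

theorem measurePreserving_gaussian
    (e : EuclideanSpace ℂ (Fin n) ≃ₗᵢ[ℝ] EuclideanSpace ℂ (Fin n)) :
    MeasurePreserving e (gaussian n) (gaussian n) := by
  refine ⟨e.continuous.measurable, ?_⟩
  ext s hs
  rw [Measure.map_apply e.continuous.measurable hs, gaussian,
    withDensity_apply _ (e.continuous.measurable hs), withDensity_apply _ hs,
    ← e.measurePreserving.setLIntegral_comp_preimage hs (measurable_density n)]
  simp only [e.norm_map]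

/-- Multiplication by a unit complex number. -/
def rot (c : Circle) : EuclideanSpace ℂ (Fin n) ≃ₗᵢ[ℝ] EuclideanSpace ℂ (Fin n) where
  toFun ζ := (c : ℂ) • ζ
  map_add' := smul_add _
  map_smul' r ζ := smul_comm _ _ _
  invFun ζ := (c : ℂ)⁻¹ • ζ
  left_inv ζ := inv_smul_smul₀ c.coe_ne_zero ζ
  right_inv ζ := smul_inv_smul₀ c.coe_ne_zero ζ
  norm_map' ζ := by
    change ‖(c : ℂ) • ζ‖ = ‖ζ‖
    rw [norm_smul, Circle.norm_coe, one_mul]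

theorem integrable (φ : Fock n) : Integrable φ (gaussian n) :=
  φ.memLp.integrable (by norm_num)

/-- The mean value property. -/
theorem integral_gaussian (φ : Fock n) : ∫ ζ, φ ζ ∂gaussian n = φ 0 := by
  have hrot : ∀ c : Circle, ∫ ζ, φ ((c : ℂ) • ζ) ∂gaussian n = ∫ ζ, φ ζ ∂gaussian n := fun c =>
    (measurePreserving_gaussian (rot c)).integral_comp
      (rot c).toHomeomorph.measurableEmbedding φ
  have hmean : ∀ ζ : EuclideanSpace ℂ (Fin n),
      ∫ θ in (0 : ℝ)..2 * Real.pi, φ ((Circle.exp θ : ℂ) • ζ) = (2 * Real.pi) • φ 0 := fun ζ => by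
    have hd : Differentiable ℂ fun w : ℂ => φ (w • ζ) :=
      φ.differentiable.comp (differentiable_id.smul_const ζ)
    have h := (hd.diffContOnCl (s := Metric.ball 0 |1|)).circleAverage
    rw [Real.circleAverage_def, zero_smul] at h
    rw [← h, smul_smul, mul_inv_cancel₀ (by positivity), one_smul]
    simp [circleMap]
  have hint : Integrable (Function.uncurry fun (θ : ℝ) (ζ : EuclideanSpace ℂ (Fin n)) =>
      φ ((Circle.exp θ : ℂ) • ζ))
      ((volume.restrict (Set.uIoc 0 (2 * Real.pi))).prod (gaussian n)) := by
    have hc : Continuous (Function.uncurry fun (θ : ℝ) (ζ : EuclideanSpace ℂ (Fin n)) =>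
        φ ((Circle.exp θ : ℂ) • ζ)) := by
      refine φ.continuous.comp ?_
      fun_prop
    refine (integrable_prod_iff hc.aestronglyMeasurable).2 ⟨?_, ?_⟩
    · exact Filter.Eventually.of_forall fun θ =>
        (measurePreserving_gaussian (rot (Circle.exp θ))).integrable_comp_of_integrable φ.integrable
    · have h1 : ∀ θ : ℝ, ∫ ζ, ‖φ ((Circle.exp θ : ℂ) • ζ)‖ ∂gaussian n
          = ∫ ζ, ‖φ ζ‖ ∂gaussian n := fun θ =>
        (measurePreserving_gaussian (rot (Circle.exp θ))).integral_comp
          (rot (Circle.exp θ)).toHomeomorph.measurableEmbedding fun ζ => ‖φ ζ‖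
      simp only [Function.uncurry_apply_pair, h1]
      have : IsFiniteMeasure (volume.restrict (Set.uIoc 0 (2 * Real.pi))) :=
        ⟨by
          rw [Measure.restrict_apply_univ, Set.uIoc, Real.volume_Ioc]
          exact ENNReal.ofReal_lt_top⟩
      exact integrable_const _
  have hsw := intervalIntegral_integral_swap hint
  simp only [hrot, hmean] at hsw
  rw [intervalIntegral.integral_const, sub_zero, integral_const] at hsw
  simp only [probReal_univ, one_smul] at hsw
  exact smul_right_injective ℂ (r := 2 * Real.pi) (by positivity) hsw

theorem norm_apply_zero_le (φ : Fock n) : ‖φ 0‖ ≤ ‖φ‖ := by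
  rw [← integral_gaussian φ, norm_eq]
  refine (norm_integral_le_integral_norm _).trans ?_
  rw [integral_norm_eq_lintegral_enorm φ.continuous.aestronglyMeasurable,
    ← eLpNorm_one_eq_lintegral_enorm]
  exact ENNReal.toReal_mono φ.memLp.2.ne
    (eLpNorm_le_eLpNorm_of_exponent_le (by norm_num) φ.continuous.aestronglyMeasurable)

/-- Point evaluations on the Bargmann--Fock space are bounded. -/
theorem norm_apply_le (φ : Fock n) (ζ : EuclideanSpace ℂ (Fin n)) :
    ‖φ ζ‖ ≤ Real.exp (‖ζ‖ ^ 2 / 2) * ‖φ‖ := by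
  have h := norm_apply_zero_le (bargmann 2 zero_le_two ζ 0 φ)
  rw [LinearIsometry.norm_map, bargmann_apply, norm_bargmannFun zero_le_two] at h
  simp only [norm_zero, ne_eq, OfNat.ofNat_ne_zero, not_false_eq_true, zero_pow, zero_div,
    Real.exp_zero, one_mul, div_self, Real.sqrt_one, Complex.ofReal_one, one_smul, zero_add] at h
  calc ‖φ ζ‖ = Real.exp (‖ζ‖ ^ 2 / 2) * (Real.exp (-‖ζ‖ ^ 2 / 2) * ‖φ ζ‖) := by
        rw [← mul_assoc, ← Real.exp_add, ← add_div, add_neg_cancel, zero_div, Real.exp_zero,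
          one_mul]
    _ ≤ _ := by gcongr

theorem norm_fderiv_le (φ : Fock n) (ζ : EuclideanSpace ℂ (Fin n)) :
    ‖fderiv ℂ φ ζ‖ ≤ Real.exp ((‖ζ‖ + 1) ^ 2 / 2) * ‖φ‖ := by
  refine ContinuousLinearMap.opNorm_le_of_unit_norm (by positivity) fun v hv => ?_
  have hd : HasDerivAt (fun w : ℂ => φ (ζ + w • v)) (fderiv ℂ φ ζ v) 0 :=
    (φ.differentiable ζ).hasFDerivAt.hasLineDerivAt v
  have hdiff : Differentiable ℂ fun w : ℂ => φ (ζ + w • v) :=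
    φ.differentiable.comp ((differentiable_id.smul_const v).const_add ζ)
  rw [← hd.deriv]
  refine (Complex.norm_deriv_le_of_forall_mem_sphere_norm_le one_pos hdiff.diffContOnCl
    fun w hw => ?_).trans (div_one _).le
  have hw1 : ‖w‖ = 1 := by simpa using hw
  refine (norm_apply_le φ _).trans ?_
  have : ‖ζ + w • v‖ ≤ ‖ζ‖ + 1 := by
    refine (norm_add_le _ _).trans ?_
    rw [norm_smul, hw1, hv, one_mul]
  gcongr

theorem fderiv_sub (φ ψ : Fock n) (ζ : EuclideanSpace ℂ (Fin n)) :
    fderiv ℂ (φ - ψ : Fock n) ζ = fderiv ℂ φ ζ - fderiv ℂ ψ ζ :=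
  _root_.fderiv_sub (φ.differentiable ζ) (ψ.differentiable ζ)

instance : CompleteSpace (Fock n) := by
  refine Metric.complete_of_cauchySeq_tendsto fun u hu => ?_
  have hu' : ∀ C : ℝ, 0 < C → ∀ ε > 0, ∃ N, ∀ k ≥ N, ∀ l ≥ N, C * ‖u k - u l‖ < ε := by
    intro C hC ε hε
    obtain ⟨N, hN⟩ := Metric.cauchySeq_iff.1 hu (ε / C) (by positivity)
    refine ⟨N, fun k hk l hl => ?_⟩
    have h := hN k hk l hl
    rw [dist_eq_norm, lt_div_iff₀ hC] at h
    linarith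
  have hpt : ∀ ζ, ∃ y, Filter.Tendsto (fun k => u k ζ) Filter.atTop (nhds y) := fun ζ => by
    refine cauchySeq_tendsto_of_complete (Metric.cauchySeq_iff.2 fun ε hε => ?_)
    obtain ⟨N, hN⟩ := hu' (Real.exp (‖ζ‖ ^ 2 / 2)) (Real.exp_pos _) ε hε
    refine ⟨N, fun k hk l hl => ?_⟩
    rw [dist_eq_norm, ← sub_apply]
    exact (norm_apply_le _ _).trans_lt (hN k hk l hl)
  choose F hF using hpt
  have hunif : ∀ r : ℝ, 0 < r → UniformCauchySeqOn (fun k => fderiv ℂ (u k)) Filter.atTop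
      (Metric.ball (0 : EuclideanSpace ℂ (Fin n)) r) := fun r hr => by
    refine Metric.uniformCauchySeqOn_iff.2 fun ε hε => ?_
    obtain ⟨N, hN⟩ := hu' (Real.exp ((r + 1) ^ 2 / 2)) (Real.exp_pos _) ε hε
    refine ⟨N, fun k hk l hl ζ hζ => ?_⟩
    have hζ' : ‖ζ‖ ≤ r := by simpa using (Metric.mem_ball.1 hζ).le
    rw [dist_eq_norm, ← fderiv_sub]
    refine (norm_fderiv_le _ _).trans_lt (lt_of_le_of_lt ?_ (hN k hk l hl))
    gcongr
  have hpt' : ∀ ζ, ∃ y, Filter.Tendsto (fun k => fderiv ℂ (u k) ζ) Filter.atTop (nhds y) :=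
    fun ζ => cauchySeq_tendsto_of_complete
      ((hunif (‖ζ‖ + 1) (by positivity)).cauchySeq (by simp))
  choose F' hF' using hpt'
  have hdiff : Differentiable ℂ F := fun ζ => by
    refine (hasFDerivAt_of_tendstoUniformlyOn (x := ζ) (g' := F') Metric.isOpen_ball
      ((hunif (‖ζ‖ + 1) (by positivity)).tendstoUniformlyOn_of_tendsto fun ξ _ => hF' ξ)
      (fun k ξ _ => ((u k).differentiable ξ).hasFDerivAt) (fun ξ _ => hF ξ)
      (by simp)).differentiableAt
  have hL : CauchySeq fun k => toL2 n (u k) := by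
    refine Metric.cauchySeq_iff.2 fun ε hε => ?_
    obtain ⟨N, hN⟩ := Metric.cauchySeq_iff.1 hu ε hε
    exact ⟨N, fun k hk l hl => hN k hk l hl⟩
  obtain ⟨G, hG⟩ := cauchySeq_tendsto_of_complete hL
  obtain ⟨ns, hns, hae⟩ := (tendstoInMeasure_of_tendsto_Lp hG).exists_seq_tendsto_ae
  have hGF : G =ᵐ[gaussian n] F := by
    have hall : ∀ᵐ ζ ∂gaussian n, ∀ k, toL2 n (u k) ζ = u k ζ :=
      ae_all_iff.2 fun k => coeFn_toL2 (u k)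
    filter_upwards [hae, hall] with ζ h1 h2
    simp only [h2] at h1
    exact tendsto_nhds_unique h1 ((hF ζ).comp hns.tendsto_atTop)
  let φ : Fock n := ⟨F, hdiff, (Lp.memLp G).ae_eq hGF⟩
  have hφ : toL2 n φ = G := Lp.ext ((coeFn_toL2 φ).trans hGF.symm)
  refine ⟨φ, Metric.tendsto_atTop.2 fun ε hε => ?_⟩
  obtain ⟨N, hN⟩ := Metric.tendsto_atTop.1 hG ε hε
  refine ⟨N, fun k hk => ?_⟩
  have h := hN k hk
  rw [← hφ] at h
  exact h

end Fock
end Fock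
section Fourier

variable {V : Type u} {Z : Type w}
  [NormedAddCommGroup V] [InnerProductSpace ℝ V] [FiniteDimensional ℝ V]
  [NormedAddCommGroup Z] [InnerProductSpace ℝ Z] [FiniteDimensional ℝ Z]

namespace HTypeAlgebra

/-- The irreducible unitary representation `π_μ = π_{|μ|} ∘ α_μ` of `G`, `μ ≠ 0`, on the
Bargmann--Fock space, where `α_μ(x, u) = (R_μᵗ x, μ · u / |μ|)`. -/
def rep (D : HTypeAlgebra V Z) (μ : Z) (hμ : μ ≠ 0) (g : V × Z) :
    Fock (finrank ℝ V / 2) →ₗᵢ[ℂ] Fock (finrank ℝ V / 2) :=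
  Fock.bargmann ‖μ‖ (norm_nonneg μ) ((D.frame μ hμ).symm g.1) (inner ℝ μ g.2 / ‖μ‖)

theorem rep_mul (D : HTypeAlgebra V Z) (μ : Z) (hμ : μ ≠ 0) (g h : V × Z)
    (φ : Fock (finrank ℝ V / 2)) :
    D.rep μ hμ (D.mul g h) φ = D.rep μ hμ g (D.rep μ hμ h φ) := by
  have hn : ‖μ‖ ≠ 0 := norm_ne_zero_iff.2 hμ
  obtain ⟨z, hz⟩ := (D.frame μ hμ).surjective g.1
  obtain ⟨z', hz'⟩ := (D.frame μ hμ).surjective h.1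
  have hbr : inner ℝ μ (D.bracket g.1 h.1) = ‖μ‖ * (inner ℂ z z').im := by
    rw [← D.inner_J, ← hz, ← hz', D.J_frame, real_inner_smul_left, LinearIsometryEquiv.inner_map_map]
    congr 1
    have hre : ∀ a b : EuclideanSpace ℂ (Fin (finrank ℝ V / 2)),
        inner ℝ a b = (inner ℂ a b).re := fun a b => by
      simp [PiLp.inner_apply, Complex.inner, mul_comm]
    rw [hre, inner_smul_left]
    simp
  refine Fock.ext fun ζ => ?_
  simp only [rep, mul, Fock.bargmann_apply, Fock.bargmannFun, ← hz, ← hz', ← map_add,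
    LinearIsometryEquiv.symm_apply_apply, Fock.sum_mul_conj]
  rw [hz, hz', ← mul_assoc, ← Complex.exp_add, smul_add, ← add_assoc ζ]
  congr 2
  have hs : (Real.sqrt (‖μ‖ / 2) : ℂ) * Real.sqrt (‖μ‖ / 2) = (‖μ‖ : ℂ) / 2 := by
    rw [← Complex.ofReal_mul, Real.mul_self_sqrt (by positivity)]; push_cast; rfl
  have hnorm : ((‖z + z'‖ : ℝ) : ℂ) ^ 2
      = (‖z‖ : ℂ) ^ 2 + inner ℂ z z' + inner ℂ z' z + (‖z'‖ : ℂ) ^ 2 := by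
    have e := inner_self_eq_norm_sq_to_K (𝕜 := ℂ) (z + z')
    rw [inner_add_left, inner_add_right, inner_add_right, inner_self_eq_norm_sq_to_K,
      inner_self_eq_norm_sq_to_K] at e
    simp only [Complex.coe_algebraMap] at e
    rw [← e]; ring
  have him : inner ℂ z z' - inner ℂ z' z = 2 * Complex.I * ((inner ℂ z z').im : ℂ) := by
    rw [← inner_conj_symm z' z, Complex.sub_conj]; push_cast; ring
  have hnC : (‖μ‖ : ℂ) ≠ 0 := Complex.ofReal_ne_zero.2 hn
  rw [hnorm, inner_add_right, inner_add_right, real_inner_smul_right, hbr, inner_add_right,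
    inner_add_left, inner_smul_right]
  push_cast
  field_simp
  linear_combination (8 * inner ℂ z' z) * hs - 2 * (‖μ‖ : ℂ) * him

/-- Matrix coefficients of `π_μ` are bounded and measurable. -/
theorem stronglyMeasurable_coeff [MeasurableSpace V] [BorelSpace V] [MeasurableSpace Z]
    [BorelSpace Z] (D : HTypeAlgebra V Z) (μ : Z) (hμ : μ ≠ 0)
    (φ ψ : Fock (finrank ℝ V / 2)) :
    StronglyMeasurable fun g : V × Z => inner ℂ φ (D.rep μ hμ g ψ) := by
  simp only [Fock.inner_fock]
  refine StronglyMeasurable.integral_prod_right (Continuous.stronglyMeasurable ?_)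
  have h1 := φ.continuous
  have h2 := ψ.continuous
  simp only [rep, Fock.bargmann_apply, Fock.bargmannFun, Function.uncurry_def]
  fun_prop

variable [MeasurableSpace V] [BorelSpace V] [MeasurableSpace Z] [BorelSpace Z]

theorem integrable_coeff (D : HTypeAlgebra V Z) {f : V × Z → ℂ} (hf : Integrable f)
    (μ : Z) (hμ : μ ≠ 0) (φ ψ : Fock (finrank ℝ V / 2)) :
    Integrable fun g => starRingEnd ℂ (f g) * inner ℂ φ (D.rep μ hμ g ψ) := by
  have hf' : Integrable fun g => starRingEnd ℂ (f g) :=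
    Complex.conjCLE.toContinuousLinearMap.integrable_comp hf
  refine (hf'.bdd_mul (c := ‖φ‖ * ‖ψ‖)
    (D.stronglyMeasurable_coeff μ hμ φ ψ).aestronglyMeasurable ?_).congr ?_
  · refine Filter.Eventually.of_forall fun g => ?_
    exact (norm_inner_le_norm _ _).trans (by rw [LinearIsometry.norm_map])
  · exact Filter.Eventually.of_forall fun g => mul_comm _ _

/-- The bounded sesquilinear form `(φ, ψ) ↦ ∫ conj f(g) ⟪φ, π_μ(g) ψ⟫ dg`. -/
def fourierForm (D : HTypeAlgebra V Z) {f : V × Z → ℂ} (hf : Integrable f) (μ : Z) (hμ : μ ≠ 0) :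
    Fock (finrank ℝ V / 2) →L⋆[ℂ] Fock (finrank ℝ V / 2) →L[ℂ] ℂ :=
  LinearMap.mkContinuous₂
    (LinearMap.mk₂'ₛₗ (starRingEnd ℂ) (RingHom.id ℂ)
      (fun φ ψ => ∫ g, starRingEnd ℂ (f g) * inner ℂ φ (D.rep μ hμ g ψ))
      (fun φ φ' ψ => by
        rw [← integral_add (D.integrable_coeff hf μ hμ φ ψ) (D.integrable_coeff hf μ hμ φ' ψ)]
        simp only [inner_add_left, mul_add])
      (fun c φ ψ => by
        rw [smul_eq_mul, ← integral_const_mul]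
        simp only [inner_smul_left, mul_left_comm])
      (fun φ ψ ψ' => by
        rw [← integral_add (D.integrable_coeff hf μ hμ φ ψ) (D.integrable_coeff hf μ hμ φ ψ')]
        simp only [map_add, inner_add_right, mul_add])
      (fun c φ ψ => by
        rw [RingHom.id_apply, smul_eq_mul, ← integral_const_mul]
        simp only [map_smul, inner_smul_right, mul_left_comm]))
    (∫ g, ‖f g‖) fun φ ψ => by
      change ‖∫ g, starRingEnd ℂ (f g) * inner ℂ φ (D.rep μ hμ g ψ)‖ ≤ _
      rw [mul_assoc, ← integral_mul_const]
      refine norm_integral_le_of_norm_le (hf.norm.mul_const _)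
        (Filter.Eventually.of_forall fun g => ?_)
      rw [norm_mul, RCLike.norm_conj]
      gcongr
      exact (norm_inner_le_norm _ _).trans (by rw [LinearIsometry.norm_map])

/-- The group Fourier transform `ℱ(f)(μ) = ∫ f(g) π_μ(g)* dg` of `f ∈ L¹(G)`, a bounded operator on
the Bargmann--Fock space; the operator-valued integral is taken in the weak sense
(see `inner_fourier`). Here `dg` is the Lebesgue measure of `𝔳 × 𝔷`. -/
def fourier (D : HTypeAlgebra V Z) {f : V × Z → ℂ} (hf : Integrable f) (μ : Z) (hμ : μ ≠ 0) :
    Fock (finrank ℝ V / 2) →L[ℂ] Fock (finrank ℝ V / 2) :=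
  InnerProductSpace.continuousLinearMapOfBilin (D.fourierForm hf μ hμ)

/-- `⟪ψ, ℱ(f)(μ) φ⟫ = ∫ f(g) ⟪ψ, π_μ(g)* φ⟫ dg`. -/
theorem inner_fourier (D : HTypeAlgebra V Z) {f : V × Z → ℂ} (hf : Integrable f) (μ : Z)
    (hμ : μ ≠ 0) (φ ψ : Fock (finrank ℝ V / 2)) :
    inner ℂ ψ (D.fourier hf μ hμ φ)
      = ∫ g, f g * inner ℂ ψ
          (ContinuousLinearMap.adjoint (D.rep μ hμ g).toContinuousLinearMap φ) := by
  rw [← inner_conj_symm, fourier, InnerProductSpace.continuousLinearMapOfBilin_apply]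
  change starRingEnd ℂ (∫ g, starRingEnd ℂ (f g) * inner ℂ φ (D.rep μ hμ g ψ)) = _
  rw [← integral_conj]
  refine integral_congr_ae (Filter.Eventually.of_forall fun g => ?_)
  simp only [map_mul, RCLike.conj_conj, inner_conj_symm]
  rw [ContinuousLinearMap.adjoint_inner_right]
  rfl

/-- The truncated frequency space `L¹_Ω(G)`: the integrable `f` with `ℱ(f)(μ) = 0` for all nonzero
`μ` outside `Ω`. -/
def truncatedL1 (D : HTypeAlgebra V Z) (Ω : Set Z) : Set (V × Z → ℂ) :=
  {f | ∃ hf : Integrable f, ∀ (μ : Z) (hμ : μ ≠ 0), μ ∉ Ω → D.fourier hf μ hμ = 0}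

/-- `I_{ν,λ} f = 0` for every unit vector `ν` and every charge `λ ∈ S`, as an element of
`L¹(G / Γ_λ)`: the `Γ_λ`-invariant function `I_{ν,λ} f` on `G` vanishes almost everywhere. -/
def XrayVanishes (D : HTypeAlgebra V Z) (f : V × Z → ℂ) (S : Set Z) : Prop :=
  ∀ ν : V, ‖ν‖ = 1 → ∀ lam ∈ S, ∀ᵐ g : V × Z, D.xray f ν lam g = 0

end HTypeAlgebra

/-- The spherical cap `C_ε(λ₀)`. -/
def sphericalCap {Z : Type w} [NormedAddCommGroup Z] (ε : ℝ) (lam₀ : Z) : Set Z :=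
  {lam | lam ≠ 0 ∧ ‖lam‖ = ‖lam₀‖ ∧ ‖lam - lam₀‖ < ε * ‖lam₀‖}

end Fourier

end HTypeXray

end

/-! ### Laguerre values at products `d * p`, and the density of such products -/

noncomputable section

namespace HTypeXray

/-! A geodesic of charge `λ` is periodic up to the central translation by `π λ / |λ|³`. When `⟨μ, λ⟩
= 2 m |λ|³` with `m` an integer, `π_μ` is trivial on that translation, and unfolding the line
integral over one period (`integral_translate_eq_zero`) turns `I_{ν,λ} f = 0` into `∫ π_μ(γ(s))
ℱ(f)(μ) ds = 0` over the period. In the Bargmann model (`twistedVanish_fourier`) this says that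
every `Y` in the range of `ℱ(f)(μ)` satisfies `∫ e^{imθ} e^{-⟨y(θ), ζ⟩} Y(ζ + y(θ)) dθ = 0` for all
`ζ`, where `y(θ) = cos θ v + sin θ T v`, `|v|² = |μ| / (2 |λ|²)`, and `T` is the complex structure
`J_λ / |λ|` seen in the frame of `μ`. Everything then rests on uniqueness statements for entire
functions.

Case 1. Take `λ` parallel to `μ`, so that `T = i` and `|v|² = m`. On each complex line in the
direction of `v` the average sends `x^k` to a multiple of `x^{k+m}`, the factor being a nonzero
multiple of the Laguerre value `L_k^{(m)}(m)`; if none of these vanishes, `Y = 0`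
(`eq_zero_of_twisted_circle`). For `m = d p` with `p` an odd prime and `0 < d < p`, the normalised
Laguerre sum is `1` plus terms of `p`-adic norm below `1`, hence nonzero for every `k`
(`laguerre_sum_ne_zero`). Such `m` are dense enough on a multiplicative scale
(`exists_prime_mul_near`) for some resonant `|λ| = √(|μ| / (2m))` to fall in `[R, R(1+ε)]` once `|μ|
/ R²` is large.

Case 2. For large `|μ| / R²` the function `λ ↦ ⟨μ, λ⟩ / (2R³)` sweeps an interval of length more
than `2` on the cap (`exists_interval_on_cap`), so two charges not parallel to `μ` are resonant for
consecutive integers. Now `T = c i + s K` with `K` a quaternionic structure and `s ≠ 0`. Taking `ζ =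
0` and using rotations of quaternionic lines, the frequency `m` kills the components of `Y` of
degree at least `|m|` with the parity of `m` (`homPart_eq_zero_of_twistedVanish`). The two integers
cover both parities, so `Y` is a polynomial of small degree; a contour deformation then removes its
top component, one degree at a time (`homPart_eq_zero_of_twistedVanish_of_le`). Thus `Y = 0`
(`eq_zero_of_twistedVanish`). -/

theorem not_pow_dvd_ascFactorial {p d j : ℕ} (hp : p.Prime) (hp2 : p ≠ 2) (hdp : d < p)
    (hj : 0 < j) : ¬ p ^ j ∣ (d * p + 1).ascFactorial j := by
  have : Fact p.Prime := ⟨hp⟩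
  have h3 : 3 ≤ p := by have := hp.two_le; omega
  intro hdvd
  rcases Nat.lt_or_ge 1 j with hj1 | hj1
  · have hne : (d * p + 1).ascFactorial j ≠ 0 := (Nat.ascFactorial_pos _ _).ne'
    have hv := (padicValNat_dvd_iff_le hne).1 hdvd
    have hfac := congrArg (padicValNat p) (Nat.factorial_mul_ascFactorial (d * p) j)
    rw [padicValNat.mul (Nat.factorial_ne_zero _) hne, mul_comm d p, padicValNat_factorial_mul,
      padicValNat.eq_zero_of_not_dvd (n := d.factorial)
        (fun h => absurd ((Nat.Prime.dvd_factorial hp).1 h) (by omega))] at hfac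
    -- Legendre: `(p-1) v_p(n!) < n` for `n = pd + j`, while `v_p((pd)!) = d` because `d < p`. A
    -- valuation of at least `j` would force `(p-2) j < d ≤ p-1`, impossible for `p ≥ 3` and `j ≥
    -- 2`.
    have hlt := sub_one_mul_padicValNat_factorial_lt_of_ne_zero (p := p) (n := p * d + j) (by omega)
    rw [← hfac] at hlt
    rw [mul_comm d p] at hv
    obtain ⟨q, rfl⟩ : ∃ q, p = q + 3 := ⟨p - 3, by omega⟩
    obtain ⟨i, rfl⟩ : ∃ i, j = i + 2 := ⟨j - 2, by omega⟩
    have : (q + 3 - 1) * (0 + d + (i + 2)) < (q + 3) * d + (i + 2) :=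
      lt_of_le_of_lt (Nat.mul_le_mul_left _ (by omega)) hlt
    have e : q + 3 - 1 = q + 2 := by omega
    rw [e] at this
    nlinarith [Nat.zero_le (q * i)]
  -- The Legendre bound does not exclude `j = 1`, `d = p - 1`; here `dp + 1 ≡ 1` modulo `p` settles
  -- it.
  · obtain rfl : j = 1 := by omega
    rw [pow_one, Nat.ascFactorial_succ, Nat.ascFactorial_zero] at hdvd
    have h1 : p ∣ 1 := (Nat.dvd_add_right (Dvd.intro_left d rfl)).1 (by simpa using hdvd)
    exact hp.one_lt.ne' (Nat.dvd_one.1 h1)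

/-- The term `j = 0` is `1`. For `j ≥ 1` the numerator is divisible by `p^j` and the denominator is
not, so the term has `p`-adic norm below `1` and cannot help to cancel the `1`. -/
theorem laguerre_sum_ne_zero_rat {p d : ℕ} (hp : p.Prime) (hp2 : p ≠ 2) (hdp : d < p) (k : ℕ) :
    ∑ j ∈ Finset.range (k + 1),
      (-((d * p : ℕ) : ℚ)) ^ j * (k.choose j : ℚ) / ((d * p + 1).ascFactorial j : ℚ) ≠ 0 := by
  have : Fact p.Prime := ⟨hp⟩
  intro h0
  have h1 := congrArg (fun q : ℚ => (q : ℚ_[p])) h0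
  simp only [Rat.cast_sum, Rat.cast_zero] at h1
  rw [Finset.sum_range_succ'] at h1
  simp only [pow_zero, Nat.choose_zero_right, Nat.ascFactorial_zero, Nat.cast_one, mul_one,
    div_one, Rat.cast_one] at h1
  -- Ultrametric inequality: one term dominates the sum of all terms with `j ≥ 1`, which should
  -- equal `-1`. The range of `i` is dropped, as the bound on a term holds for every index.
  obtain ⟨i, -, hi⟩ := IsUltrametricDist.exists_norm_finsetSum_le (Finset.range k)
    (fun j => (((-((d * p : ℕ) : ℚ)) ^ (j + 1) * (k.choose (j + 1) : ℚ)
      / ((d * p + 1).ascFactorial (j + 1) : ℚ) : ℚ) : ℚ_[p]))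
  have hlt : ‖(((-((d * p : ℕ) : ℚ)) ^ (i + 1) * (k.choose (i + 1) : ℚ)
      / ((d * p + 1).ascFactorial (i + 1) : ℚ) : ℚ) : ℚ_[p])‖ < 1 := by
    have ha : (p : ℝ) ^ (-((i + 1 : ℕ) : ℤ)) < ‖(((d * p + 1).ascFactorial (i + 1) : ℕ) : ℚ_[p])‖ := by
      by_contra hc
      refine not_pow_dvd_ascFactorial hp hp2 hdp (Nat.succ_pos i) ?_
      have := (Padic.norm_int_le_pow_iff_dvd (p := p)
        (((d * p + 1).ascFactorial (i + 1) : ℕ) : ℤ) (i + 1)).1 (by simpa using hc)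
      exact_mod_cast this
    have hb : ‖(((d * p) ^ (i + 1) : ℕ) : ℚ_[p])‖ ≤ (p : ℝ) ^ (-((i + 1 : ℕ) : ℤ)) := by
      have := (Padic.norm_int_le_pow_iff_dvd (p := p)
        (((d * p) ^ (i + 1) : ℕ) : ℤ) (i + 1)).2
        (by exact_mod_cast pow_dvd_pow_of_dvd (Dvd.intro_left d rfl) (i + 1))
      exact_mod_cast this
    have hc : ‖((k.choose (i + 1) : ℕ) : ℚ_[p])‖ ≤ 1 := by
      simpa using Padic.norm_int_le_one (p := p) (k.choose (i + 1) : ℤ)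
    have hpos := lt_of_le_of_lt (norm_nonneg _) (lt_of_le_of_lt hb ha)
    push_cast at *
    rw [norm_div, norm_mul, norm_pow, norm_neg, div_lt_one hpos, ← norm_pow]
    calc _ ≤ ‖((d : ℚ_[p]) * p) ^ (i + 1)‖ * 1 := by gcongr
      _ < _ := by rw [mul_one]; exact lt_of_le_of_lt hb ha
  have h2 := lt_of_le_of_lt hi hlt
  rw [eq_neg_of_add_eq_zero_left h1, norm_neg, norm_one] at h2
  exact lt_irrefl _ h2

theorem laguerre_sum_ne_zero {p d : ℕ} (hp : p.Prime) (hp2 : p ≠ 2) (hdp : d < p) (k : ℕ) :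
    ∑ j ∈ Finset.range (k + 1),
      (-((d * p : ℕ) : ℂ)) ^ j * (k.choose j : ℂ) / ((d * p + j).factorial : ℂ) ≠ 0 := by
  have h := laguerre_sum_ne_zero_rat hp hp2 hdp k
  have h' : ((∑ j ∈ Finset.range (k + 1),
      (-((d * p : ℕ) : ℚ)) ^ j * (k.choose j : ℚ) / ((d * p + 1).ascFactorial j : ℚ) : ℚ) : ℂ) ≠ 0 :=
    Rat.cast_ne_zero.2 h
  intro h0
  apply h'
  rw [← mul_zero (((d * p).factorial : ℕ) : ℂ), ← h0, Finset.mul_sum, Rat.cast_sum]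
  refine Finset.sum_congr rfl fun j _ => ?_
  rw [← Nat.factorial_mul_ascFactorial]
  have := Nat.factorial_ne_zero (d * p)
  push_cast
  field_simp

/-- Every large real `M` is well approximated from below by products `d * p` with `p` an odd prime
and `0 < d < p`. -/
theorem exists_prime_mul_near (ε : ℝ) (hε : 0 < ε) : ∃ C : ℝ, 0 < C ∧ ∀ M : ℝ, C < M →
    ∃ p d : ℕ, p.Prime ∧ p ≠ 2 ∧ 0 < d ∧ d < p ∧ ((d * p : ℕ) : ℝ) ≤ M ∧
      M ≤ ((d * p : ℕ) : ℝ) * (1 + ε) := by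
  -- With `r = √M`, this constant ensures `r > 8` and `ε r > 8`.
  refine ⟨max 64 (64 / ε ^ 2 + 64 ), by positivity, fun M hM => ?_⟩
  have hM1 : 64 < M := lt_of_le_of_lt (le_max_left _ _) hM
  have hM2 : 64 / ε ^ 2 + 64 < M := lt_of_le_of_lt (le_max_right _ _) hM
  set r := Real.sqrt M with hr
  have hrr : r * r = M := Real.mul_self_sqrt (by linarith)
  have hr8 : 8 < r := by
    rw [hr]; exact (Real.lt_sqrt (by norm_num)).2 (by linarith)
  set N := ⌈r⌉₊ with hN
  have hN1 : r ≤ N := Nat.le_ceil r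
  have hN2 : (N : ℝ) < r + 1 := Nat.ceil_lt_add_one (by linarith)
  have hN0 : N ≠ 0 := by
    rintro h; rw [h] at hN1; norm_num at hN1; linarith
  -- Bertrand's postulate gives `√M < p ≤ 3√M`. With `d = ⌊M / p⌋`, the first bound yields `d < p`,
  -- and the second makes the error `M - dp < p` of order `√M`, which is at most `ε dp`.
  obtain ⟨p, hp, hNp, hp2⟩ := Nat.exists_prime_lt_and_le_two_mul N hN0
  have hNp' : (N : ℝ) < p := by exact_mod_cast hNp
  have hp2' : (p : ℝ) ≤ 2 * N := by exact_mod_cast hp2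
  have hp0 : (0 : ℝ) < p := by linarith
  have hd1 : (⌊M / p⌋₊ : ℝ) ≤ M / p := Nat.floor_le (by positivity)
  have hd2 : M / p < ⌊M / p⌋₊ + 1 := Nat.lt_floor_add_one _
  rw [le_div_iff₀ hp0] at hd1
  rw [div_lt_iff₀ hp0] at hd2
  refine ⟨p, ⌊M / p⌋₊, hp, ?_, ?_, ?_, by exact_mod_cast hd1, ?_⟩
  · rintro rfl
    have : (N : ℝ) ≤ 1 := by exact_mod_cast Nat.lt_succ_iff.1 hNp
    linarith
  · rw [Nat.floor_pos, le_div_iff₀ hp0]; nlinarith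
  · have : (⌊M / p⌋₊ : ℝ) < p := by
      by_contra hc
      push Not at hc
      nlinarith
    exact_mod_cast this
  · push_cast
    have h8 : 8 < ε * r := by
      have : 64 / ε ^ 2 < M := by linarith
      rw [div_lt_iff₀ (by positivity)] at this
      by_contra hc
      push Not at hc
      have h0 : 0 ≤ ε * r := by positivity
      nlinarith
    have hpr : (p : ℝ) ≤ 3 * r := by linarith
    have hlow : M - 3 * r ≤ ⌊M / p⌋₊ * p := by nlinarith
    nlinarith
end HTypeXray

/-! ### Fourier coefficients on circles and twisted averages along complex circles -/

namespace HTypeXray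

theorem integral_exp_int_mul (p : ℤ) :
    ∫ θ in (0 : ℝ)..2 * Real.pi, Complex.exp (p * θ * Complex.I)
      = if p = 0 then (2 * Real.pi : ℂ) else 0 := by
  split_ifs with h
  · simp [h]
  · have hc : (p : ℂ) * Complex.I ≠ 0 := mul_ne_zero (Int.cast_ne_zero.2 h) Complex.I_ne_zero
    have h1 := integral_exp_mul_complex (a := 0) (b := 2 * Real.pi) hc
    have h2 : Complex.exp ((p : ℂ) * Complex.I * ((2 * Real.pi : ℝ) : ℂ)) = 1 := by
      rw [Complex.exp_eq_one_iff]
      exact ⟨p, by push_cast; ring⟩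
    rw [h2] at h1
    simp only [Complex.ofReal_zero, mul_zero, Complex.exp_zero, sub_self, zero_div] at h1
    rw [← h1]
    refine intervalIntegral.integral_congr fun θ _ => ?_
    congr 1; ring

theorem norm_exp_int_mul (p : ℤ) (θ : ℝ) : ‖Complex.exp (p * θ * Complex.I)‖ = 1 := by
  rw [show (p : ℂ) * θ * Complex.I = ((p * θ : ℝ) : ℂ) * Complex.I by push_cast; ring]
  exact Complex.norm_exp_ofReal_mul_I _

theorem hasSum_intervalIntegral_of_norm_le {F : ℕ → ℝ → ℂ} {g : ℝ → ℂ} {b : ℕ → ℝ} {α β : ℝ}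
    (hF : ∀ k, Continuous (F k)) (hb : Summable b) (hbd : ∀ k θ, ‖F k θ‖ ≤ b k)
    (hg : ∀ θ, HasSum (fun k => F k θ) (g θ)) :
    HasSum (fun k => ∫ θ in α..β, F k θ) (∫ θ in α..β, g θ) := by
  refine intervalIntegral.hasSum_integral_of_dominated_convergence (fun k _ => b k)
    (fun k => (hF k).aestronglyMeasurable) (fun k => ?_) ?_ ?_ ?_
  · exact Filter.Eventually.of_forall fun θ _ => hbd k θ
  · exact Filter.Eventually.of_forall fun θ _ => hb
  · exact intervalIntegrable_const
  · exact Filter.Eventually.of_forall fun θ _ => hg θ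

/-- Only the term of degree `k = -p` is resonant with `e^{ipθ}`; there is none when `p > 0`. -/
theorem integral_exp_mul_of_hasSum {a : ℕ → ℂ} (ha : Summable fun k => ‖a k‖) {g : ℝ → ℂ}
    (hg : ∀ θ : ℝ, HasSum (fun k => a k * Complex.exp (θ * Complex.I) ^ k) (g θ)) (p : ℤ) :
    ∫ θ in (0 : ℝ)..2 * Real.pi, Complex.exp (p * θ * Complex.I) * g θ
      = if p ≤ 0 then 2 * Real.pi * a p.natAbs else 0 := by
  have h := hasSum_intervalIntegral_of_norm_le (α := 0) (β := 2 * Real.pi)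
    (F := fun k θ => Complex.exp (p * θ * Complex.I) * (a k * Complex.exp (θ * Complex.I) ^ k))
    (g := fun θ => Complex.exp (p * θ * Complex.I) * g θ)
    (fun k => by fun_prop) ha (fun k θ => by
      rw [norm_mul, norm_exp_int_mul, norm_mul, norm_pow, Complex.norm_exp_ofReal_mul_I]; simp)
    (fun θ => (hg θ).mul_left _)
  have hk : ∀ k : ℕ, ∫ θ in (0 : ℝ)..2 * Real.pi,
      Complex.exp (p * θ * Complex.I) * (a k * Complex.exp (θ * Complex.I) ^ k)
      = if (p + k = 0) then 2 * Real.pi * a k else 0 := fun k => by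
    have : ∀ θ : ℝ, Complex.exp (p * θ * Complex.I) * (a k * Complex.exp (θ * Complex.I) ^ k)
        = a k * Complex.exp (((p + k : ℤ) : ℂ) * θ * Complex.I) := fun θ => by
      rw [mul_left_comm, ← Complex.exp_nat_mul, ← Complex.exp_add]
      congr 2; push_cast; ring
    simp only [this]
    rw [intervalIntegral.integral_const_mul, integral_exp_int_mul]
    split_ifs <;> ring
  simp only [hk] at h
  refine h.unique ?_
  split_ifs with hp
  · have := hasSum_single (f := fun k : ℕ => if p + k = 0 then (2 * Real.pi : ℂ) * a k else 0)
      p.natAbs (fun k hk => if_neg (by omega))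
    rwa [if_pos (show p + (p.natAbs : ℤ) = 0 by omega)] at this
  · have : ∀ k : ℕ, (if p + k = 0 then (2 * Real.pi : ℂ) * a k else 0) = 0 := fun k =>
      if_neg (by omega)
    simp only [this]
    exact hasSum_zero

/-- The Taylor coefficients at the origin. -/
def taylorCoeff (g : ℂ → ℂ) (k : ℕ) : ℂ := (k.factorial : ℂ)⁻¹ * iteratedDeriv k g 0

theorem hasSum_taylorCoeff {g : ℂ → ℂ} (hg : Differentiable ℂ g) (z : ℂ) :
    HasSum (fun k => taylorCoeff g k * z ^ k) (g z) := by
  have h := Complex.hasSum_taylorSeries_of_entire hg 0 z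
  simp only [sub_zero, smul_eq_mul] at h
  convert! h using 2 with k
  rw [taylorCoeff]; ring

theorem summable_norm_taylorCoeff {g : ℂ → ℂ} (hg : Differentiable ℂ g) (r : ℝ) :
    Summable fun k => ‖taylorCoeff g k‖ * r ^ k := by
  have h := (hasSum_taylorCoeff hg (|r| : ℝ)).summable.norm
  refine Summable.of_norm ?_
  simpa using h

theorem integral_exp_mul_entire {g : ℂ → ℂ} (hg : Differentiable ℂ g) (r : ℂ) (p : ℤ) :
    ∫ θ in (0 : ℝ)..2 * Real.pi, Complex.exp (p * θ * Complex.I)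
      * g (r * Complex.exp (θ * Complex.I))
      = if p ≤ 0 then 2 * Real.pi * (taylorCoeff g p.natAbs * r ^ p.natAbs) else 0 := by
  refine integral_exp_mul_of_hasSum (a := fun k => taylorCoeff g k * r ^ k) ?_ (fun θ => ?_) p
  · simpa using summable_norm_taylorCoeff hg ‖r‖
  · simpa only [mul_pow, mul_assoc] using hasSum_taylorCoeff hg (r * Complex.exp (θ * Complex.I))

theorem eq_zero_of_hasSum_circle {a : ℕ → ℂ} (ha : Summable fun k => ‖a k‖)
    (hg : ∀ θ : ℝ, HasSum (fun k => a k * Complex.exp (θ * Complex.I) ^ k) 0) (k : ℕ) :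
    a k = 0 := by
  have h := integral_exp_mul_of_hasSum ha hg (-(k : ℤ))
  have hpi : (Real.pi : ℂ) ≠ 0 := Complex.ofReal_ne_zero.2 Real.pi_ne_zero
  simpa [hpi] using h.symm

theorem taylorCoeff_unique {g : ℂ → ℂ} (hg : Differentiable ℂ g) {a : ℕ → ℂ}
    (ha : ∀ z, HasSum (fun k => a k * z ^ k) (g z)) (k : ℕ) : a k = taylorCoeff g k := by
  refine sub_eq_zero.1 (eq_zero_of_hasSum_circle (a := fun k => a k - taylorCoeff g k) ?_ ?_ k)
  · have h1 := (ha 1).summable.sub (hasSum_taylorCoeff hg 1).summable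
    simpa using h1.norm
  · intro θ
    have h := (ha (Complex.exp (θ * Complex.I))).sub (hasSum_taylorCoeff hg (Complex.exp (θ * Complex.I)))
    rw [sub_self] at h
    simpa only [sub_mul] using h

theorem taylorCoeff_comp_mul {g : ℂ → ℂ} (hg : Differentiable ℂ g) (t : ℂ) (k : ℕ) :
    taylorCoeff (fun z => g (t * z)) k = t ^ k * taylorCoeff g k := by
  refine (taylorCoeff_unique (g := fun z => g (t * z)) (a := fun k => t ^ k * taylorCoeff g k)
    (by fun_prop) (fun z => ?_) k).symm
  convert! hasSum_taylorCoeff hg (t * z) using 2 with j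
  ring

theorem eq_zero_of_taylorCoeff {g : ℂ → ℂ} (hg : Differentiable ℂ g)
    (h : ∀ k, taylorCoeff g k = 0) (z : ℂ) : g z = 0 := by
  refine (hasSum_taylorCoeff hg z).unique ?_
  simp only [h, zero_mul]
  exact hasSum_zero

/-- The reflection `θ ↦ 2π - θ` turns the integral into the extraction of the `p`-th Taylor
coefficient of `x ↦ exp(-y x)`. -/
theorem integral_exp_mul_exp_neg (p : ℕ) (y : ℂ) :
    ∫ θ in (0 : ℝ)..2 * Real.pi, Complex.exp (p * θ * Complex.I)
      * Complex.exp (-(Complex.exp (-(θ * Complex.I)) * y))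
      = 2 * Real.pi * ((-y) ^ p / p.factorial) := by
  have hco : ∀ k, ((k.factorial : ℂ)⁻¹) = taylorCoeff Complex.exp k := fun k => by
    simp [taylorCoeff, iteratedDeriv_eq_iterate]
  have h := integral_exp_mul_entire Complex.differentiable_exp (-y) (-(p : ℤ))
  rw [if_pos (by omega), Int.natAbs_neg, Int.natAbs_natCast, ← hco] at h
  have e : ∀ θ : ℝ, Complex.exp (p * ((2 * Real.pi - θ : ℝ) : ℂ) * Complex.I)
      * Complex.exp (-(Complex.exp (-(((2 * Real.pi - θ : ℝ) : ℂ) * Complex.I)) * y))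
      = Complex.exp (((-(p : ℤ) : ℤ) : ℂ) * θ * Complex.I)
        * Complex.exp (-y * Complex.exp (θ * Complex.I)) := fun θ => by
    have e1 : Complex.exp (p * ((2 * Real.pi - θ : ℝ) : ℂ) * Complex.I)
        = Complex.exp (((-(p : ℤ) : ℤ) : ℂ) * θ * Complex.I) := by
      rw [Complex.exp_eq_exp_iff_exists_int]
      exact ⟨p, by push_cast; ring⟩
    have e2 : Complex.exp (-(((2 * Real.pi - θ : ℝ) : ℂ) * Complex.I))
        = Complex.exp (θ * Complex.I) := by
      rw [Complex.exp_eq_exp_iff_exists_int]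
      exact ⟨-1, by push_cast; ring⟩
    rw [e1, e2]; congr 2; ring
  have hsub := intervalIntegral.integral_comp_sub_left (a := 0) (b := 2 * Real.pi)
    (fun θ : ℝ => Complex.exp (p * θ * Complex.I)
      * Complex.exp (-(Complex.exp (-(θ * Complex.I)) * y))) (2 * Real.pi)
  simp only [sub_self, sub_zero] at hsub
  rw [← hsub]
  simp only [e]
  rw [h]; ring

/-- The moments of the twisted circle averages of monomials. -/
theorem integral_exp_mul_exp_neg_mul_pow (m k : ℕ) (a x : ℂ) :
    ∫ θ in (0 : ℝ)..2 * Real.pi, Complex.exp (m * θ * Complex.I)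
      * Complex.exp (-(Complex.exp (-(θ * Complex.I)) * (a * x)))
      * (x + a * Complex.exp (θ * Complex.I)) ^ k
      = 2 * Real.pi * (-a) ^ m * (∑ j ∈ Finset.range (k + 1),
        (-(a ^ 2)) ^ j * (k.choose j : ℂ) / ((m + j).factorial : ℂ)) * x ^ (k + m) := by
  have e : ∀ θ : ℝ, Complex.exp (m * θ * Complex.I)
      * Complex.exp (-(Complex.exp (-(θ * Complex.I)) * (a * x)))
      * (x + a * Complex.exp (θ * Complex.I)) ^ k
      = ∑ j ∈ Finset.range (k + 1), (a ^ j * x ^ (k - j) * (k.choose j : ℂ))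
        * (Complex.exp (((m + j : ℕ) : ℂ) * θ * Complex.I)
          * Complex.exp (-(Complex.exp (-(θ * Complex.I)) * (a * x)))) := fun θ => by
    rw [add_comm x, add_pow, Finset.mul_sum]
    refine Finset.sum_congr rfl fun j _ => ?_
    have : Complex.exp (((m + j : ℕ) : ℂ) * θ * Complex.I)
        = Complex.exp (m * θ * Complex.I) * Complex.exp (θ * Complex.I) ^ j := by
      rw [← Complex.exp_nat_mul, ← Complex.exp_add]; congr 1; push_cast; ring
    rw [this, mul_pow]; ring
  simp only [e]
  rw [intervalIntegral.integral_finsetSum fun j _ =>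
    Continuous.intervalIntegrable (by fun_prop) _ _]
  rw [Finset.mul_sum, Finset.sum_mul]
  refine Finset.sum_congr rfl fun j hj => ?_
  rw [intervalIntegral.integral_const_mul, integral_exp_mul_exp_neg]
  have hj' : j ≤ k := Nat.lt_succ_iff.1 (Finset.mem_range.1 hj)
  obtain ⟨i, rfl⟩ := Nat.exists_eq_add_of_le hj'
  rw [Nat.add_sub_cancel_left]
  have e3 : (-(a * x)) ^ (m + j) = (-a) ^ m * (-a) ^ j * x ^ (m + j) := by
    rw [← pow_add, ← mul_pow]; ring
  have e4 : (-(a ^ 2)) ^ j = a ^ j * (-a) ^ j := by rw [← mul_pow]; ring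
  rw [e3, e4]
  ring

/-- The twisted average is diagonal on monomials, up to the shift `x^k ↦ x^{k+m}`, and `hne` says
that no diagonal entry vanishes. Expanding `Φ` in its Taylor series therefore kills the coefficients
one by one. -/
theorem entire_eq_zero_of_twisted_average {Φ : ℂ → ℂ} (hΦ : Differentiable ℂ Φ) {m : ℕ} {a : ℂ}
    (ha : a ≠ 0)
    (hne : ∀ k, ∑ j ∈ Finset.range (k + 1),
      (-(a ^ 2)) ^ j * (k.choose j : ℂ) / ((m + j).factorial : ℂ) ≠ 0)
    (h : ∀ x : ℂ, ∫ θ in (0 : ℝ)..2 * Real.pi, Complex.exp (m * θ * Complex.I)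
      * Complex.exp (-(Complex.exp (-(θ * Complex.I)) * (a * x)))
      * Φ (x + a * Complex.exp (θ * Complex.I)) = 0) (x : ℂ) : Φ x = 0 := by
  set S : ℕ → ℂ := fun k => 2 * Real.pi * (-a) ^ m * ∑ j ∈ Finset.range (k + 1),
      (-(a ^ 2)) ^ j * (k.choose j : ℂ) / ((m + j).factorial : ℂ) with hS
  have hsum : ∀ x : ℂ, HasSum (fun k => taylorCoeff Φ k * (S k * x ^ (k + m))) 0 := fun x => by
    rw [← h x]
    have hh := hasSum_intervalIntegral_of_norm_le (α := 0) (β := 2 * Real.pi)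
      (F := fun k θ => Complex.exp (m * θ * Complex.I)
        * Complex.exp (-(Complex.exp (-(θ * Complex.I)) * (a * x)))
        * (taylorCoeff Φ k * (x + a * Complex.exp (θ * Complex.I)) ^ k))
      (g := fun θ => Complex.exp (m * θ * Complex.I)
        * Complex.exp (-(Complex.exp (-(θ * Complex.I)) * (a * x)))
        * Φ (x + a * Complex.exp (θ * Complex.I)))
      (b := fun k => Real.exp (‖a * x‖) * (‖taylorCoeff Φ k‖ * (‖x‖ + ‖a‖) ^ k))
      (fun k => by fun_prop) ((summable_norm_taylorCoeff hΦ _).mul_left _) (fun k θ => ?_)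
      (fun θ => (hasSum_taylorCoeff hΦ _).mul_left _)
    · convert! hh using 2 with k
      rw [hS]
      simp only
      rw [← integral_exp_mul_exp_neg_mul_pow, ← intervalIntegral.integral_const_mul]
      refine intervalIntegral.integral_congr fun θ _ => ?_
      ring
    · have h1 : ‖Complex.exp (m * θ * Complex.I)‖ = 1 := by
        simpa using norm_exp_int_mul (m : ℤ) θ
      have hn : ‖Complex.exp (-(θ * Complex.I))‖ = 1 := by
        simpa using norm_exp_int_mul (-1) θ
      have h2 : ‖Complex.exp (-(Complex.exp (-(θ * Complex.I)) * (a * x)))‖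
          ≤ Real.exp ‖a * x‖ := by
        refine (Complex.norm_exp_le_exp_norm _).trans_eq ?_
        rw [norm_neg, norm_mul, hn, one_mul]
      have h3 : ‖x + a * Complex.exp (θ * Complex.I)‖ ≤ ‖x‖ + ‖a‖ := by
        refine (norm_add_le _ _).trans_eq ?_
        rw [norm_mul, Complex.norm_exp_ofReal_mul_I, mul_one]
      rw [norm_mul, norm_mul, h1, one_mul, norm_mul, norm_pow]
      gcongr
  have hz : ∀ k, taylorCoeff Φ k * S k = 0 := by
    -- Dividing by `x^m` loses only `x = 0`; uniqueness of the coefficients needs only the unit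
    -- circle.
    have hred : ∀ x : ℂ, x ≠ 0 → HasSum (fun k => taylorCoeff Φ k * S k * x ^ k) 0 := fun x hx => by
      have := (hsum x).mul_left ((x ^ m)⁻¹)
      rw [mul_zero] at this
      convert! this using 2 with k
      rw [pow_add]
      field_simp
    refine eq_zero_of_hasSum_circle ?_ fun θ => hred _ (Complex.exp_ne_zero _)
    simpa using (hred 1 one_ne_zero).summable.norm
  refine eq_zero_of_taylorCoeff hΦ (fun k => ?_) x
  refine (mul_eq_zero.1 (hz k)).resolve_right ?_
  have hpi : (Real.pi : ℂ) ≠ 0 := Complex.ofReal_ne_zero.2 Real.pi_ne_zero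
  exact mul_ne_zero (mul_ne_zero (mul_ne_zero two_ne_zero hpi) (pow_ne_zero _ (neg_ne_zero.2 ha)))
    (hne k)

/-- An entire function whose twisted averages along the circle `θ ↦ e^{iθ} v`, `|v|² = m`, vanish
at all centres is zero, as soon as the Laguerre polynomials `L_k^{(m)}` do not vanish at `m`. -/
theorem eq_zero_of_twisted_circle {n : ℕ} {φ : EuclideanSpace ℂ (Fin n) → ℂ}
    (hφ : Differentiable ℂ φ) {m : ℕ} (hm : m ≠ 0)
    (hne : ∀ k, ∑ j ∈ Finset.range (k + 1),
      (-(m : ℂ)) ^ j * (k.choose j : ℂ) / ((m + j).factorial : ℂ) ≠ 0)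
    {v : EuclideanSpace ℂ (Fin n)} (hv : ‖v‖ ^ 2 = m)
    (h : ∀ ζ, ∫ θ in (0 : ℝ)..2 * Real.pi, Complex.exp (m * θ * Complex.I)
      * Complex.exp (-inner ℂ (Complex.exp (θ * Complex.I) • v) ζ)
      * φ (ζ + Complex.exp (θ * Complex.I) • v) = 0) (ζ : EuclideanSpace ℂ (Fin n)) :
    φ ζ = 0 := by
  have hm' : (0 : ℝ) < m := by exact_mod_cast Nat.pos_of_ne_zero hm
  have hvn : ‖v‖ ≠ 0 := by rintro h0; rw [h0] at hv; simp at hv; exact hm (by exact_mod_cast hv.symm)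
  set a : ℂ := (‖v‖ : ℂ) with ha
  have ha0 : a ≠ 0 := Complex.ofReal_ne_zero.2 hvn
  have ha2 : a ^ 2 = m := by rw [ha, ← Complex.ofReal_pow, hv]; simp
  have hvv : inner ℂ v v = (a ^ 2 : ℂ) := by
    rw [inner_self_eq_norm_sq_to_K]; simp [ha]
  -- Split `ζ = ζ' + (x₀ / a) v` with `ζ' ⟂ v`. In the coordinate `x` along `v / a`, the twist
  -- `exp(-⟨e^{iθ} v, ζ⟩)` becomes `exp(-e^{-iθ} a x)`, independent of `ζ'`, which reduces the claim
  -- to one variable.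
  set x₀ : ℂ := a⁻¹ * inner ℂ v ζ with hx₀
  set ζ' := ζ - (x₀ * a⁻¹) • v with hζ'
  have horth : inner ℂ v ζ' = 0 := by
    rw [hζ', inner_sub_right, inner_smul_right, hvv, hx₀]; field_simp; ring
  have hd : Differentiable ℂ fun x : ℂ => φ (ζ' + (x * a⁻¹) • v) := by fun_prop
  have h0 := entire_eq_zero_of_twisted_average hd ha0 (m := m) (by rw [ha2]; exact hne)
    (fun x => by
      rw [← h (ζ' + (x * a⁻¹) • v)]
      refine intervalIntegral.integral_congr fun θ _ => ?_
      congr 2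
      · congr 2
        rw [inner_smul_left, inner_add_right, horth, inner_smul_right, hvv, ← Complex.exp_conj,
          map_mul, Complex.conj_I, Complex.conj_ofReal, zero_add, mul_neg]
        field_simp
      · rw [add_mul, add_smul, ← add_assoc, mul_assoc, mul_comm a, mul_assoc,
          inv_mul_cancel₀ ha0, mul_one]) x₀
  simpa [hζ'] using h0

end HTypeXray

/-! ### Homogeneous components and the contour deformation -/

namespace HTypeXray

section HomPart

variable {E : Type*} [NormedAddCommGroup E] [NormedSpace ℂ E]

/-- The component of degree `k` of an entire function. -/
def homPart (φ : E → ℂ) (k : ℕ) (v : E) : ℂ := taylorCoeff (fun x : ℂ => φ (x • v)) k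

variable {φ : E → ℂ}

theorem hasSum_homPart (hφ : Differentiable ℂ φ) (v : E) :
    HasSum (fun k => homPart φ k v) (φ v) := by
  have hd : Differentiable ℂ fun x : ℂ => φ (x • v) := by fun_prop
  simpa [homPart] using hasSum_taylorCoeff hd 1

theorem homPart_smul (hφ : Differentiable ℂ φ) (k : ℕ) (t : ℂ) (v : E) :
    homPart φ k (t • v) = t ^ k * homPart φ k v := by
  have hd : Differentiable ℂ fun x : ℂ => φ (x • v) := by fun_prop
  rw [homPart, homPart, ← taylorCoeff_comp_mul hd t k]
  simp only [smul_smul, mul_comm]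

/-- Cauchy's formula on the unit circle presents the component as a parameter integral. Continuity
in `v` is what permits the limit `ε → 0` in the contour argument. -/
theorem continuous_homPart (hφ : Differentiable ℂ φ) (k : ℕ) : Continuous (homPart φ k) := by
  have h : homPart φ k = fun v => (2 * Real.pi : ℂ)⁻¹ * ∫ θ in (0 : ℝ)..2 * Real.pi,
      Complex.exp (((-(k : ℤ) : ℤ) : ℂ) * θ * Complex.I)
        * φ (Complex.exp (θ * Complex.I) • v) := by
    funext v
    have hd : Differentiable ℂ fun x : ℂ => φ (x • v) := by fun_prop
    have h1 := integral_exp_mul_entire hd 1 (-(k : ℤ))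
    rw [if_pos (by omega), Int.natAbs_neg, Int.natAbs_natCast] at h1
    simp only [one_mul, one_pow, mul_one] at h1
    have hpi : (2 * Real.pi : ℂ) ≠ 0 :=
      mul_ne_zero two_ne_zero (Complex.ofReal_ne_zero.2 Real.pi_ne_zero)
    rw [h1, inv_mul_cancel_left₀ hpi, homPart]
  rw [h]
  refine continuous_const.mul
    (intervalIntegral.continuous_parametric_intervalIntegral_of_continuous' ?_ _ _)
  have := hφ.continuous
  simp only [Function.uncurry_def]
  fun_prop

theorem eq_sum_homPart (hφ : Differentiable ℂ φ) {N : ℕ} (h : ∀ k, N ≤ k → ∀ v, homPart φ k v = 0)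
    (v : E) : φ v = ∑ k ∈ Finset.range N, homPart φ k v := by
  refine (hasSum_homPart hφ v).unique (hasSum_sum_of_ne_finset_zero fun k hk => ?_)
  exact h k (by simpa using hk) v

end HomPart

/-- Up to the factor `i`, these are the integrals of `f(z) dz / z` over the two circles, so Cauchy's
theorem on the annulus applies; a singularity at the origin is allowed. -/
theorem integral_circle_eq_of_differentiable {f : ℂ → ℂ} (hf : ∀ z, z ≠ 0 → DifferentiableAt ℂ f z)
    {ε : ℝ} (h0 : 0 < ε) (h1 : ε ≤ 1) :
    ∫ θ in (0 : ℝ)..2 * Real.pi, f (ε * Complex.exp (θ * Complex.I))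
      = ∫ θ in (0 : ℝ)..2 * Real.pi, f (Complex.exp (θ * Complex.I)) := by
  have hne : ∀ z ∈ Metric.closedBall (0 : ℂ) 1 \ Metric.ball 0 ε, z ≠ 0 := fun z hz h => by
    rw [h] at hz; exact hz.2 (Metric.mem_ball_self h0)
  have h := Complex.circleIntegral_sub_center_inv_smul_eq_of_differentiable_on_annulus_off_countable
    (c := 0) (f := f) h0 h1 Set.countable_empty
    (fun z hz => (hf z (hne z hz)).continuousAt.continuousWithinAt)
    (fun z hz => hf z (by
      rintro rfl
      exact hz.1.2 (Metric.mem_closedBall_self h0.le)))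
  have key : ∀ r : ℝ, 0 < r → (∮ z in C(0, r), (z - 0)⁻¹ • f z)
      = Complex.I * ∫ θ in (0 : ℝ)..2 * Real.pi, f (r * Complex.exp (θ * Complex.I)) := fun r hr => by
    rw [circleIntegral, ← intervalIntegral.integral_const_mul]
    refine intervalIntegral.integral_congr fun θ _ => ?_
    have hr' : (r : ℂ) ≠ 0 := Complex.ofReal_ne_zero.2 hr.ne'
    have he := Complex.exp_ne_zero (θ * Complex.I)
    simp only [deriv_circleMap, circleMap, zero_add, sub_zero, smul_eq_mul]
    field_simp
  rw [key 1 one_pos, key ε h0] at h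
  simpa using (mul_left_cancel₀ Complex.I_ne_zero h).symm

/-- The extreme frequency of the twisted averages of a function of degree at most `κ ≤ m` along the
closed curve `θ ↦ e^{iθ} z₁ + e^{-iθ} z₂`. -/
theorem homPart_eq_zero_of_twisted_average {n : ℕ} {φ : EuclideanSpace ℂ (Fin n) → ℂ}
    (hφ : Differentiable ℂ φ) {m κ : ℕ} (hκ : κ ≤ m)
    (hdeg : ∀ k, κ + 1 ≤ k → ∀ v, homPart φ k v = 0)
    {z₁ z₂ : EuclideanSpace ℂ (Fin n)} (hz : z₁ ≠ 0)
    (h : ∀ ζ, ∫ θ in (0 : ℝ)..2 * Real.pi, Complex.exp (m * θ * Complex.I)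
      * Complex.exp (-inner ℂ (Complex.exp (θ * Complex.I) • z₁
          + (Complex.exp (θ * Complex.I))⁻¹ • z₂) ζ)
      * φ (ζ + (Complex.exp (θ * Complex.I) • z₁
          + (Complex.exp (θ * Complex.I))⁻¹ • z₂)) = 0) :
    homPart φ κ z₂ = 0 := by
  set p : ℂ := inner ℂ z₁ z₁ with hp
  set r : ℂ := inner ℂ z₂ z₁ with hr
  have hp0 : p ≠ 0 := inner_self_ne_zero.2 hz
  -- deform the contour
  have hcirc : ∀ (t : ℂ) (ε : ℝ), 0 < ε → ε ≤ 1 → ∫ θ in (0 : ℝ)..2 * Real.pi,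
      (fun u : ℂ => u ^ m * Complex.exp (-(t * (u⁻¹ * p + u * r)))
        * φ (t • z₁ + (u • z₁ + u⁻¹ • z₂))) (ε * Complex.exp (θ * Complex.I)) = 0 := by
    intro t ε h0 h1
    refine (integral_circle_eq_of_differentiable (f := fun u : ℂ => u ^ m
      * Complex.exp (-(t * (u⁻¹ * p + u * r))) * φ (t • z₁ + (u • z₁ + u⁻¹ • z₂))) ?_ h0 h1).trans ?_
    rotate_left
    · rw [← h (t • z₁)]
      refine intervalIntegral.integral_congr fun θ _ => ?_
      have hconj : starRingEnd ℂ (Complex.exp (θ * Complex.I))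
          = (Complex.exp (θ * Complex.I))⁻¹ := by
        rw [← Complex.exp_conj, ← Complex.exp_neg, map_mul, Complex.conj_I, Complex.conj_ofReal,
          mul_neg]
      rw [inner_add_left, inner_smul_left, inner_smul_left, map_inv₀, hconj, inv_inv,
        inner_smul_right, inner_smul_right, ← hp, ← hr, ← Complex.exp_nat_mul]
      congr 3
      · ring_nf
      · ring
    · intro u hu
      have := hφ
      fun_prop (disch := assumption)
  -- the rescaled integrand
  set Q : ℝ → ℝ → ℂ := fun ε θ => Complex.exp (m * θ * Complex.I)
    * Complex.exp (-(Complex.exp (-(θ * Complex.I)) * p + ε ^ 2 * Complex.exp (θ * Complex.I) * r))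
    * ∑ k ∈ Finset.range (κ + 1), (ε : ℂ) ^ (κ - k) * homPart φ k
      (Complex.exp (-(θ * Complex.I)) • z₂
        + (ε ^ 2 : ℂ) • (z₁ + Complex.exp (θ * Complex.I) • z₁)) with hQ
  have hQcont : Continuous (Function.uncurry Q) := by
    have := fun k => continuous_homPart hφ k
    simp only [hQ, Function.uncurry_def]
    fun_prop
  have hJ : Continuous fun ε => ∫ θ in (0 : ℝ)..2 * Real.pi, Q ε θ :=
    intervalIntegral.continuous_parametric_intervalIntegral_of_continuous' hQcont _ _
  -- `Q` is the integrand on `|u| = ε` at the centre `ζ = ε z₁`, multiplied by `ε^{κ-m}`. On this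
  -- circle the argument of `φ` is `ε⁻¹ (e^{-iθ} z₂ + O(ε²))`, so the component of degree `κ`
  -- dominates as `ε → 0`.
  have hJ0 : ∀ ε : ℝ, 0 < ε → ε ≤ 1 → ∫ θ in (0 : ℝ)..2 * Real.pi, Q ε θ = 0 := by
    intro ε h0 h1
    have hε : (ε : ℂ) ≠ 0 := Complex.ofReal_ne_zero.2 h0.ne'
    have hc := hcirc ε ε h0 h1
    have : ∀ θ : ℝ, Q ε θ = ((ε : ℂ) ^ κ * ((ε : ℂ) ^ m)⁻¹) *
        (fun u : ℂ => u ^ m * Complex.exp (-((ε : ℂ) * (u⁻¹ * p + u * r)))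
        * φ ((ε : ℂ) • z₁ + (u • z₁ + u⁻¹ • z₂))) (ε * Complex.exp (θ * Complex.I)) := by
      intro θ
      have he := Complex.exp_ne_zero (θ * Complex.I)
      have hy : (ε : ℂ) • z₁ + ((ε * Complex.exp (θ * Complex.I)) • z₁
          + (ε * Complex.exp (θ * Complex.I))⁻¹ • z₂)
          = (ε : ℂ)⁻¹ • (Complex.exp (-(θ * Complex.I)) • z₂
            + (ε ^ 2 : ℂ) • (z₁ + Complex.exp (θ * Complex.I) • z₁)) := by
        have e1 : (ε : ℂ)⁻¹ * (ε : ℂ) ^ 2 = ε := by field_simp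
        rw [smul_add, smul_smul, smul_smul, smul_add, e1, mul_inv, Complex.exp_neg, mul_smul _ _ z₁]
        abel
      simp only
      rw [hy, eq_sum_homPart hφ hdeg]
      simp only [homPart_smul hφ, hQ, Finset.mul_sum]
      refine Finset.sum_congr rfl fun k hk => ?_
      have hk' : k ≤ κ := Nat.lt_succ_iff.1 (Finset.mem_range.1 hk)
      rw [pow_sub₀ _ hε hk', mul_pow, ← Complex.exp_nat_mul, inv_pow, ← mul_assoc (m : ℂ),
        Complex.exp_neg (θ * Complex.I), mul_inv]
      have e2 : (ε : ℂ) * ((ε : ℂ)⁻¹ * (Complex.exp (θ * Complex.I))⁻¹ * p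
          + ε * Complex.exp (θ * Complex.I) * r) = (Complex.exp (θ * Complex.I))⁻¹ * p
          + ε ^ 2 * Complex.exp (θ * Complex.I) * r := by field_simp
      rw [e2]
      field_simp
    simp only [this]
    rw [intervalIntegral.integral_const_mul, hc, mul_zero]
  have hlim : ∫ θ in (0 : ℝ)..2 * Real.pi, Q 0 θ = 0 := by
    have h1 : Filter.Tendsto (fun ε => ∫ θ in (0 : ℝ)..2 * Real.pi, Q ε θ)
        (nhdsWithin 0 (Set.Ioi 0)) (nhds (∫ θ in (0 : ℝ)..2 * Real.pi, Q 0 θ)) :=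
      (hJ.tendsto 0).mono_left nhdsWithin_le_nhds
    refine tendsto_nhds_unique h1 (tendsto_const_nhds.congr' ?_)
    filter_upwards [Ioc_mem_nhdsGT (zero_lt_one' ℝ)] with ε hε
    exact (hJ0 ε hε.1 hε.2).symm
  -- The centre `ε z₁` is chosen so that the factor `exp(-e^{-iθ} |z₁|²)` survives in the limit. Its
  -- coefficient of `e^{-i(m-κ)θ}` is nonzero, whereas the centre `0` would leave `∫ e^{i(m-κ)θ}
  -- dθ`, which vanishes for `κ < m`.
  have hQ0 : ∀ θ : ℝ, Q 0 θ = homPart φ κ z₂ * (Complex.exp (((m - κ : ℕ) : ℂ) * θ * Complex.I)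
      * Complex.exp (-(Complex.exp (-(θ * Complex.I)) * p))) := by
    intro θ
    simp only [hQ]
    rw [Finset.sum_eq_single κ]
    · simp only [Complex.ofReal_zero, ne_eq, OfNat.ofNat_ne_zero, not_false_eq_true, zero_pow,
        zero_mul, add_zero, zero_smul, Nat.sub_self, pow_zero, one_mul, homPart_smul hφ]
      rw [← Complex.exp_nat_mul, Nat.cast_sub hκ]
      have : Complex.exp ((m - κ : ℂ) * θ * Complex.I)
          = Complex.exp (m * θ * Complex.I) * Complex.exp (κ * -(θ * Complex.I)) := by
        rw [← Complex.exp_add]; congr 1; ring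
      rw [this]; ring
    · intro k hk hne
      have : κ - k ≠ 0 := by have := Finset.mem_range.1 hk; omega
      simp [this]
    · intro hk; simp at hk
  simp only [hQ0] at hlim
  rw [intervalIntegral.integral_const_mul, integral_exp_mul_exp_neg] at hlim
  refine (mul_eq_zero.1 hlim).resolve_right ?_
  have hpi : (Real.pi : ℂ) ≠ 0 := Complex.ofReal_ne_zero.2 Real.pi_ne_zero
  exact mul_ne_zero (mul_ne_zero two_ne_zero hpi) (div_ne_zero (pow_ne_zero _ (neg_ne_zero.2 hp0))
    (Nat.cast_ne_zero.2 (Nat.factorial_ne_zero _)))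

end HTypeXray

/-! ### The invariant measure on the sphere and rotations of `ℂ²` -/

namespace HTypeXray

/-- The uniform probability measure on the unit sphere of `ℂⁿ`. -/
def sphereMeasure (n : ℕ) : Measure (EuclideanSpace ℂ (Fin n)) :=
  (gaussian n).map fun w => (‖w‖⁻¹ : ℝ) • w

theorem measurable_normalize (n : ℕ) :
    Measurable fun w : EuclideanSpace ℂ (Fin n) => (‖w‖⁻¹ : ℝ) • w := by
  fun_prop

instance isProbabilityMeasure_sphereMeasure (n : ℕ) : IsProbabilityMeasure (sphereMeasure n) :=
  Measure.isProbabilityMeasure_map (measurable_normalize n).aemeasurable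

theorem ae_ne_zero_gaussian (n : ℕ) [NeZero n] : ∀ᵐ w ∂gaussian n, w ≠ 0 := by
  have hac : gaussian n ≪ volume := withDensity_absolutelyContinuous _ _
  refine hac.ae_le ?_
  have : Nontrivial (EuclideanSpace ℂ (Fin n)) :=
    ⟨0, EuclideanSpace.single 0 1, fun h => by
      have := congrArg (fun v : EuclideanSpace ℂ (Fin n) => v 0) h
      simp at this⟩
  exact compl_mem_ae_iff.2 (measure_singleton _)

theorem ae_norm_eq_one_sphereMeasure (n : ℕ) [NeZero n] : ∀ᵐ w ∂sphereMeasure n, ‖w‖ = 1 := by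
  rw [sphereMeasure, ae_map_iff (measurable_normalize n).aemeasurable
    (measurableSet_eq_fun measurable_norm measurable_const)]
  filter_upwards [ae_ne_zero_gaussian n] with w hw
  rw [norm_smul, norm_inv, norm_norm, inv_mul_cancel₀ (norm_ne_zero_iff.2 hw)]

theorem measurePreserving_sphereMeasure {n : ℕ}
    (e : EuclideanSpace ℂ (Fin n) ≃ₗᵢ[ℝ] EuclideanSpace ℂ (Fin n)) :
    MeasurePreserving e (sphereMeasure n) (sphereMeasure n) := by
  refine ⟨e.continuous.measurable, ?_⟩
  rw [sphereMeasure, Measure.map_map e.continuous.measurable (measurable_normalize n)]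
  conv_rhs => rw [← (Fock.measurePreserving_gaussian e).map_eq,
    Measure.map_map (measurable_normalize n) e.continuous.measurable]
  congr 1
  funext w
  simp

theorem integrable_prod_sphereMeasure {n : ℕ} [NeZero n] {F : ℝ → EuclideanSpace ℂ (Fin n) → ℂ}
    (hF : Continuous (Function.uncurry F)) (α β : ℝ) :
    Integrable (Function.uncurry F) ((volume.restrict (Set.uIoc α β)).prod (sphereMeasure n)) := by
  have hcomp : IsCompact (Set.uIcc α β ×ˢ Metric.closedBall (0 : EuclideanSpace ℂ (Fin n)) 1) :=
    isCompact_uIcc.prod (isCompact_closedBall _ _)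
  obtain ⟨C, hC⟩ := hcomp.exists_bound_of_continuousOn hF.continuousOn
  have : IsFiniteMeasure (volume.restrict (Set.uIoc α β)) :=
    ⟨by rw [Measure.restrict_apply_univ, Set.uIoc, Real.volume_Ioc]; exact ENNReal.ofReal_lt_top⟩
  refine Integrable.of_bound hF.aestronglyMeasurable C ?_
  have h1 : ∀ᵐ q ∂(volume.restrict (Set.uIoc α β)).prod (sphereMeasure n), q.1 ∈ Set.uIoc α β :=
    Measure.quasiMeasurePreserving_fst.ae (ae_restrict_mem measurableSet_uIoc)
  have h2 : ∀ᵐ q ∂(volume.restrict (Set.uIoc α β)).prod (sphereMeasure n), ‖q.2‖ = 1 :=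
    Measure.quasiMeasurePreserving_snd.ae (ae_norm_eq_one_sphereMeasure n)
  filter_upwards [h1, h2] with q hq1 hq2
  exact hC q ⟨Set.uIoc_subset_uIcc hq1, by simp [hq2]⟩

theorem integral_sphereMeasure_swap {n : ℕ} [NeZero n] {F : ℝ → EuclideanSpace ℂ (Fin n) → ℂ}
    (hF : Continuous (Function.uncurry F)) (α β : ℝ) :
    ∫ w, (∫ θ in α..β, F θ w) ∂sphereMeasure n = ∫ θ in α..β, ∫ w, F θ w ∂sphereMeasure n :=
  (intervalIntegral_integral_swap (integrable_prod_sphereMeasure hF α β)).symm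

/-- Integrals over the sphere may be averaged over a family of isometries. -/
theorem integral_sphereMeasure_average {n : ℕ} [NeZero n] {H : EuclideanSpace ℂ (Fin n) → ℂ}
    (hH : Continuous H) (e : ℝ → EuclideanSpace ℂ (Fin n) ≃ₗᵢ[ℝ] EuclideanSpace ℂ (Fin n))
    (he : Continuous fun q : ℝ × EuclideanSpace ℂ (Fin n) => e q.1 q.2)
    {G : EuclideanSpace ℂ (Fin n) → ℂ}
    (hG : ∀ w, ∫ θ in (0 : ℝ)..2 * Real.pi, H (e θ w) = 2 * Real.pi * G w) :
    ∫ w, H w ∂sphereMeasure n = ∫ w, G w ∂sphereMeasure n := by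
  have h := integral_sphereMeasure_swap (n := n) (F := fun θ w => H (e θ w))
    (hH.comp he) 0 (2 * Real.pi)
  have h1 : ∀ θ : ℝ, ∫ w, H (e θ w) ∂sphereMeasure n = ∫ w, H w ∂sphereMeasure n := fun θ =>
    (measurePreserving_sphereMeasure (e θ)).integral_comp
      (e θ).toHomeomorph.measurableEmbedding H
  simp only [hG, h1] at h
  rw [integral_const_mul, intervalIntegral.integral_const, sub_zero, Complex.real_smul] at h
  push_cast at h
  have hpi : (2 * Real.pi : ℂ) ≠ 0 :=
    mul_ne_zero two_ne_zero (Complex.ofReal_ne_zero.2 Real.pi_ne_zero)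
  exact (mul_left_cancel₀ hpi h).symm

/-- The integrand is `|w₀|^{2p} ≥ 0`. If its integral vanished, the coordinate `w₀` would vanish
almost everywhere for the Gaussian, hence everywhere by continuity. -/
theorem integral_norm_coord_pow_ne_zero (n : ℕ) [NeZero n] (p : ℕ) :
    ∫ w : EuclideanSpace ℂ (Fin n), ((starRingEnd ℂ (w 0)) ^ p * w 0 ^ p) ∂sphereMeasure n ≠ 0 := by
  have e : ∀ w : EuclideanSpace ℂ (Fin n), (starRingEnd ℂ (w 0)) ^ p * w 0 ^ p
      = ((‖w 0‖ ^ (2 * p) : ℝ) : ℂ) := fun w => by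
    rw [← mul_pow, ← Complex.normSq_eq_conj_mul_self, Complex.normSq_eq_norm_sq, pow_mul]
    push_cast; rfl
  simp only [e]
  rw [integral_complex_ofReal, Complex.ofReal_ne_zero]
  intro h0
  have hc : Continuous fun w : EuclideanSpace ℂ (Fin n) => ‖w 0‖ ^ (2 * p) := by fun_prop
  have hint : Integrable (fun w : EuclideanSpace ℂ (Fin n) => ‖w 0‖ ^ (2 * p))
      (sphereMeasure n) := by
    refine Integrable.of_bound hc.aestronglyMeasurable 1 ?_
    filter_upwards [ae_norm_eq_one_sphereMeasure n] with w hw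
    have : ‖w 0‖ ≤ 1 := hw ▸ PiLp.norm_apply_le w 0
    simpa using pow_le_one₀ (norm_nonneg _) this
  rw [integral_eq_zero_iff_of_nonneg (fun w => by positivity) hint] at h0
  have h1 : ∀ᵐ w ∂gaussian n, w 0 = (0 : ℂ) := by
    have h2 := ae_of_ae_map (measurable_normalize n).aemeasurable h0
    filter_upwards [h2, ae_ne_zero_gaussian n] with w hw hw0
    have h3 : ‖((‖w‖⁻¹ : ℝ) • w) 0‖ = 0 := by
      by_contra hne
      exact (pow_ne_zero _ hne) hw
    rw [PiLp.smul_apply, norm_smul, norm_inv, norm_norm, mul_eq_zero, inv_eq_zero,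
      norm_eq_zero, norm_eq_zero] at h3
    exact h3.resolve_left hw0
  have h4 := Fock.eq_of_ae_eq (n := n) (f := fun w => w 0) (g := fun _ => 0) (by fun_prop)
    continuous_const h1
  have h5 := congrFun h4 (EuclideanSpace.single 0 1)
  simp at h5

/-- The coordinatewise rotations of `ℂ²`. -/
def torusRotation (c : Fin 2 → Circle) :
    EuclideanSpace ℂ (Fin 2) ≃ₗᵢ[ℝ] EuclideanSpace ℂ (Fin 2) :=
  LinearIsometryEquiv.piLpCongrRight 2 fun i => rotation (c i)

theorem torusRotation_apply (c : Fin 2 → Circle) (w : EuclideanSpace ℂ (Fin 2)) (i : Fin 2) :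
    torusRotation c w i = c i * w i := by
  simp [torusRotation]

/-- Right multiplication by the unit quaternion `A + B j` on `ℂ²`. -/
def quaternionRotation (A : ℂ) (B : ℝ) (h : Complex.normSq A + B ^ 2 = 1) :
    EuclideanSpace ℂ (Fin 2) ≃ₗᵢ[ℝ] EuclideanSpace ℂ (Fin 2) where
  toFun w := !₂[A * w 0 - B * starRingEnd ℂ (w 1), A * w 1 + B * starRingEnd ℂ (w 0)]
  map_add' x y := by
    ext i; fin_cases i <;> simp <;> ring
  map_smul' r x := by
    ext i; fin_cases i <;> simp <;> ring
  invFun w := !₂[starRingEnd ℂ A * w 0 + B * starRingEnd ℂ (w 1),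
    starRingEnd ℂ A * w 1 - B * starRingEnd ℂ (w 0)]
  left_inv w := by
    have h' : starRingEnd ℂ A * A + (B : ℂ) ^ 2 = 1 := by
      rw [← Complex.normSq_eq_conj_mul_self]; exact_mod_cast h
    ext i; fin_cases i
    · simp; linear_combination (w 0) * h'
    · simp; linear_combination (w 1) * h'
  right_inv w := by
    have h' : starRingEnd ℂ A * A + (B : ℂ) ^ 2 = 1 := by
      rw [← Complex.normSq_eq_conj_mul_self]; exact_mod_cast h
    ext i; fin_cases i
    · simp; linear_combination (w 0) * h'
    · simp; linear_combination (w 1) * h'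
  norm_map' w := by
    rw [← sq_eq_sq₀ (norm_nonneg _) (norm_nonneg _), EuclideanSpace.norm_sq_eq,
      EuclideanSpace.norm_sq_eq]
    simp only [Fin.sum_univ_two, ← Complex.normSq_eq_norm_sq]
    simp [Complex.normSq_apply] at h ⊢
    linear_combination ((w 0).re ^ 2 + (w 0).im ^ 2 + (w 1).re ^ 2 + (w 1).im ^ 2) * h

theorem quaternionRotation_apply (A : ℂ) (B : ℝ) (h : Complex.normSq A + B ^ 2 = 1)
    (w : EuclideanSpace ℂ (Fin 2)) : quaternionRotation A B h w
      = !₂[A * w 0 - B * starRingEnd ℂ (w 1), A * w 1 + B * starRingEnd ℂ (w 0)] := rfl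

theorem quaternionRotation_symm_apply (A : ℂ) (B : ℝ) (h : Complex.normSq A + B ^ 2 = 1)
    (w : EuclideanSpace ℂ (Fin 2)) : (quaternionRotation A B h).symm w
      = !₂[starRingEnd ℂ A * w 0 + B * starRingEnd ℂ (w 1),
        starRingEnd ℂ A * w 1 - B * starRingEnd ℂ (w 0)] := rfl

end HTypeXray

/-! ### Taylor coefficients from averages over rotations of the sphere in `ℂ²` -/

namespace HTypeXray

/-- The integrand is holomorphic in `w₁`, so averaging over rotations of `w₁` amounts to setting `w₁
= 0`. Averaging then over rotations of `w₀`, the factor `conj(w₀)^p` selects the coefficient of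
degree `p`. -/
theorem integral_conj_coord_pow_mul {Φ : EuclideanSpace ℂ (Fin 2) → ℂ} (hΦ : Differentiable ℂ Φ)
    (A B : ℂ) (p : ℕ) :
    ∫ w, (A * starRingEnd ℂ (w 0) + B * w 1) ^ p * Φ w ∂sphereMeasure 2
      = A ^ p * taylorCoeff (fun x => Φ !₂[x, 0]) p
        * ∫ w : EuclideanSpace ℂ (Fin 2), ((starRingEnd ℂ (w 0)) ^ p * w 0 ^ p)
          ∂sphereMeasure 2 := by
  have hc := hΦ.continuous
  have hd0 : Differentiable ℂ fun x : ℂ => Φ !₂[x, 0] := by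
    refine hΦ.comp ?_
    rw [differentiable_euclidean]
    intro i; fin_cases i <;> simp
  have h1 : ∫ w, (A * starRingEnd ℂ (w 0) + B * w 1) ^ p * Φ w ∂sphereMeasure 2
      = ∫ w : EuclideanSpace ℂ (Fin 2), (A * starRingEnd ℂ (w 0)) ^ p * Φ !₂[w 0, 0]
        ∂sphereMeasure 2 := by
    refine integral_sphereMeasure_average (by fun_prop)
      (fun θ => torusRotation ![1, Circle.exp θ]) ?_ fun w => ?_
    · refine (PiLp.continuous_toLp 2 _).comp (continuous_pi fun i => ?_)
      fin_cases i <;> simp <;> fun_prop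
    · have hd : Differentiable ℂ fun x : ℂ =>
          (A * starRingEnd ℂ (w 0) + B * (x * w 1)) ^ p * Φ !₂[w 0, x * w 1] := by
        refine Differentiable.mul (by fun_prop) (hΦ.comp ?_)
        rw [differentiable_euclidean]
        intro i; fin_cases i <;> simp
      have h := integral_exp_mul_entire hd 1 0
      simp only [Int.cast_zero, zero_mul, Complex.exp_zero, one_mul, le_refl, if_true,
        Int.natAbs_zero, pow_zero, mul_one] at h
      rw [taylorCoeff] at h
      simp only [Nat.factorial_zero, Nat.cast_one, inv_one, one_mul, iteratedDeriv_zero, zero_mul,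
        mul_zero, add_zero] at h
      rw [← h]
      refine intervalIntegral.integral_congr fun θ _ => ?_
      have e : torusRotation ![1, Circle.exp θ] w
          = !₂[w 0, Complex.exp (θ * Complex.I) * w 1] := by
        ext i; rw [torusRotation_apply]; fin_cases i <;> simp
      simp only [e]
      simp
  have h2 : ∫ w : EuclideanSpace ℂ (Fin 2), (A * starRingEnd ℂ (w 0)) ^ p * Φ !₂[w 0, 0]
        ∂sphereMeasure 2
      = ∫ w : EuclideanSpace ℂ (Fin 2), A ^ p * taylorCoeff (fun x => Φ !₂[x, 0]) p
        * ((starRingEnd ℂ (w 0)) ^ p * w 0 ^ p) ∂sphereMeasure 2 := by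
    have hcont : Continuous fun w : EuclideanSpace ℂ (Fin 2) => Φ !₂[w 0, 0] :=
      hd0.continuous.comp (by fun_prop : Continuous fun w : EuclideanSpace ℂ (Fin 2) => w 0)
    refine integral_sphereMeasure_average (by fun_prop)
      (fun θ => torusRotation ![Circle.exp θ, 1]) ?_ fun w => ?_
    · refine (PiLp.continuous_toLp 2 _).comp (continuous_pi fun i => ?_)
      fin_cases i <;> simp <;> fun_prop
    · have h := integral_exp_mul_entire hd0 (w 0) (-(p : ℤ))
      rw [if_pos (by omega), Int.natAbs_neg, Int.natAbs_natCast] at h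
      have e : ∀ θ : ℝ, (A * starRingEnd ℂ ((torusRotation ![Circle.exp θ, 1] w) 0)) ^ p
          * Φ !₂[(torusRotation ![Circle.exp θ, 1] w) 0, 0]
          = (A * starRingEnd ℂ (w 0)) ^ p * (Complex.exp (((-(p : ℤ) : ℤ) : ℂ) * θ * Complex.I)
            * Φ !₂[w 0 * Complex.exp (θ * Complex.I), 0]) := fun θ => by
        have e1 : starRingEnd ℂ (Complex.exp (θ * Complex.I)) ^ p
            = Complex.exp (((-(p : ℤ) : ℤ) : ℂ) * θ * Complex.I) := by
          rw [← Complex.exp_conj, ← Complex.exp_nat_mul, map_mul, Complex.conj_I,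
            Complex.conj_ofReal]
          congr 1; push_cast; ring
        rw [torusRotation_apply, ← e1]
        simp only [Matrix.cons_val_zero, Circle.coe_exp, map_mul, mul_pow]
        rw [mul_comm (w 0)]
        ring
      simp only [e]
      rw [intervalIntegral.integral_const_mul, h]
      ring
  rw [h1, h2, integral_const_mul]

theorem integral_exp_mul_add_pow (m : ℤ) (α β : ℂ) (p j : ℕ) (hp : (p : ℤ) = m + 2 * j)
    (hj : j ≤ p) :
    ∫ θ in (0 : ℝ)..2 * Real.pi, Complex.exp (m * θ * Complex.I)
      * (α * Complex.exp (θ * Complex.I) + β * Complex.exp (-(θ * Complex.I))) ^ p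
      = 2 * Real.pi * (α ^ j * β ^ (p - j) * p.choose j) := by
  have e : ∀ θ : ℝ, Complex.exp (m * θ * Complex.I)
      * (α * Complex.exp (θ * Complex.I) + β * Complex.exp (-(θ * Complex.I))) ^ p
      = ∑ i ∈ Finset.range (p + 1), (α ^ i * β ^ (p - i) * p.choose i)
        * Complex.exp (((m + 2 * i - p : ℤ) : ℂ) * θ * Complex.I) := fun θ => by
    rw [add_pow, Finset.mul_sum]
    refine Finset.sum_congr rfl fun i hi => ?_
    have hi' : i ≤ p := Nat.lt_succ_iff.1 (Finset.mem_range.1 hi)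
    have : Complex.exp (((m + 2 * i - p : ℤ) : ℂ) * θ * Complex.I)
        = Complex.exp (m * θ * Complex.I) * (Complex.exp (θ * Complex.I) ^ i
          * Complex.exp (-(θ * Complex.I)) ^ (p - i)) := by
      rw [← Complex.exp_nat_mul, ← Complex.exp_nat_mul, ← Complex.exp_add, ← Complex.exp_add,
        Nat.cast_sub hi']
      congr 1; push_cast; ring
    rw [this, mul_pow, mul_pow]; ring
  simp only [e]
  rw [intervalIntegral.integral_finsetSum fun i _ =>
    Continuous.intervalIntegrable (by fun_prop) _ _]
  simp only [intervalIntegral.integral_const_mul, integral_exp_int_mul]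
  rw [Finset.sum_eq_single j]
  · rw [if_pos (by omega)]; ring
  · intro i _ hij
    rw [if_neg (by omega), mul_zero]
  · intro h; simp at h; omega

/-- Vanishing of one Fourier coefficient of an entire function on `ℂ²` along all the orbits of a
one-parameter group of rotations of the unit sphere. -/
theorem taylorCoeff_eq_zero_of_rotation {Φ : EuclideanSpace ℂ (Fin 2) → ℂ}
    (hΦ : Differentiable ℂ Φ) {c s : ℝ} (hcs : c ^ 2 + s ^ 2 = 1) (hs : s ≠ 0) {m : ℕ}
    (h : ∀ w : EuclideanSpace ℂ (Fin 2), ‖w‖ = 1 → ∫ θ in (0 : ℝ)..2 * Real.pi,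
      Complex.exp (m * θ * Complex.I)
        * Φ !₂[(Real.cos θ + c * Real.sin θ * Complex.I) * w 0
            - (s * Real.sin θ : ℝ) * starRingEnd ℂ (w 1),
          (Real.cos θ + c * Real.sin θ * Complex.I) * w 1
            + (s * Real.sin θ : ℝ) * starRingEnd ℂ (w 0)] = 0)
    {p j : ℕ} (hp : p = m + 2 * j) : taylorCoeff (fun x => Φ !₂[x, 0]) p = 0 := by
  have hc := hΦ.continuous
  have hAB : ∀ θ : ℝ, Complex.normSq (Real.cos θ + c * Real.sin θ * Complex.I)
      + (s * Real.sin θ) ^ 2 = 1 := fun θ => by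
    rw [← Complex.ofReal_mul, Complex.normSq_add_mul_I]
    linear_combination (Real.sin θ) ^ 2 * hcs + Real.sin_sq_add_cos_sq θ
  set A : ℝ → ℂ := fun θ => Real.cos θ + c * Real.sin θ * Complex.I with hA
  set B : ℝ → ℝ := fun θ => s * Real.sin θ with hB
  have hAc : Continuous A := by fun_prop
  have hBc : Continuous B := by fun_prop
  have hcont : Continuous fun q : ℝ × EuclideanSpace ℂ (Fin 2) =>
      quaternionRotation (A q.1) (B q.1) (hAB q.1) q.2 := by
    simp only [quaternionRotation_apply]
    refine (PiLp.continuous_toLp 2 _).comp (continuous_pi fun i => ?_)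
    fin_cases i <;> simp <;> fun_prop
  -- The hypothesis is tested against `conj(w₀)^p` on the sphere. Integrating in `θ` first gives
  -- `0`; integrating over the sphere first moves the rotation onto the test function and gives
  -- `A(θ)^p` times the wanted coefficient.
  have hswap := integral_sphereMeasure_swap (n := 2) (F := fun θ w => (starRingEnd ℂ (w 0)) ^ p
    * (Complex.exp (m * θ * Complex.I) * Φ (quaternionRotation (A θ) (B θ) (hAB θ) w)))
    (by
      have h1 : Continuous fun q : ℝ × EuclideanSpace ℂ (Fin 2) =>
        Φ (quaternionRotation (A q.1) (B q.1) (hAB q.1) q.2) := hc.comp hcont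
      have h2 : Continuous fun q : ℝ × EuclideanSpace ℂ (Fin 2) =>
        (starRingEnd ℂ (q.2 0)) ^ p := by fun_prop
      have h3 : Continuous fun q : ℝ × EuclideanSpace ℂ (Fin 2) =>
        Complex.exp (m * q.1 * Complex.I) := by fun_prop
      exact h2.mul (h3.mul h1)) 0 (2 * Real.pi)
  have hleft : ∫ w, (∫ θ in (0 : ℝ)..2 * Real.pi, (starRingEnd ℂ (w 0)) ^ p
      * (Complex.exp (m * θ * Complex.I) * Φ (quaternionRotation (A θ) (B θ) (hAB θ) w)))
      ∂sphereMeasure 2 = 0 := by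
    refine (integral_congr_ae ?_).trans (integral_zero _ _)
    filter_upwards [ae_norm_eq_one_sphereMeasure 2] with w hw
    rw [intervalIntegral.integral_const_mul]
    simp only [quaternionRotation_apply]
    rw [h w hw, mul_zero]
  have hright : ∀ θ : ℝ, ∫ w, (starRingEnd ℂ (w 0)) ^ p
      * (Complex.exp (m * θ * Complex.I) * Φ (quaternionRotation (A θ) (B θ) (hAB θ) w))
      ∂sphereMeasure 2
      = Complex.exp (m * θ * Complex.I) * A θ ^ p * (taylorCoeff (fun x => Φ !₂[x, 0]) p
        * ∫ w : EuclideanSpace ℂ (Fin 2), ((starRingEnd ℂ (w 0)) ^ p * w 0 ^ p)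
          ∂sphereMeasure 2) := fun θ => by
    set e := quaternionRotation (A θ) (B θ) (hAB θ) with he
    -- The inverse rotation turns `conj(w₀)` into `A conj(w₀) + B w₁`, the form treated by
    -- `integral_conj_coord_pow_mul`.
    have h1 := (measurePreserving_sphereMeasure e).integral_comp
      e.toHomeomorph.measurableEmbedding
      (fun w => Complex.exp (m * θ * Complex.I) * ((starRingEnd ℂ ((e.symm w) 0)) ^ p * Φ w))
    simp only [LinearIsometryEquiv.symm_apply_apply] at h1
    have h2 := integral_conj_coord_pow_mul hΦ (A θ) (B θ) p
    rw [integral_const_mul, integral_const_mul] at h1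
    have h3 : ∀ w : EuclideanSpace ℂ (Fin 2), starRingEnd ℂ ((e.symm w) 0)
        = A θ * starRingEnd ℂ (w 0) + B θ * w 1 := fun w => by
      rw [he, quaternionRotation_symm_apply]; simp
    simp only [h3] at h1
    rw [h2] at h1
    refine Eq.trans ?_ (h1.trans (by ring))
    rw [← integral_const_mul]
    refine integral_congr_ae (Filter.Eventually.of_forall fun w => ?_)
    simp only
    ring
  rw [hleft] at hswap
  simp only [hright] at hswap
  rw [intervalIntegral.integral_mul_const] at hswap
  have hA' : ∀ θ : ℝ, A θ = ((1 + c) / 2 : ℂ) * Complex.exp (θ * Complex.I)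
      + ((1 - c) / 2 : ℂ) * Complex.exp (-(θ * Complex.I)) := fun θ => by
    rw [← neg_mul, ← Complex.ofReal_neg, Complex.exp_mul_I, Complex.exp_mul_I, hA]
    push_cast
    rw [Complex.cos_neg, Complex.sin_neg]
    ring
  -- `A` is a combination of `e^{iθ}` and `e^{-iθ}` with weights `(1 ± c) / 2`, both nonzero because
  -- `s ≠ 0` forces `|c| < 1`. All frequencies of the parity of `p` between `-p` and `p` therefore
  -- occur in `A^p`.
  have hne : ∫ θ in (0 : ℝ)..2 * Real.pi, Complex.exp (m * θ * Complex.I) * A θ ^ p ≠ 0 := by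
    simp only [hA']
    have h1 := integral_exp_mul_add_pow (m : ℤ) ((1 + c) / 2 : ℂ) ((1 - c) / 2 : ℂ) p j
      (by omega) (by omega)
    simp only [Int.cast_natCast] at h1
    rw [h1]
    have hpi : (Real.pi : ℂ) ≠ 0 := Complex.ofReal_ne_zero.2 Real.pi_ne_zero
    have hs2 : 0 < s ^ 2 := by positivity
    have hc1 : (1 + c : ℂ) ≠ 0 := by
      have : (1 + c : ℝ) ≠ 0 := fun h0 => by nlinarith
      exact_mod_cast this
    have hc2 : (1 - c : ℂ) ≠ 0 := by
      have : (1 - c : ℝ) ≠ 0 := fun h0 => by nlinarith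
      exact_mod_cast this
    have hch : ((p.choose j : ℕ) : ℂ) ≠ 0 :=
      Nat.cast_ne_zero.2 (Nat.choose_pos (by omega)).ne'
    exact mul_ne_zero (mul_ne_zero two_ne_zero hpi) (mul_ne_zero (mul_ne_zero
      (pow_ne_zero _ (div_ne_zero hc1 two_ne_zero)) (pow_ne_zero _ (div_ne_zero hc2 two_ne_zero)))
      hch)
  exact (mul_eq_zero.1 ((mul_eq_zero.1 hswap.symm).resolve_left hne)).resolve_right
    (integral_norm_coord_pow_ne_zero 2 p)

end HTypeXray

/-! ### Uniqueness for twisted averages along curves transversal to the complex structure -/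

namespace HTypeXray

/-- All the twisted averages of frequency `m` along the curves `θ ↦ cos θ v + sin θ T v`, `|v| = a`,
vanish. -/
def TwistedVanish {n : ℕ} (φ : EuclideanSpace ℂ (Fin n) → ℂ)
    (T : EuclideanSpace ℂ (Fin n) → EuclideanSpace ℂ (Fin n)) (a : ℝ) (m : ℤ) : Prop :=
  ∀ v, ‖v‖ = a → ∀ ζ, ∫ θ in (0 : ℝ)..2 * Real.pi, Complex.exp (m * θ * Complex.I)
    * Complex.exp (-inner ℂ (Real.cos θ • v + Real.sin θ • T v) ζ)
    * φ (ζ + (Real.cos θ • v + Real.sin θ • T v)) = 0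

variable {n : ℕ} {φ : EuclideanSpace ℂ (Fin n) → ℂ} {a : ℝ}

theorem TwistedVanish.neg {T : EuclideanSpace ℂ (Fin n) → EuclideanSpace ℂ (Fin n)} {m : ℤ}
    (h : TwistedVanish φ T a m) : TwistedVanish φ (fun v => -T v) a (-m) := by
  intro v hv ζ
  rw [← h v hv ζ]
  set F : ℝ → ℂ := fun θ => Complex.exp (m * θ * Complex.I)
    * Complex.exp (-inner ℂ (Real.cos θ • v + Real.sin θ • T v) ζ)
    * φ (ζ + (Real.cos θ • v + Real.sin θ • T v)) with hF
  have hsub := intervalIntegral.integral_comp_sub_left (a := 0) (b := 2 * Real.pi) F (2 * Real.pi)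
  simp only [sub_self, sub_zero] at hsub
  rw [← hsub]
  refine intervalIntegral.integral_congr fun θ _ => ?_
  have e1 : Complex.exp (m * ((2 * Real.pi - θ : ℝ) : ℂ) * Complex.I)
      = Complex.exp (((-m : ℤ) : ℂ) * θ * Complex.I) := by
    rw [Complex.exp_eq_exp_iff_exists_int]
    exact ⟨m, by push_cast; ring⟩
  simp only [hF, e1, Real.cos_two_pi_sub, Real.sin_two_pi_sub, neg_smul, smul_neg]

/-- The quaternionic structures on `ℂⁿ`. -/
structure IsQuaternionic (K : EuclideanSpace ℂ (Fin n) →ₗ[ℝ] EuclideanSpace ℂ (Fin n)) : Prop where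
  map_I_smul : ∀ v, K (Complex.I • v) = -(Complex.I • K v)
  map_map : ∀ v, K (K v) = -v
  norm_map : ∀ v, ‖K v‖ = ‖v‖

namespace IsQuaternionic

variable {K : EuclideanSpace ℂ (Fin n) →ₗ[ℝ] EuclideanSpace ℂ (Fin n)}

theorem map_smul (hK : IsQuaternionic K) (z : ℂ) (v : EuclideanSpace ℂ (Fin n)) :
    K (z • v) = starRingEnd ℂ z • K v := by
  have e : ∀ (z : ℂ) (v : EuclideanSpace ℂ (Fin n)), z • v = z.re • v + z.im • (Complex.I • v) :=
    fun z v => by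
      ext i
      simp only [PiLp.smul_apply, PiLp.add_apply, smul_eq_mul, Complex.real_smul]
      conv_lhs => rw [← Complex.re_add_im z]
      ring
  rw [e z, map_add, LinearMap.map_smul, LinearMap.map_smul, hK.map_I_smul, e (starRingEnd ℂ z)]
  simp

/-- `K` is isometric and maps `v + K v` to `K v - v`, so `|v + K v| = |v - K v|` and the real part
vanishes. The same argument with `i v` in place of the first `v` handles the imaginary part. -/
theorem inner_eq_zero (hK : IsQuaternionic K) (v : EuclideanSpace ℂ (Fin n)) :
    inner ℂ v (K v) = 0 := by
  have key : ∀ x y : EuclideanSpace ℂ (Fin n), ‖x + y‖ = ‖x - y‖ → (inner ℂ x y).re = 0 :=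
    fun x y h => by
      have h1 := @norm_add_sq ℂ _ _ _ _ x y
      have h2 := @norm_sub_sq ℂ _ _ _ _ x y
      rw [h] at h1
      simp only [RCLike.re_eq_complex_re] at h1 h2
      linarith
  have h1 : (inner ℂ v (K v)).re = 0 := by
    refine key _ _ ?_
    rw [← hK.norm_map (v + K v), map_add, hK.map_map, ← sub_eq_add_neg, norm_sub_rev]
  have h2 : (inner ℂ (Complex.I • v) (K v)).re = 0 := by
    refine key _ _ ?_
    rw [← hK.norm_map (Complex.I • v + K v), map_add, hK.map_map, hK.map_I_smul]
    have : -(Complex.I • K v) + -v = -Complex.I • (K v - Complex.I • v) := by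
      rw [smul_sub, smul_smul]; simp [sub_eq_add_neg]
    rw [this, norm_smul, norm_neg, Complex.norm_I, one_mul, norm_sub_rev]
  apply Complex.ext
  · exact h1
  · rw [inner_smul_left] at h2
    simpa using h2

theorem norm_smul_add_smul (hK : IsQuaternionic K) (v : EuclideanSpace ℂ (Fin n))
    (w : EuclideanSpace ℂ (Fin 2)) : ‖w 0 • v + w 1 • K v‖ = ‖w‖ * ‖v‖ := by
  rw [← sq_eq_sq₀ (norm_nonneg _) (by positivity), @norm_add_sq ℂ, inner_smul_left,
    inner_smul_right, hK.inner_eq_zero, norm_smul, norm_smul, hK.norm_map, mul_pow, mul_pow,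
    mul_pow, EuclideanSpace.norm_sq_eq w, Fin.sum_univ_two]
  simp
  ring

end IsQuaternionic

/-- On the quaternionic line spanned by `v` and `K v`, a scaled copy of `ℂ²`, the map `c i + s K`
acts as right multiplication by a unit imaginary quaternion. At the centre `ζ = 0` the exponential
twist disappears, leaving a Fourier coefficient along orbits of rotations of the sphere, as in
`taylorCoeff_eq_zero_of_rotation`. Homogeneity removes the condition `|v| = a`. -/
theorem homPart_eq_zero_of_twistedVanish [NeZero n] (hφ : Differentiable ℂ φ)
    {K : EuclideanSpace ℂ (Fin n) →ₗ[ℝ] EuclideanSpace ℂ (Fin n)} (hK : IsQuaternionic K)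
    (ha : 0 < a) {c s : ℝ} (hcs : c ^ 2 + s ^ 2 = 1) (hs : s ≠ 0) {m : ℕ}
    (h : TwistedVanish φ (fun v => c • (Complex.I • v) + s • K v) a m)
    {p j : ℕ} (hp : p = m + 2 * j) (v : EuclideanSpace ℂ (Fin n)) : homPart φ p v = 0 := by
  have main : ∀ v : EuclideanSpace ℂ (Fin n), ‖v‖ = a → homPart φ p v = 0 := by
    intro v hv
    set Φ : EuclideanSpace ℂ (Fin 2) → ℂ := fun w => φ (w 0 • v + w 1 • K v) with hΦ
    have hd : Differentiable ℂ Φ := by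
      refine hφ.comp ?_
      fun_prop
    have h1 := taylorCoeff_eq_zero_of_rotation hd hcs hs (m := m) (fun w hw => ?_) hp
    · simpa [hΦ, homPart] using h1
    · have hn : ‖w 0 • v + w 1 • K v‖ = a := by rw [hK.norm_smul_add_smul, hw, hv, one_mul]
      rw [← h _ hn 0]
      refine intervalIntegral.integral_congr fun θ _ => ?_
      simp only [inner_zero_right, neg_zero, Complex.exp_zero, mul_one, zero_add, hΦ,
        Int.cast_natCast]
      congr 2
      rw [map_add, hK.map_smul, hK.map_smul, hK.map_map]
      ext i
      simp only [PiLp.add_apply, PiLp.smul_apply, PiLp.neg_apply, smul_eq_mul, Complex.real_smul,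
        Matrix.cons_val_zero, Matrix.cons_val_one, Complex.ofReal_mul]
      ring
  rcases eq_or_ne v 0 with rfl | hv
  · rw [show (0 : EuclideanSpace ℂ (Fin n)) = (0 : ℂ) • EuclideanSpace.single 0 (a : ℂ) by simp,
      homPart_smul hφ, main _ (by simp [abs_of_pos ha]), mul_zero]
  · have hv' : (‖v‖ : ℂ) ≠ 0 := Complex.ofReal_ne_zero.2 (norm_ne_zero_iff.2 hv)
    have h2 := main (((a / ‖v‖ : ℝ) : ℂ) • v) (by
      rw [norm_smul, Complex.norm_real, Real.norm_of_nonneg (by positivity),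
        div_mul_cancel₀ _ (norm_ne_zero_iff.2 hv)])
    rw [homPart_smul hφ] at h2
    refine (mul_eq_zero.1 h2).resolve_left (pow_ne_zero _ ?_)
    rw [Complex.ofReal_ne_zero]
    exact (div_pos ha (norm_pos_iff.2 hv)).ne'


/-- The curve through `v` has the form `e^{iθ} z₁ + e^{-iθ} z₂`, and
`homPart_eq_zero_of_twisted_average` kills the top component at `z₂`. Since `s ≠ 0`, the vector `v`
can be chosen so that `z₂` points in any prescribed direction `y`. -/
theorem homPart_eq_zero_of_twistedVanish_of_le [NeZero n] (hφ : Differentiable ℂ φ)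
    {K : EuclideanSpace ℂ (Fin n) →ₗ[ℝ] EuclideanSpace ℂ (Fin n)} (hK : IsQuaternionic K)
    (ha : 0 < a) {c s : ℝ} (hcs : c ^ 2 + s ^ 2 = 1) (hs : s ≠ 0) {m κ : ℕ} (hκ : κ ≤ m)
    (h : TwistedVanish φ (fun v => c • (Complex.I • v) + s • K v) a m)
    (hdeg : ∀ k, κ + 1 ≤ k → ∀ v, homPart φ k v = 0) (y : EuclideanSpace ℂ (Fin n)) :
    homPart φ κ y = 0 := by
  have hs2 : 0 < s ^ 2 := by positivity
  have hc : 0 < 1 - c := by nlinarith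
  have main : ∀ y : EuclideanSpace ℂ (Fin n), y ≠ 0 → homPart φ κ y = 0 := by
    intro y hy
    set M : EuclideanSpace ℂ (Fin n) → EuclideanSpace ℂ (Fin n) := fun v => Complex.I • K v with hM
    have hMM : ∀ v, M (M v) = -v := fun v => by
      simp only [hM]
      rw [hK.map_I_smul, hK.map_map]
      simp [smul_smul]
    have hMr : ∀ (r : ℝ) v, M (r • v) = r • M v := fun r v => by
      simp only [hM]
      rw [LinearMap.map_smul, smul_comm]
    have hMa : ∀ v w, M (v - w) = M v - M w := fun v w => by
      simp only [hM]
      rw [map_sub, smul_sub]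
    -- Since `M² = -1`, the operator `(1 - c) + s M` defining `2 z₂` is inverted, up to the scalar
    -- `(1 - c)² + s² = 2(1 - c)`, by `(1 - c) - s M`.
    set v₀ := (1 - c) • y - s • M y with hv₀
    have hz₀ : (1 - c) • v₀ + s • M v₀ = (2 * (1 - c)) • y := by
      rw [hv₀, hMa, hMr, hMr, hMM]
      have : (2 * (1 - c)) • y = ((1 - c) ^ 2 + s ^ 2) • y := by
        congr 1; linear_combination -hcs
      rw [this]
      module
    have hv₀ne : v₀ ≠ 0 := fun h0 => by
      have h1 : M 0 = 0 := by simp [hM]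
      rw [h0, h1, smul_zero, smul_zero, add_zero] at hz₀
      exact (smul_ne_zero (by positivity) hy) hz₀.symm
    have hv₀n : 0 < ‖v₀‖ := norm_pos_iff.2 hv₀ne
    set t : ℝ := a / ‖v₀‖ with ht
    have ht0 : 0 < t := div_pos ha hv₀n
    have hvn : ‖t • v₀‖ = a := by
      rw [norm_smul, Real.norm_of_nonneg ht0.le, ht, div_mul_cancel₀ _ hv₀n.ne']
    set v := t • v₀ with hv
    have hvne : v ≠ 0 := smul_ne_zero ht0.ne' hv₀ne
    set z₁ := (1 / 2 : ℝ) • ((1 + c) • v - s • M v) with hz₁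
    set z₂ := (1 / 2 : ℝ) • ((1 - c) • v + s • M v) with hz₂
    have hz₂y : z₂ = ((t * (1 - c) : ℝ) : ℂ) • y := by
      have : ((t * (1 - c) : ℝ) : ℂ) • y = (t * (1 - c)) • y := by ext i; simp
      rw [this, hz₂, hv, hMr, smul_comm _ t v₀, smul_comm _ t (M v₀), ← smul_add, hz₀]
      module
    have hz₁ne : z₁ ≠ 0 := by
      intro h0
      rw [hz₁] at h0
      have h1 := (smul_eq_zero.1 h0).resolve_left (by norm_num)
      have h2 : ∀ x, (1 + c) • ((1 + c) • x - s • M x) + s • M ((1 + c) • x - s • M x)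
          = ((1 + c) ^ 2 + s ^ 2) • x := fun x => by
        rw [hMa, hMr, hMr, hMM]; module
      replace h2 := h2 v
      have h3 : M 0 = 0 := by simp [hM]
      rw [h1, h3, smul_zero, smul_zero, add_zero] at h2
      exact (smul_ne_zero (by positivity) hvne) h2.symm
    have hcurve : ∀ θ : ℝ, Real.cos θ • v + Real.sin θ • (c • (Complex.I • v) + s • K v)
        = Complex.exp (θ * Complex.I) • z₁ + (Complex.exp (θ * Complex.I))⁻¹ • z₂ := fun θ => by
      rw [← Complex.exp_neg, ← neg_mul, ← Complex.ofReal_neg, Complex.exp_mul_I,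
        Complex.exp_mul_I, hz₁, hz₂]
      ext i
      simp only [hM, PiLp.add_apply, PiLp.sub_apply, PiLp.smul_apply, smul_eq_mul,
        Complex.real_smul]
      push_cast
      rw [Complex.cos_neg, Complex.sin_neg]
      linear_combination (Complex.sin θ * s * K v i) * Complex.I_mul_I
    have h0 := homPart_eq_zero_of_twisted_average hφ hκ hdeg hz₁ne (z₂ := z₂) (fun ζ => by
      have := h v hvn ζ
      simp only [hcurve] at this
      exact_mod_cast this)
    rw [hz₂y, homPart_smul hφ] at h0
    refine (mul_eq_zero.1 h0).resolve_left (pow_ne_zero _ (Complex.ofReal_ne_zero.2 ?_))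
    positivity
  rcases eq_or_ne y 0 with rfl | hy
  · rw [show (0 : EuclideanSpace ℂ (Fin n)) = (0 : ℂ) • EuclideanSpace.single 0 (1 : ℂ) by simp,
      homPart_smul hφ, main _ (by simp), mul_zero]
  · exact main y hy

/-- The two frequencies have opposite parities, so together they kill every component of degree at
least `m`, the larger one. The lower components then go by descending induction, using the frequency
`m` alone. -/
theorem eq_zero_of_twistedVanish_nat [NeZero n] (hφ : Differentiable ℂ φ)
    {K K' : EuclideanSpace ℂ (Fin n) →ₗ[ℝ] EuclideanSpace ℂ (Fin n)} (hK : IsQuaternionic K)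
    (hK' : IsQuaternionic K') (ha : 0 < a) {c s c' s' : ℝ} (hcs : c ^ 2 + s ^ 2 = 1) (hs : s ≠ 0)
    (hcs' : c' ^ 2 + s' ^ 2 = 1) (hs' : s' ≠ 0) {m m' : ℕ} (hmm : m % 2 ≠ m' % 2) (hle : m' ≤ m)
    (h : TwistedVanish φ (fun v => c • (Complex.I • v) + s • K v) a m)
    (h' : TwistedVanish φ (fun v => c' • (Complex.I • v) + s' • K' v) a m') :
    ∀ ζ, φ ζ = 0 := by
  have hlarge : ∀ p, m ≤ p → ∀ v, homPart φ p v = 0 := fun p hp v => by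
    rcases eq_or_ne (p % 2) (m % 2) with hpm | hpm
    · exact homPart_eq_zero_of_twistedVanish hφ hK ha hcs hs h (j := (p - m) / 2) (by omega) v
    · exact homPart_eq_zero_of_twistedVanish hφ hK' ha hcs' hs' h' (j := (p - m') / 2) (by omega) v
  have hall : ∀ i, i ≤ m → ∀ k, m - i ≤ k → ∀ v, homPart φ k v = 0 := by
    intro i
    induction i with
    | zero => intro _ k hk; exact hlarge k (by omega)
    | succ i ih =>
      intro hi k hk
      rcases Nat.lt_or_ge (m - (i + 1)) k with hlt | hge
      · exact ih (by omega) k (by omega)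
      · exact homPart_eq_zero_of_twistedVanish_of_le hφ hK ha hcs hs (by omega) h
          fun k' hk' => ih (by omega) k' (by omega)
  intro ζ
  rw [eq_sum_homPart hφ (N := 0) (fun k _ => hall m le_rfl k (by omega))]
  simp

/-- Reversing the orientation of the curve changes the signs of both the frequency and `(c, s)`, so
nonnegative frequencies suffice. -/
theorem TwistedVanish.natAbs
    {K : EuclideanSpace ℂ (Fin n) →ₗ[ℝ] EuclideanSpace ℂ (Fin n)}
    {c s : ℝ} (hcs : c ^ 2 + s ^ 2 = 1) (hs : s ≠ 0) {m : ℤ}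
    (h : TwistedVanish φ (fun v => c • (Complex.I • v) + s • K v) a m) :
    ∃ c' s' : ℝ, c' ^ 2 + s' ^ 2 = 1 ∧ s' ≠ 0 ∧
      TwistedVanish φ (fun v => c' • (Complex.I • v) + s' • K v) a m.natAbs := by
  rcases Int.natAbs_eq m with hm | hm
  · exact ⟨c, s, hcs, hs, hm ▸ h⟩
  · refine ⟨-c, -s, by simpa using hcs, neg_ne_zero.2 hs, ?_⟩
    have h1 := h.neg
    rw [show -m = m.natAbs by omega] at h1
    convert! h1 using 2 with v
    module

/-- An entire function whose twisted averages of two consecutive frequencies along curves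
transversal to the complex structure vanish is zero. -/
theorem eq_zero_of_twistedVanish [NeZero n] (hφ : Differentiable ℂ φ)
    {K K' : EuclideanSpace ℂ (Fin n) →ₗ[ℝ] EuclideanSpace ℂ (Fin n)} (hK : IsQuaternionic K)
    (hK' : IsQuaternionic K') (ha : 0 < a) {c s c' s' : ℝ} (hcs : c ^ 2 + s ^ 2 = 1) (hs : s ≠ 0)
    (hcs' : c' ^ 2 + s' ^ 2 = 1) (hs' : s' ≠ 0) {m : ℤ}
    (h : TwistedVanish φ (fun v => c • (Complex.I • v) + s • K v) a m)
    (h' : TwistedVanish φ (fun v => c' • (Complex.I • v) + s' • K' v) a (m + 1)) :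
    ∀ ζ, φ ζ = 0 := by
  obtain ⟨c₁, s₁, hcs₁, hs₁, h₁⟩ := h.natAbs hcs hs
  obtain ⟨c₂, s₂, hcs₂, hs₂, h₂⟩ := h'.natAbs hcs' hs'
  rcases le_total (m + 1).natAbs m.natAbs with hle | hle
  · exact eq_zero_of_twistedVanish_nat hφ hK hK' ha hcs₁ hs₁ hcs₂ hs₂ (by omega) hle h₁ h₂
  · exact eq_zero_of_twistedVanish_nat hφ hK' hK ha hcs₂ hs₂ hcs₁ hs₁ (by omega) hle h₂ h₁

end HTypeXray

/-! ### Unfolding the X-ray transform over one period of the geodesic -/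

namespace HTypeXray

section Unfolding

/-- If `r (s + T) = r s - 1`, then `{s | r s ∈ (0, 1]}` is a fundamental domain of `ℝ / Tℤ`. -/
theorem isAddFundamentalDomain_preimage {r : ℝ → ℝ} (hr : Measurable r) {T : ℝ} (hT : 0 < T)
    (hrT : ∀ s, r (s + T) = r s - 1) :
    IsAddFundamentalDomain (AddSubgroup.zmultiples T) (r ⁻¹' Set.Ioc 0 1) volume := by
  have hk : ∀ (k : ℤ) (s : ℝ), r (s + k • T) = r s - k := by
    intro k s
    induction k using Int.induction_on with
    | zero => simp
    | succ i ih => rw [add_smul, one_smul, ← add_assoc, hrT, ih]; push_cast; ring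
    | pred i ih =>
      have := hrT (s + (-(i : ℤ) - 1) • T)
      rw [add_assoc, ← add_one_zsmul, sub_add_cancel, ih] at this
      push_cast at this ⊢; linarith
  refine IsAddFundamentalDomain.mk' (hr measurableSet_Ioc).nullMeasurableSet fun x => ?_
  have hb : Function.Bijective (Set.codRestrict (fun n : ℤ => n • T)
      (AddSubgroup.zmultiples T : Set ℝ) fun n => ⟨n, rfl⟩) :=
    (Equiv.ofInjective (fun n : ℤ => n • T) (zsmul_left_strictMono hT).injective).bijective
  refine hb.existsUnique_iff.2 ?_
  obtain ⟨k, hk1, hk2⟩ := existsUnique_sub_zsmul_mem_Ioc (one_pos (α := ℝ)) (r x) 0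
  have e : ∀ j : ℤ, (Set.codRestrict (fun n : ℤ => n • T)
      (AddSubgroup.zmultiples T : Set ℝ) (fun n => ⟨n, rfl⟩) j) +ᵥ x ∈ r ⁻¹' Set.Ioc 0 1
      ↔ r x - j • (1 : ℝ) ∈ Set.Ioc 0 (0 + 1) := fun j => by
    change r (j • T + x) ∈ Set.Ioc 0 1 ↔ _
    rw [add_comm, hk, zero_add]
    simp
  exact ⟨k, (e k).2 hk1, fun j hj => hk2 j ((e j).1 hj)⟩

theorem setIntegral_preimage_eq {r : ℝ → ℝ} (hr : Measurable r) {T : ℝ} (hT : 0 < T)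
    (hrT : ∀ s, r (s + T) = r s - 1) {v : ℝ → ℂ} (hv : ∀ s, v (s + T) = v s) :
    ∫ s in r ⁻¹' Set.Ioc 0 1, v s = ∫ s in (0 : ℝ)..T, v s := by
  rw [intervalIntegral.integral_of_le hT.le]
  have h2 := isAddFundamentalDomain_Ioc hT 0
  rw [zero_add] at h2
  refine (isAddFundamentalDomain_preimage hr hT hrT).setIntegral_eq h2 fun g x => ?_
  obtain ⟨k, hk⟩ := AddSubgroup.mem_zmultiples_iff.1 g.2
  rw [AddSubgroup.vadd_def, ← hk, vadd_eq_add, add_comm]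
  exact Function.Periodic.int_mul (f := v) (c := T) hv k x |> fun h => by simpa using h

theorem volume_preimage_eq {r : ℝ → ℝ} (hr : Measurable r) {T : ℝ} (hT : 0 < T)
    (hrT : ∀ s, r (s + T) = r s - 1) : volume (r ⁻¹' Set.Ioc 0 1) = ENNReal.ofReal T := by
  have h2 := isAddFundamentalDomain_Ioc hT 0
  rw [zero_add] at h2
  rw [(isAddFundamentalDomain_preimage hr hT hrT).measure_eq h2, Real.volume_Ioc, sub_zero]

end Unfolding

namespace HTypeAlgebra

variable {V : Type u} {Z : Type w}
  [NormedAddCommGroup V] [InnerProductSpace ℝ V] [FiniteDimensional ℝ V]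
  [NormedAddCommGroup Z] [InnerProductSpace ℝ Z] [FiniteDimensional ℝ Z]

theorem continuous_bracket (D : HTypeAlgebra V Z) :
    Continuous fun p : V × V => D.bracket p.1 p.2 := by
  let b := stdOrthonormalBasis ℝ V
  have h : (fun p : V × V => D.bracket p.1 p.2)
      = fun p => ∑ i, (inner ℝ (b i) p.1) • (D.bracket (b i)).toContinuousLinearMap p.2 := by
    funext p
    conv_lhs => rw [← b.sum_repr' p.1]
    simp
  rw [h]
  fun_prop

theorem continuous_mul (D : HTypeAlgebra V Z) :
    Continuous fun p : (V × Z) × (V × Z) => D.mul p.1 p.2 := by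
  have := D.continuous_bracket.comp
    (by fun_prop : Continuous fun p : (V × Z) × (V × Z) => (p.1.1, p.2.1))
  simp only [Function.comp_def] at this
  simp only [mul]
  fun_prop

theorem mul_neg_cancel_right (D : HTypeAlgebra V Z) (g h : V × Z) :
    D.mul (D.mul g h) (-h) = g := by
  ext
  · simp [mul]
  · simp [mul, D.bracket_self]
    abel

theorem mul_neg_self (D : HTypeAlgebra V Z) (h : V × Z) : D.mul h (-h) = 0 := by
  ext <;> simp [mul, D.bracket_self]

theorem mul_central (D : HTypeAlgebra V Z) (g : V × Z) (z : Z) :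
    D.mul g (0, z) = (g.1, g.2 + z) := by
  simp [mul]

theorem helix_apply (D : HTypeAlgebra V Z) {lam : Z} (hlam : lam ≠ 0) {ν : V} (hν : ‖ν‖ = 1)
    (s : ℝ) : D.helix ν lam s
      = (Real.cos (‖lam‖ * s) • (Ring.inverse (D.J lam) ν)
          + (Real.sin (‖lam‖ * s) / ‖lam‖) • D.J lam (Ring.inverse (D.J lam) ν),
        (s / (2 * ‖lam‖ ^ 2)) • lam) := by
  rw [helix, D.exp_smul_J hlam, hν]
  simp

theorem continuous_helix (D : HTypeAlgebra V Z) {lam : Z} (hlam : lam ≠ 0) {ν : V}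
    (hν : ‖ν‖ = 1) : Continuous (D.helix ν lam) := by
  rw [funext (D.helix_apply hlam hν)]
  fun_prop

theorem helix_add_period (D : HTypeAlgebra V Z) {lam : Z} (hlam : lam ≠ 0) {ν : V}
    (hν : ‖ν‖ = 1) (s : ℝ) : D.helix ν lam (s + 2 * Real.pi / ‖lam‖)
      = ((D.helix ν lam s).1, (D.helix ν lam s).2 + (Real.pi / ‖lam‖ ^ 3) • lam) := by
  have hn : ‖lam‖ ≠ 0 := norm_ne_zero_iff.2 hlam
  have e : ‖lam‖ * (s + 2 * Real.pi / ‖lam‖) = ‖lam‖ * s + 2 * Real.pi := by field_simp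
  rw [D.helix_apply hlam hν, D.helix_apply hlam hν, e, Real.cos_add_two_pi, Real.sin_add_two_pi,
    ← add_smul]
  congr 2
  field_simp

theorem norm_J (D : HTypeAlgebra V Z) (μ : Z) (x : V) : ‖D.J μ x‖ = ‖μ‖ * ‖x‖ := by
  rw [← sq_eq_sq₀ (norm_nonneg _) (by positivity), ← real_inner_self_eq_norm_sq,
    D.inner_J_right, D.J_J, inner_smul_left, real_inner_self_eq_norm_sq]
  simp; ring

variable [MeasurableSpace V] [BorelSpace V] [MeasurableSpace Z] [BorelSpace Z]

theorem measurePreserving_mul_right (D : HTypeAlgebra V Z) (h : V × Z) :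
    MeasurePreserving fun g : V × Z => D.mul g h := by
  have hc := D.continuous_bracket.comp (by fun_prop : Continuous fun x : V => (x, h.1))
  simp only [Function.comp_def] at hc
  have := (measurePreserving_add_right (volume : Measure V) h.1).skew_product
    (μc := (volume : Measure Z)) (μd := (volume : Measure Z))
    (g := fun x u => u + (h.2 + (1 / 2 : ℝ) • D.bracket x h.1))
    (Continuous.measurable (by simp only [Function.uncurry_def]; fun_prop))
    (Filter.Eventually.of_forall fun x => (measurePreserving_add_right _ _).map_eq)
  convert! this using 2 with g
  · simp only [mul, add_assoc]

theorem measurePreserving_shear (D : HTypeAlgebra V Z) {γ : ℝ → V × Z} (hγ : Continuous γ) :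
    MeasurePreserving (fun q : ℝ × (V × Z) => (q.1, D.mul q.2 (γ q.1)))
      (volume.prod volume) (volume.prod volume) := by
  refine (MeasurePreserving.id (volume : Measure ℝ)).skew_product
    (g := fun s g => D.mul g (γ s)) (Continuous.measurable ?_)
    (Filter.Eventually.of_forall fun s => (D.measurePreserving_mul_right (γ s)).map_eq)
  exact D.continuous_mul.comp
    (by fun_prop : Continuous fun q : ℝ × (V × Z) => (q.2, γ q.1))

/-- If the X-ray transform of `f` vanishes, then so do the averages of `f` against the
translates by the geodesic of a bounded function invariant under the period of the geodesic. -/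
theorem integral_translate_eq_zero (D : HTypeAlgebra V Z) {f : V × Z → ℂ} (hf : Integrable f)
    {lam : Z} (hlam : lam ≠ 0) {ν : V} (hν : ‖ν‖ = 1) (hx : ∀ᵐ g : V × Z, D.xray f ν lam g = 0)
    {U : V × Z → ℂ} (hU : Measurable U) {C : ℝ} (hC : ∀ g, ‖U g‖ ≤ C)
    (hinv : ∀ g : V × Z, U (g.1, g.2 + (Real.pi / ‖lam‖ ^ 3) • lam) = U g) :
    ∫ s in (0 : ℝ)..2 * Real.pi / ‖lam‖, ∫ g, f g * U (D.mul g (-D.helix ν lam s)) = 0 := by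
  have hn : 0 < ‖lam‖ := norm_pos_iff.2 hlam
  set T := 2 * Real.pi / ‖lam‖ with hT
  have hT0 : 0 < T := by positivity
  set γ := D.helix ν lam with hγ
  have hγc : Continuous γ := D.continuous_helix hlam hν
  -- Normalised so that the central period `(π / |λ|³) λ` raises `ρ` by exactly `1`; cutting off to
  -- `ρ ∈ (0, 1]` thus selects one period.
  set ρ : V × Z → ℝ := fun g => inner ℝ lam g.2 * (‖lam‖ / Real.pi) with hρ
  have hmulc : Continuous fun q : ℝ × (V × Z) => D.mul q.2 (-γ q.1) :=
    D.continuous_mul.comp (by fun_prop : Continuous fun q : ℝ × (V × Z) => (q.2, -γ q.1))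
  have hρc : Continuous ρ := by fun_prop
  have hper : ∀ g s, D.mul g (-γ (s + T)) = ((D.mul g (-γ s)).1,
      (D.mul g (-γ s)).2 - (Real.pi / ‖lam‖ ^ 3) • lam) := fun g s => by
    rw [hγ, hT, D.helix_add_period hlam hν]
    ext
    · simp [mul]
    · simp [mul]; abel
  have hρT : ∀ g s, ρ (D.mul g (-γ (s + T))) = ρ (D.mul g (-γ s)) - 1 := fun g s => by
    rw [hper]
    simp only [hρ]
    rw [inner_sub_right, inner_smul_right, real_inner_self_eq_norm_sq]
    field_simp
  have hUT : ∀ g s, U (D.mul g (-γ (s + T))) = U (D.mul g (-γ s)) := fun g s => by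
    rw [hper, ← hinv]; simp
  -- For fixed `g` the bracket makes `s ↦ ρ(g γ(s)⁻¹)` oscillate, so the slice need not be an
  -- interval. It is still a fundamental domain of `ℝ / Tℤ`, and so has measure `T`, which makes `k`
  -- integrable.
  set A : Set (ℝ × (V × Z)) := {q | ρ (D.mul q.2 (-γ q.1)) ∈ Set.Ioc (0 : ℝ) 1} with hA
  have hAm : MeasurableSet A := (hρc.comp hmulc).measurable measurableSet_Ioc
  have hslice : ∀ g, Measurable fun s => ρ (D.mul g (-γ s)) := fun g =>
    (hρc.comp (hmulc.comp (by fun_prop : Continuous fun s : ℝ => (s, g)))).measurable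
  have hvol : ∀ g, volume ((fun s => ρ (D.mul g (-γ s))) ⁻¹' Set.Ioc 0 1) = ENNReal.ofReal T :=
    fun g => volume_preimage_eq (hslice g) hT0 (hρT g)
  have hind : ∀ (k : ℝ × (V × Z) → ℂ) g s, A.indicator k (s, g)
      = ((fun s => ρ (D.mul g (-γ s))) ⁻¹' Set.Ioc 0 1).indicator (fun s => k (s, g)) s :=
    fun k g s => rfl
  have hfm : AEStronglyMeasurable (fun q : ℝ × (V × Z) => f q.2) (volume.prod volume) :=
    hf.1.comp_snd
  have hL : Integrable (A.indicator fun q => f q.2)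
      ((volume : Measure ℝ).prod (volume : Measure (V × Z))) := by
    refine (integrable_prod_iff' (hfm.indicator hAm)).2 ⟨Filter.Eventually.of_forall fun g => ?_, ?_⟩
    · simp only [hind]
      refine (integrable_indicator_iff (hslice g measurableSet_Ioc)).2 ?_
      refine integrableOn_const ?_
      rw [hvol]; exact ENNReal.ofReal_ne_top
    · have : ∀ g, ∫ s, ‖A.indicator (fun q => f q.2) (s, g)‖ = T * ‖f g‖ := fun g => by
        simp only [hind, norm_indicator_eq_indicator_norm]
        rw [integral_indicator (hslice g measurableSet_Ioc), setIntegral_const, measureReal_def,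
          hvol, ENNReal.toReal_ofReal hT0.le, smul_eq_mul]
      simp only [this]
      exact hf.norm.const_mul T
  have hUm : Measurable fun q : ℝ × (V × Z) => U (D.mul q.2 (-γ q.1)) := hU.comp hmulc.measurable
  set k : ℝ × (V × Z) → ℂ := fun q => U (D.mul q.2 (-γ q.1)) * A.indicator (fun q => f q.2) q
    with hk
  have hkint : Integrable k (volume.prod volume) :=
    hL.bdd_mul (c := C) hUm.aestronglyMeasurable (Filter.Eventually.of_forall fun q => hC _)
  have hΨ := D.measurePreserving_shear hγc
  have hcomp : ∫ q, k (q.1, D.mul q.2 (γ q.1)) ∂(volume : Measure ℝ).prod (volume : Measure (V × Z))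
      = ∫ q, k q ∂(volume : Measure ℝ).prod (volume : Measure (V × Z)) := by
    conv_rhs => rw [← hΨ.map_eq]
    rw [integral_map hΨ.measurable.aemeasurable (by rw [hΨ.map_eq]; exact hkint.1)]
  -- After the shear `g ↦ g γ(s)`, the weight `U` and the cut-off depend on `g` alone, and the
  -- remaining `s`-integral is the X-ray transform.
  have hzero : ∫ q, k (q.1, D.mul q.2 (γ q.1))
      ∂(volume : Measure ℝ).prod (volume : Measure (V × Z)) = 0 := by
    have hci : Integrable (fun q : ℝ × (V × Z) => k (q.1, D.mul q.2 (γ q.1)))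
        (volume.prod volume) := hΨ.integrable_comp_of_integrable hkint
    rw [integral_prod_symm _ hci]
    refine (integral_congr_ae ?_).trans (integral_zero _ _)
    filter_upwards [hx] with g hg
    have e : ∀ s, k (s, D.mul g (γ s))
        = (U g * (ρ ⁻¹' Set.Ioc 0 1).indicator 1 g) * f (D.mul g (γ s)) := fun s => by
      have e0 : (s, D.mul g (γ s)) ∈ A ↔ g ∈ ρ ⁻¹' Set.Ioc 0 1 := by
        simp only [hA, Set.mem_ofPred_eq, D.mul_neg_cancel_right, Set.mem_preimage]
      simp only [hk, D.mul_neg_cancel_right]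
      by_cases hm : g ∈ ρ ⁻¹' Set.Ioc 0 1
      · rw [Set.indicator_of_mem (e0.2 hm), Set.indicator_of_mem hm]; simp
      · rw [Set.indicator_of_notMem (fun h => hm (e0.1 h)), Set.indicator_of_notMem hm]; simp
    simp only [e]
    rw [integral_const_mul]
    have : ∫ s, f (D.mul g (γ s)) = 0 := hg
    rw [this, mul_zero]
  rw [hzero, integral_prod_symm _ hkint] at hcomp
  -- Without the shear, `f` is constant in `s` and `U` is `T`-periodic, so the fundamental domain
  -- may be replaced by `(0, T]`.
  have hinner : ∀ g, ∫ s, k (s, g) = ∫ s in (0 : ℝ)..T, f g * U (D.mul g (-γ s)) := fun g => by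
    have e : ∀ s, k (s, g) = ((fun s => ρ (D.mul g (-γ s))) ⁻¹' Set.Ioc 0 1).indicator
        (fun s => f g * U (D.mul g (-γ s))) s := fun s => by
      simp only [hk]
      rw [hind]
      by_cases hm : s ∈ (fun s => ρ (D.mul g (-γ s))) ⁻¹' Set.Ioc 0 1
      · rw [Set.indicator_of_mem hm, Set.indicator_of_mem hm, mul_comm]
      · rw [Set.indicator_of_notMem hm, Set.indicator_of_notMem hm, mul_zero]
    simp only [e]
    rw [integral_indicator (hslice g measurableSet_Ioc)]
    exact setIntegral_preimage_eq (hslice g) hT0 (hρT g) fun s => by rw [hUT]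
  simp only [hinner] at hcomp
  rw [hcomp]
  refine intervalIntegral_integral_swap ?_
  have hfi : Integrable (fun q : ℝ × (V × Z) => f q.2)
      (((volume : Measure ℝ).restrict (Set.uIoc 0 T)).prod volume) := by
    have : IsFiniteMeasure ((volume : Measure ℝ).restrict (Set.uIoc 0 T)) :=
      ⟨by rw [Measure.restrict_apply_univ, Set.uIoc, Real.volume_Ioc]; exact ENNReal.ofReal_lt_top⟩
    exact hf.comp_snd _
  refine (hfi.bdd_mul (c := C) hUm.aestronglyMeasurable
    (Filter.Eventually.of_forall fun q => hC _)).congr ?_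
  exact Filter.Eventually.of_forall fun q => mul_comm _ _

end HTypeAlgebra
end HTypeXray

/-! ### The Fourier slice theorem -/

namespace HTypeXray

theorem Fock.exists_kernel {n : ℕ} (ζ : EuclideanSpace ℂ (Fin n)) :
    ∃ ψ : Fock n, ∀ F : Fock n, inner ℂ ψ F = F ζ := by
  let l : Fock n →L[ℂ] ℂ := LinearMap.mkContinuous
    { toFun := fun F => F ζ
      map_add' := fun F G => rfl
      map_smul' := fun c F => rfl } (Real.exp (‖ζ‖ ^ 2 / 2)) (fun F => Fock.norm_apply_le F ζ)
  exact ⟨(InnerProductSpace.toDual ℂ (Fock n)).symm l, fun F =>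
    InnerProductSpace.toDual_symm_apply⟩

namespace HTypeAlgebra

variable {V : Type u} {Z : Type w}
  [NormedAddCommGroup V] [InnerProductSpace ℝ V] [FiniteDimensional ℝ V]
  [NormedAddCommGroup Z] [InnerProductSpace ℝ Z] [FiniteDimensional ℝ Z]

theorem rep_zero (D : HTypeAlgebra V Z) (μ : Z) (hμ : μ ≠ 0) (φ : Fock (finrank ℝ V / 2)) :
    D.rep μ hμ 0 φ = φ := by
  ext ζ
  simp [rep, Fock.bargmann_apply, Fock.bargmannFun]

theorem rep_central (D : HTypeAlgebra V Z) (μ : Z) (hμ : μ ≠ 0) {z : Z} {m : ℤ}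
    (hz : inner ℝ μ z = 2 * Real.pi * m) (φ : Fock (finrank ℝ V / 2)) :
    D.rep μ hμ (0, z) φ = φ := by
  have hn : (‖μ‖ : ℂ) ≠ 0 := Complex.ofReal_ne_zero.2 (norm_ne_zero_iff.2 hμ)
  ext ζ
  simp only [rep, Fock.bargmann_apply, Fock.bargmannFun, hz]
  have e : Complex.I * ‖μ‖ * ((2 * Real.pi * m / ‖μ‖ : ℝ) : ℂ) = m * (2 * Real.pi * Complex.I) := by
    push_cast
    field_simp
  rw [e]
  simp [Complex.exp_int_mul_two_pi_mul_I]

/-- The complex structure `J_λ / |λ|` on `𝔳` transported to `ℂⁿ` by the frame of `μ`. -/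
def transported (D : HTypeAlgebra V Z) (μ : Z) (hμ : μ ≠ 0) (lam : Z) :
    EuclideanSpace ℂ (Fin (finrank ℝ V / 2)) →ₗ[ℝ] EuclideanSpace ℂ (Fin (finrank ℝ V / 2)) :=
  (D.frame μ hμ).symm.toLinearEquiv.toLinearMap ∘ₗ (D.J lam).toLinearMap ∘ₗ
    (D.frame μ hμ).toLinearEquiv.toLinearMap

theorem transported_apply (D : HTypeAlgebra V Z) (μ : Z) (hμ : μ ≠ 0) (lam : Z)
    (v : EuclideanSpace ℂ (Fin (finrank ℝ V / 2))) :
    D.transported μ hμ lam v = (D.frame μ hμ).symm (D.J lam (D.frame μ hμ v)) := rfl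

variable [MeasurableSpace V] [BorelSpace V] [MeasurableSpace Z] [BorelSpace Z]

theorem inner_fourier_right (D : HTypeAlgebra V Z) {f : V × Z → ℂ} (hf : Integrable f) (μ : Z)
    (hμ : μ ≠ 0) (φ χ : Fock (finrank ℝ V / 2)) :
    ∫ g, f g * inner ℂ (D.rep μ hμ g χ) φ = inner ℂ χ (D.fourier hf μ hμ φ) := by
  rw [D.inner_fourier hf]
  simp only [ContinuousLinearMap.adjoint_inner_right]
  rfl

/-- The unfolding applies to the coefficient `U(g) = ⟨π_μ(g) ψ, φ⟩`, with `ψ` the reproducing kernel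
at `ζ`: the resonance makes `π_μ` trivial on the central period, so `U` has the required invariance.
Unitarity moves `π_μ(γ(s)⁻¹)` from `ψ` to `ℱ(f)(μ) φ`. -/
theorem integral_rep_helix_eq_zero (D : HTypeAlgebra V Z) {f : V × Z → ℂ} (hf : Integrable f)
    {μ lam : Z} (hμ : μ ≠ 0) (hlam : lam ≠ 0) {m : ℤ}
    (hm : inner ℝ μ lam = 2 * m * ‖lam‖ ^ 3) {ν : V} (hν : ‖ν‖ = 1)
    (hx : ∀ᵐ g : V × Z, D.xray f ν lam g = 0) (φ : Fock (finrank ℝ V / 2))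
    (ζ : EuclideanSpace ℂ (Fin (finrank ℝ V / 2))) :
    ∫ s in (0 : ℝ)..2 * Real.pi / ‖lam‖,
      D.rep μ hμ (D.helix ν lam s) (D.fourier hf μ hμ φ) ζ = 0 := by
  have hn : ‖lam‖ ≠ 0 := norm_ne_zero_iff.2 hlam
  obtain ⟨ψ, hψ⟩ := Fock.exists_kernel ζ
  have hz : inner ℝ μ ((Real.pi / ‖lam‖ ^ 3) • lam) = 2 * Real.pi * m := by
    rw [inner_smul_right, hm]; field_simp
  have hmeas : Measurable fun g => inner ℂ (D.rep μ hμ g ψ) φ := by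
    have h := (D.stronglyMeasurable_coeff μ hμ φ ψ).measurable
    have h2 := Complex.continuous_conj.measurable.comp h
    simpa [Function.comp_def] using h2
  have h := D.integral_translate_eq_zero hf hlam hν hx hmeas (C := ‖ψ‖ * ‖φ‖)
    (fun g => (norm_inner_le_norm _ _).trans (by rw [LinearIsometry.norm_map]))
    (fun g => by rw [← D.mul_central, D.rep_mul, D.rep_central μ hμ hz])
  rw [← h]
  refine intervalIntegral.integral_congr fun s _ => ?_
  simp only [D.rep_mul]
  rw [D.inner_fourier_right hf, ← hψ, ← LinearIsometry.inner_map_map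
    (D.rep μ hμ (D.helix ν lam s)) (D.rep μ hμ (-D.helix ν lam s) ψ), ← D.rep_mul, D.mul_neg_self,
    D.rep_zero]

/-- The Fourier slice theorem for the X-ray transform: the range of `ℱ(f)(μ)` consists of functions
with vanishing twisted averages whenever the X-ray transform of `f` at charge `λ` vanishes and
`⟨μ, λ⟩ = 2 m |λ|³`. -/
theorem twistedVanish_fourier (D : HTypeAlgebra V Z) {f : V × Z → ℂ} (hf : Integrable f)
    {μ lam : Z} (hμ : μ ≠ 0) (hlam : lam ≠ 0) {m : ℤ}
    (hm : inner ℝ μ lam = 2 * m * ‖lam‖ ^ 3)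
    (hx : ∀ ν : V, ‖ν‖ = 1 → ∀ᵐ g : V × Z, D.xray f ν lam g = 0)
    (φ : Fock (finrank ℝ V / 2)) :
    TwistedVanish (D.fourier hf μ hμ φ) (fun v => ‖lam‖⁻¹ • D.transported μ hμ lam v)
      (Real.sqrt (‖μ‖ / 2) / ‖lam‖) m := by
  intro v hv ζ
  have hn : 0 < ‖lam‖ := norm_pos_iff.2 hlam
  have hn' : (‖lam‖ : ℂ) ≠ 0 := Complex.ofReal_ne_zero.2 hn.ne'
  have hμ0 : 0 < ‖μ‖ := norm_pos_iff.2 hμ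
  have hμ' : (‖μ‖ : ℂ) ≠ 0 := Complex.ofReal_ne_zero.2 hμ0.ne'
  set Y := D.fourier hf μ hμ φ with hY
  set b := Real.sqrt (‖μ‖ / 2) with hb
  have hb0 : 0 < b := Real.sqrt_pos.2 (by positivity)
  set R := D.frame μ hμ with hR
  -- The direction `ν = J_λ w` is chosen so that the geodesic starts at `w`; dividing by `b =
  -- √(|μ|/2)` undoes the dilation in `π_μ`, so that the translations of the Fock variable are
  -- exactly `y(θ)`, with `θ = |λ| s`.
  set w : V := R (b⁻¹ • v) with hw
  have hwn : ‖w‖ = ‖lam‖⁻¹ := by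
    rw [hw, LinearIsometryEquiv.norm_map, norm_smul, hv, Real.norm_of_nonneg (by positivity)]
    field_simp
  have hinv : Ring.inverse (D.J lam) (D.J lam w) = w := by
    rw [D.inverse_J hlam]
    simp [D.J_J, smul_smul, hn.ne']
  have hν : ‖D.J lam w‖ = 1 := by rw [D.norm_J, hwn, mul_inv_cancel₀ hn.ne']
  have h := D.integral_rep_helix_eq_zero hf hμ hlam hm hν (hx _ hν) φ ζ
  set y : ℝ → EuclideanSpace ℂ (Fin (finrank ℝ V / 2)) := fun θ =>
    Real.cos θ • v + Real.sin θ • ‖lam‖⁻¹ • D.transported μ hμ lam v with hy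
  set F : ℝ → ℂ := fun θ => Complex.exp (m * θ * Complex.I) * Complex.exp (-inner ℂ (y θ) ζ)
    * Y (ζ + y θ) with hF
  have hz : ∀ s, R.symm (D.helix (D.J lam w) lam s).1 = b⁻¹ • y (‖lam‖ * s) := fun s => by
    rw [D.helix_apply hlam hν, hinv]
    simp only [hy, D.transported_apply, ← hR, hw, map_add, map_smul,
      LinearIsometryEquiv.symm_apply_apply, smul_add]
    congr 1
    · rw [smul_comm]
    · rw [smul_smul, smul_smul, smul_smul]
      congr 1
      ring
  have hyn : ∀ θ, ‖b⁻¹ • y θ‖ = ‖lam‖⁻¹ := fun θ => by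
    have h1 : ‖y θ‖ ^ 2 = ‖v‖ ^ 2 := by
      have horth : inner ℝ v (D.transported μ hμ lam v) = 0 := by
        rw [D.transported_apply, ← hR, ← R.inner_map_map, R.apply_symm_apply]
        have h2 := D.inner_J_right lam (R v) (R v)
        rw [real_inner_comm (R v) (D.J lam (R v))] at h2
        linarith
      have hTn : ‖D.transported μ hμ lam v‖ = ‖lam‖ * ‖v‖ := by
        rw [D.transported_apply, LinearIsometryEquiv.norm_map, D.norm_J,
          LinearIsometryEquiv.norm_map]
      simp only [hy]
      rw [norm_add_sq_real, inner_smul_left, inner_smul_right, inner_smul_right, horth, norm_smul,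
        norm_smul, norm_smul, hTn, norm_inv, norm_norm, inv_mul_cancel_left₀ hn.ne', mul_pow,
        mul_pow, Real.norm_eq_abs, Real.norm_eq_abs, sq_abs, sq_abs]
      simp only [mul_zero, add_zero]
      rw [← add_mul, Real.cos_sq_add_sin_sq, one_mul]
    have h3 : ‖y θ‖ = ‖v‖ := (sq_eq_sq₀ (norm_nonneg _) (norm_nonneg _)).1 h1
    rw [norm_smul, h3, hv, Real.norm_of_nonneg (by positivity)]
    field_simp
  -- The horizontal part of the geodesic has constant norm `1 / |λ|`, so the Gaussian factor of the
  -- representation is a nonzero constant and drops out. The central part contributes exactly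
  -- `e^{imθ}`.
  have hrep : ∀ s, D.rep μ hμ (D.helix (D.J lam w) lam s) Y ζ
      = Complex.exp (-(‖μ‖ / 4 * (‖lam‖⁻¹ : ℝ) ^ 2)) * F (‖lam‖ * s) := fun s => by
    have hbb : (b : ℂ) • ((b⁻¹ : ℝ) • y (‖lam‖ * s)) = y (‖lam‖ * s) := by
      ext i
      simp only [PiLp.smul_apply, smul_eq_mul, Complex.real_smul, Complex.ofReal_inv]
      rw [mul_inv_cancel_left₀ (Complex.ofReal_ne_zero.2 hb0.ne')]
    have hin : (b : ℂ) * inner ℂ ((b⁻¹ : ℝ) • y (‖lam‖ * s)) ζ = inner ℂ (y (‖lam‖ * s)) ζ := by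
      conv_rhs => rw [← hbb, inner_smul_left, Complex.conj_ofReal]
    have hsecond : inner ℝ μ (D.helix (D.J lam w) lam s).2 = m * (‖lam‖ * s) := by
      rw [D.helix_apply hlam hν, inner_smul_right, hm]
      field_simp
    simp only [rep, Fock.bargmann_apply, Fock.bargmannFun, ← hR, hz, Fock.sum_mul_conj, ← hb, hbb,
      hin, hyn, hsecond, hF]
    simp only [← mul_assoc, ← Complex.exp_add]
    congr 2
    push_cast
    field_simp
    ring
  rw [intervalIntegral.integral_congr fun s _ => hrep s, intervalIntegral.integral_const_mul,
    intervalIntegral.integral_comp_mul_left F hn.ne'] at h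
  have h4 := (mul_eq_zero.1 h).resolve_left (Complex.exp_ne_zero _)
  rw [mul_zero, mul_div_cancel₀ _ hn.ne', smul_eq_zero] at h4
  exact h4.resolve_left (inv_ne_zero hn.ne')

end HTypeAlgebra
end HTypeXray

/-! ### Clifford relations and vanishing of the Fourier transform at resonant frequencies -/

namespace HTypeXray

namespace HTypeAlgebra

variable {V : Type u} {Z : Type w}
  [NormedAddCommGroup V] [InnerProductSpace ℝ V] [FiniteDimensional ℝ V]
  [NormedAddCommGroup Z] [InnerProductSpace ℝ Z] [FiniteDimensional ℝ Z]

theorem J_add (D : HTypeAlgebra V Z) (μ lam : Z) (x : V) :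
    D.J (μ + lam) x = D.J μ x + D.J lam x :=
  ext_inner_right ℝ fun y => by
    rw [inner_add_left, D.inner_J, D.inner_J, D.inner_J, inner_add_left]

/-- Polarisation of `J_μ² = -|μ|²`, applied to `μ + τ`. -/
theorem J_J_comm_of_inner_eq_zero (D : HTypeAlgebra V Z) {μ τ : Z} (h : inner ℝ μ τ = 0) (x : V) :
    D.J τ (D.J μ x) = -D.J μ (D.J τ x) := by
  have h1 := D.J_J (μ + τ) x
  rw [norm_add_sq_real, h, D.J_add, D.J_add, map_add, map_add, D.J_J, D.J_J] at h1
  have h2 : D.J τ (D.J μ x) + D.J μ (D.J τ x) = 0 := by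
    have h3 : D.J τ (D.J μ x) + D.J μ (D.J τ x)
      = (-(‖μ‖ ^ 2 + 2 * 0 + ‖τ‖ ^ 2)) • x - (-(‖μ‖ ^ 2) • x + -(‖τ‖ ^ 2) • x) := by
      rw [← h1]; abel
    rw [h3]; module
  exact eq_neg_of_add_eq_zero_left h2

theorem frame_I_smul (D : HTypeAlgebra V Z) {μ : Z} (hμ : μ ≠ 0)
    (v : EuclideanSpace ℂ (Fin (finrank ℝ V / 2))) :
    D.frame μ hμ (Complex.I • v) = ‖μ‖⁻¹ • D.J μ (D.frame μ hμ v) := by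
  rw [D.J_frame, inv_smul_smul₀ (norm_ne_zero_iff.2 hμ)]

theorem transported_self (D : HTypeAlgebra V Z) {μ : Z} (hμ : μ ≠ 0)
    (v : EuclideanSpace ℂ (Fin (finrank ℝ V / 2))) :
    D.transported μ hμ μ v = ‖μ‖ • Complex.I • v := by
  rw [transported_apply, D.J_frame, map_smul, LinearIsometryEquiv.symm_apply_apply]

theorem transported_add (D : HTypeAlgebra V Z) {μ : Z} (hμ : μ ≠ 0) (lam τ : Z)
    (v : EuclideanSpace ℂ (Fin (finrank ℝ V / 2))) :
    D.transported μ hμ (lam + τ) v = D.transported μ hμ lam v + D.transported μ hμ τ v := by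
  simp only [transported_apply, J_add, map_add]

theorem transported_smul (D : HTypeAlgebra V Z) {μ : Z} (hμ : μ ≠ 0) (r : ℝ) (lam : Z)
    (v : EuclideanSpace ℂ (Fin (finrank ℝ V / 2))) :
    D.transported μ hμ (r • lam) v = r • D.transported μ hμ lam v := by
  simp only [transported_apply, J_smul, map_smul]

theorem isQuaternionic_transported (D : HTypeAlgebra V Z) {μ τ : Z} (hμ : μ ≠ 0) (hτ : ‖τ‖ = 1)
    (h : inner ℝ μ τ = 0) : IsQuaternionic (D.transported μ hμ τ) where
  map_I_smul v := by
    apply (D.frame μ hμ).injective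
    rw [transported_apply, LinearIsometryEquiv.apply_symm_apply, map_neg, D.frame_I_smul,
      D.frame_I_smul, transported_apply, LinearIsometryEquiv.apply_symm_apply, map_smul,
      D.J_J_comm_of_inner_eq_zero h, smul_neg]
  map_map v := by
    rw [transported_apply, transported_apply, LinearIsometryEquiv.apply_symm_apply, D.J_J, hτ]
    simp
  norm_map v := by
    rw [transported_apply, LinearIsometryEquiv.norm_map, D.norm_J, hτ, one_mul,
      LinearIsometryEquiv.norm_map]

/-- Decompose `λ = k μ + τ` with `τ ⟂ μ`. In the frame of `μ` the first part acts as a multiple of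
`i`, and the normalised second part anticommutes with it. Strictness in Cauchy–Schwarz is what makes
`s = |τ| / |λ|` nonzero. -/
theorem exists_isQuaternionic (D : HTypeAlgebra V Z) {μ lam : Z} (hμ : μ ≠ 0) (hlam : lam ≠ 0)
    (h : (inner ℝ μ lam) ^ 2 < (‖μ‖ * ‖lam‖) ^ 2) :
    ∃ (K : EuclideanSpace ℂ (Fin (finrank ℝ V / 2)) →ₗ[ℝ]
        EuclideanSpace ℂ (Fin (finrank ℝ V / 2))) (c s : ℝ), IsQuaternionic K ∧
      c ^ 2 + s ^ 2 = 1 ∧ s ≠ 0 ∧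
      (fun v => ‖lam‖⁻¹ • D.transported μ hμ lam v)
        = fun v => c • (Complex.I • v) + s • K v := by
  have hμ0 : ‖μ‖ ≠ 0 := norm_ne_zero_iff.2 hμ
  have hl0 : ‖lam‖ ≠ 0 := norm_ne_zero_iff.2 hlam
  set k := inner ℝ μ lam / ‖μ‖ ^ 2 with hk
  set τ := lam - k • μ with hτ
  have horth : inner ℝ μ τ = 0 := by
    rw [hτ, inner_sub_right, inner_smul_right, real_inner_self_eq_norm_sq, hk]
    field_simp
    ring
  have hlamτ : lam = k • μ + τ := by rw [hτ]; abel
  have hpyth : ‖lam‖ ^ 2 = (k * ‖μ‖) ^ 2 + ‖τ‖ ^ 2 := by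
    conv_lhs => rw [hlamτ, norm_add_sq_real, inner_smul_left, horth, norm_smul, mul_pow,
      Real.norm_eq_abs, sq_abs]
    simp [mul_pow]
  have hτ0 : τ ≠ 0 := by
    intro h0
    rw [h0] at hpyth
    rw [mul_pow, hpyth, hk] at h
    have : ‖μ‖ ^ 2 * ((inner ℝ μ lam / ‖μ‖ ^ 2 * ‖μ‖) ^ 2 + ‖(0 : Z)‖ ^ 2)
        = (inner ℝ μ lam) ^ 2 := by
      rw [norm_zero]; field_simp; ring
    rw [this] at h
    exact lt_irrefl _ h
  have hτn : ‖τ‖ ≠ 0 := norm_ne_zero_iff.2 hτ0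
  refine ⟨D.transported μ hμ (‖τ‖⁻¹ • τ), ‖lam‖⁻¹ * (k * ‖μ‖), ‖lam‖⁻¹ * ‖τ‖,
    D.isQuaternionic_transported hμ (norm_smul_inv_norm hτ0)
      (by rw [inner_smul_right, horth, mul_zero]), ?_, mul_ne_zero (inv_ne_zero hl0) hτn, ?_⟩
  · rw [mul_pow _ (k * ‖μ‖), mul_pow _ ‖τ‖, ← mul_add, ← hpyth]
    field_simp
  · funext v
    rw [D.transported_smul, smul_smul, mul_inv_cancel_right₀ hτn]
    conv_lhs => rw [hlamτ, D.transported_add, D.transported_smul, D.transported_self, ← hlamτ]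
    module

/-- Otherwise `𝔳 = 0` and the brackets could not span a centre containing `μ ≠ 0`. -/
theorem finrank_div_two_ne_zero (D : HTypeAlgebra V Z) {μ : Z} (hμ : μ ≠ 0) :
    finrank ℝ V / 2 ≠ 0 := by
  intro h
  have : Subsingleton (EuclideanSpace ℂ (Fin (finrank ℝ V / 2))) := by
    rw [h]; infer_instance
  have hV : ∀ x : V, x = 0 := fun x => by
    rw [← (D.frame μ hμ).apply_symm_apply x, Subsingleton.elim ((D.frame μ hμ).symm x) 0, map_zero]
  have hs : {u : Z | ∃ x y, D.bracket x y = u} ⊆ ((⊥ : Submodule ℝ Z) : Set Z) := by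
    rintro u ⟨x, y, rfl⟩
    rw [hV x]; simp
  have htop := D.span_bracket
  have hle := Submodule.span_le.2 hs
  rw [htop] at hle
  exact hμ (by simpa using hle (Submodule.mem_top (x := μ)))

variable [MeasurableSpace V] [BorelSpace V] [MeasurableSpace Z] [BorelSpace Z]

/-- If the X-ray transform of `f` vanishes at the charge `λ` parallel to `μ` for which
`|μ| = 2 m |λ|²`, and no Laguerre polynomial `L_k^{(m)}` vanishes at `m`, then `ℱ(f)(μ) = 0`. -/
theorem fourier_eq_zero_of_parallel (D : HTypeAlgebra V Z) {f : V × Z → ℂ} (hf : Integrable f)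
    {μ : Z} (hμ : μ ≠ 0) {m : ℕ} (hm : m ≠ 0)
    (hne : ∀ k, ∑ j ∈ Finset.range (k + 1),
      (-(m : ℂ)) ^ j * (k.choose j : ℂ) / ((m + j).factorial : ℂ) ≠ 0)
    {t : ℝ} (ht : 0 < t) (htm : ‖μ‖ = 2 * m * t ^ 2)
    (hx : ∀ ν : V, ‖ν‖ = 1 → ∀ᵐ g : V × Z, D.xray f ν ((t / ‖μ‖) • μ) g = 0) :
    D.fourier hf μ hμ = 0 := by
  have hμ0 : 0 < ‖μ‖ := norm_pos_iff.2 hμ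
  have : NeZero (finrank ℝ V / 2) := ⟨D.finrank_div_two_ne_zero hμ⟩
  have hlam : (t / ‖μ‖) • μ ≠ 0 := smul_ne_zero (by positivity) hμ
  have hnorm : ‖(t / ‖μ‖) • μ‖ = t := by
    rw [norm_smul, Real.norm_of_nonneg (by positivity)]; field_simp
  have hinner : inner ℝ μ ((t / ‖μ‖) • μ) = 2 * ((m : ℤ) : ℝ) * ‖(t / ‖μ‖) • μ‖ ^ 3 := by
    rw [hnorm, inner_smul_right, real_inner_self_eq_norm_sq, Int.cast_natCast]
    field_simp
    rw [htm]
    ring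
  ext φ ζ
  have h := D.twistedVanish_fourier hf hμ hlam hinner hx φ
  have hT : ∀ v, ‖(t / ‖μ‖) • μ‖⁻¹ • D.transported μ hμ ((t / ‖μ‖) • μ) v = Complex.I • v :=
    fun v => by
      rw [hnorm, D.transported_smul, D.transported_self, smul_smul, smul_smul]
      convert one_smul ℝ _
      field_simp
  have ha : (Real.sqrt (‖μ‖ / 2) / ‖(t / ‖μ‖) • μ‖) ^ 2 = m := by
    rw [hnorm, div_pow, Real.sq_sqrt (by positivity), htm]
    field_simp
  obtain ⟨v, hv⟩ : ∃ v : EuclideanSpace ℂ (Fin (finrank ℝ V / 2)),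
      ‖v‖ = Real.sqrt (‖μ‖ / 2) / ‖(t / ‖μ‖) • μ‖ :=
    ⟨EuclideanSpace.single 0 ((Real.sqrt (‖μ‖ / 2) / ‖(t / ‖μ‖) • μ‖ : ℝ) : ℂ), by
      rw [PiLp.norm_single, Complex.norm_real, Real.norm_of_nonneg (by positivity)]⟩
  refine eq_zero_of_twisted_circle (Fock.differentiable _) hm hne (v := v) (by rw [hv, ha])
    (fun ζ => ?_) ζ
  have h1 := h v hv ζ
  rw [← h1]
  refine intervalIntegral.integral_congr fun θ _ => ?_
  have he : Complex.exp (θ * Complex.I) • v = Real.cos θ • v + Real.sin θ • Complex.I • v := by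
    rw [Complex.exp_mul_I, add_smul, mul_smul, ← Complex.ofReal_cos, ← Complex.ofReal_sin]
    rfl
  simp only [hT, he, Int.cast_natCast]

/-- If the X-ray transform of `f` vanishes at two charges `λ`, `λ'` of the same length, not parallel
to `μ`, which are resonant with `μ` for consecutive integers, then `ℱ(f)(μ) = 0`. -/
theorem fourier_eq_zero_of_consecutive (D : HTypeAlgebra V Z) {f : V × Z → ℂ} (hf : Integrable f)
    {μ lam lam' : Z} (hμ : μ ≠ 0) {R : ℝ} (hR : 0 < R) (hlam : ‖lam‖ = R) (hlam' : ‖lam'‖ = R)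
    {m : ℤ} (hm : inner ℝ μ lam = 2 * m * R ^ 3)
    (hm' : inner ℝ μ lam' = 2 * (m + 1 : ℤ) * R ^ 3)
    (hlt : (inner ℝ μ lam) ^ 2 < (‖μ‖ * R) ^ 2) (hlt' : (inner ℝ μ lam') ^ 2 < (‖μ‖ * R) ^ 2)
    (hx : ∀ ν : V, ‖ν‖ = 1 → ∀ᵐ g : V × Z, D.xray f ν lam g = 0)
    (hx' : ∀ ν : V, ‖ν‖ = 1 → ∀ᵐ g : V × Z, D.xray f ν lam' g = 0) :
    D.fourier hf μ hμ = 0 := by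
  have hμ0 : 0 < ‖μ‖ := norm_pos_iff.2 hμ
  have : NeZero (finrank ℝ V / 2) := ⟨D.finrank_div_two_ne_zero hμ⟩
  have hl : lam ≠ 0 := norm_pos_iff.1 (hlam ▸ hR)
  have hl' : lam' ≠ 0 := norm_pos_iff.1 (hlam' ▸ hR)
  obtain ⟨K, c, s, hK, hcs, hs, e⟩ := D.exists_isQuaternionic hμ hl (hlam.symm ▸ hlt)
  obtain ⟨K', c', s', hK', hcs', hs', e'⟩ := D.exists_isQuaternionic hμ hl' (hlam'.symm ▸ hlt')
  ext φ ζ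
  have h := D.twistedVanish_fourier hf hμ hl (hlam.symm ▸ hm) hx φ
  have h' := D.twistedVanish_fourier hf hμ hl' (hlam'.symm ▸ hm') hx' φ
  rw [e, hlam] at h
  rw [e', hlam'] at h'
  exact eq_zero_of_twistedVanish (Fock.differentiable _) hK hK' (by positivity) hcs hs hcs' hs' h h' ζ

end HTypeAlgebra

/-! ### Values of a linear functional on a spherical cap -/

section Sphere

variable {Z : Type w} [NormedAddCommGroup Z] [InnerProductSpace ℝ Z]

/-- A unit vector `σ` lies in a plane spanned by `ω` and a unit vector `e ⟂ ω`; the sign of `e` can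
be chosen so that the coordinates of `σ` do not have the same sign. -/
theorem exists_unit_orthogonal [FiniteDimensional ℝ Z] (hd : 1 < finrank ℝ Z) {σ ω : Z}
    (hω : ‖ω‖ = 1) : ∃ e : Z, ‖e‖ = 1 ∧ inner ℝ ω e = 0 ∧
      σ = inner ℝ σ ω • ω + inner ℝ σ e • e ∧ inner ℝ σ ω * inner ℝ σ e ≤ 0 := by
  obtain ⟨e, he, horth, hσ⟩ : ∃ e : Z, ‖e‖ = 1 ∧ inner ℝ ω e = 0 ∧
      σ = inner ℝ σ ω • ω + inner ℝ σ e • e := by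
    have hω0 : ω ≠ 0 := norm_ne_zero_iff.1 (by rw [hω]; exact one_ne_zero)
    set τ := σ - inner ℝ σ ω • ω with hτ
    have hωτ : inner ℝ ω τ = 0 := by
      rw [hτ, inner_sub_right, inner_smul_right, real_inner_self_eq_norm_sq, hω,
        real_inner_comm]
      ring
    by_cases h0 : τ = 0
    · have hsum := (Submodule.span ℝ {ω}).finrank_add_finrank_orthogonal
      rw [finrank_span_singleton hω0] at hsum
      have : Nontrivial (Submodule.span ℝ {ω})ᗮ := nontrivial_of_finrank_pos (R := ℝ) (by omega)
      obtain ⟨x, hx⟩ := exists_ne (0 : (Submodule.span ℝ {ω})ᗮ)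
      have hωx : inner ℝ ω (x : Z) = 0 := Submodule.mem_orthogonal_singleton_iff_inner_right.1 x.2
      have hσω : σ = inner ℝ σ ω • ω := sub_eq_zero.1 h0
      refine ⟨‖(x : Z)‖⁻¹ • (x : Z), norm_smul_inv_norm (by simpa using hx),
        by rw [inner_smul_right, hωx, mul_zero], ?_⟩
      have hσx : inner ℝ σ (x : Z) = 0 := by rw [hσω, inner_smul_left, hωx, mul_zero]
      rw [inner_smul_right, hσx, mul_zero, zero_smul, add_zero]
      exact hσω
    · have hn : ‖τ‖ ≠ 0 := norm_ne_zero_iff.2 h0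
      refine ⟨‖τ‖⁻¹ • τ, norm_smul_inv_norm h0, by rw [inner_smul_right, hωτ, mul_zero], ?_⟩
      have hστ : inner ℝ σ τ = ‖τ‖ ^ 2 := by
        have h1 : σ = τ + inner ℝ σ ω • ω := by rw [hτ]; abel
        conv_lhs => rw [h1]
        rw [inner_add_left, inner_smul_left, hωτ, real_inner_self_eq_norm_sq]
        simp
      rw [inner_smul_right, hστ, smul_smul]
      have : ‖τ‖⁻¹ * ‖τ‖ ^ 2 * ‖τ‖⁻¹ = 1 := by field_simp
      rw [this, one_smul, hτ]
      abel
  rcases le_total (inner ℝ σ ω * inner ℝ σ e) 0 with h | h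
  · exact ⟨e, he, horth, hσ, h⟩
  · refine ⟨-e, by rw [norm_neg, he], by rw [inner_neg_right, horth, neg_zero], ?_, ?_⟩
    · rw [inner_neg_right, neg_smul_neg]; exact hσ
    · rw [inner_neg_right]; linarith

/-- With `xy ≤ 0` the cross term in the square is nonnegative, and `sin t ≥ 1 - cos t` on `[0, 1]`.
Without the sign condition the two terms could cancel. -/
theorem one_sub_cos_le_abs {x y t : ℝ} (hxy : x ^ 2 + y ^ 2 = 1) (h : x * y ≤ 0) (ht : 0 ≤ t)
    (ht1 : t ≤ 1) : 1 - Real.cos t ≤ |x * (1 - Real.cos t) - y * Real.sin t| := by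
  have hc1 := Real.cos_le_one t
  have hc0 : 0 ≤ Real.cos t := Real.cos_nonneg_of_neg_pi_div_two_le_of_le
    (by linarith [Real.pi_gt_three]) (by linarith [Real.pi_gt_three])
  have hs0 : 0 ≤ Real.sin t := Real.sin_nonneg_of_nonneg_of_le_pi ht (by linarith [Real.pi_gt_three])
  have hsc := Real.sin_sq_add_cos_sq t
  have hs : 1 - Real.cos t ≤ Real.sin t := by
    refine le_of_sq_le_sq ?_ hs0
    nlinarith
  refine abs_le_of_sq_le_sq' ?_ (abs_nonneg _) |>.2
  rw [sq_abs]
  have h1 : (1 - Real.cos t) ^ 2 ≤ Real.sin t ^ 2 := pow_le_pow_left₀ (by linarith) hs 2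
  have h2 : 0 ≤ -(x * y) * ((1 - Real.cos t) * Real.sin t) :=
    mul_nonneg (by linarith) (mul_nonneg (by linarith) hs0)
  nlinarith [mul_nonneg (sq_nonneg y) (sub_nonneg.2 h1)]

/-- On a spherical cap of radius `ε`, the function `λ ↦ ⟨σ, λ⟩` takes all values of an interval of
length `δ(ε)`. -/
theorem exists_interval_on_cap [FiniteDimensional ℝ Z] (hd : 1 < finrank ℝ Z) {ε t : ℝ}
    (ht : 0 ≤ t) (ht1 : t ≤ 1) (htε : t < ε) {σ ω : Z} (hσ : ‖σ‖ = 1) (hω : ‖ω‖ = 1) :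
    ∃ a b : ℝ, -1 ≤ a ∧ b ≤ 1 ∧ 1 - Real.cos t ≤ b - a ∧ ∀ r, a < r → r < b →
      ∃ η : Z, ‖η‖ = 1 ∧ ‖η - ω‖ < ε ∧ inner ℝ σ η = r := by
  obtain ⟨e, he, horth, hσe, hxy⟩ := exists_unit_orthogonal hd (σ := σ) hω
  set x := inner ℝ σ ω with hx
  set y := inner ℝ σ e with hy
  have hnorm : ∀ p q : ℝ, ‖p • ω + q • e‖ ^ 2 = p ^ 2 + q ^ 2 := fun p q => by
    rw [norm_add_sq_real, inner_smul_left, inner_smul_right, horth, norm_smul, norm_smul, hω, he]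
    simp
  have hxy1 : x ^ 2 + y ^ 2 = 1 := by rw [← hnorm, ← hσe, hσ, one_pow]
  -- A great-circle arc from the centre of the cap, in a plane containing `σ`. Its chords are at
  -- most `s ≤ t < ε`, so it stays in the cap, and the intermediate value theorem along it gives the
  -- interval.
  set γ : ℝ → Z := fun s => Real.cos s • ω + Real.sin s • e with hγ
  set g : ℝ → ℝ := fun s => x * Real.cos s + y * Real.sin s with hg
  have hγn : ∀ s, ‖γ s‖ = 1 := fun s => by
    rw [← sq_eq_sq₀ (norm_nonneg _) zero_le_one, hγ, hnorm, Real.cos_sq_add_sin_sq, one_pow]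
  have hγg : ∀ s, inner ℝ σ (γ s) = g s := fun s => by
    simp only [hγ, hg, inner_add_right, inner_smul_right, ← hx, ← hy]
    ring
  have hg1 : ∀ s, |g s| ≤ 1 := fun s => by
    rw [← hγg]
    exact (abs_real_inner_le_norm _ _).trans (by rw [hσ, hγn, one_mul])
  have hγd : ∀ s, 0 ≤ s → s ≤ t → ‖γ s - ω‖ < ε := fun s hs hst => by
    refine lt_of_le_of_lt (le_of_sq_le_sq ?_ hs) (hst.trans_lt htε)
    have h1 : γ s - ω = (Real.cos s - 1) • ω + Real.sin s • e := by
      simp only [hγ]; module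
    rw [h1, hnorm]
    nlinarith [Real.one_sub_sq_div_two_le_cos (x := s), Real.sin_sq_add_cos_sq s]
  have hosc : 1 - Real.cos t ≤ |g 0 - g t| := by
    have h1 : g 0 - g t = x * (1 - Real.cos t) - y * Real.sin t := by
      simp only [hg, Real.cos_zero, Real.sin_zero]; ring
    rw [h1]
    exact one_sub_cos_le_abs hxy1 hxy ht ht1
  have hcont : ContinuousOn g (Set.uIcc 0 t) := by fun_prop
  have hivt := intermediate_value_uIcc hcont
  refine ⟨min (g 0) (g t), max (g 0) (g t), le_min (abs_le.1 (hg1 0)).1 (abs_le.1 (hg1 t)).1,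
    max_le (abs_le.1 (hg1 0)).2 (abs_le.1 (hg1 t)).2, by rwa [max_sub_min_eq_abs, abs_sub_comm],
    fun r hr1 hr2 => ?_⟩
  obtain ⟨s, hs, hsr⟩ := hivt ⟨hr1.le, hr2.le⟩
  rw [Set.uIcc_of_le ht] at hs
  exact ⟨γ s, hγn s, hγd s hs.1 hs.2, by rw [hγg, hsr]⟩

end Sphere
end HTypeXray

end

/-! ### The two frequency-support theorems -/

theorem theorem2p4 :
    (∀ ε : ℝ, 0 < ε → ∃ c : ℝ, 0 < c ∧
      ∀ (V : Type u) (Z : Type w)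
        [NormedAddCommGroup V] [InnerProductSpace ℝ V] [FiniteDimensional ℝ V]
        [MeasurableSpace V] [BorelSpace V]
        [NormedAddCommGroup Z] [InnerProductSpace ℝ Z] [FiniteDimensional ℝ Z]
        [MeasurableSpace Z] [BorelSpace Z]
        (D : HTypeXray.HTypeAlgebra V Z),
        Module.finrank ℝ Z = 1 →
        ∀ R : ℝ, 0 < R → ∀ f : V × Z → ℂ, Integrable f →
          D.XrayVanishes f {lam : Z | ‖lam‖ ∈ Set.Icc R (R * (1 + ε))} →
          f ∈ D.truncatedL1 {mu : Z | mu ≠ 0 ∧ ‖mu‖ ≤ c * R ^ 2}) ∧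
    (∀ ε : ℝ, 0 < ε → ∃ c : ℝ, 0 < c ∧
      ∀ (V : Type u) (Z : Type w)
        [NormedAddCommGroup V] [InnerProductSpace ℝ V] [FiniteDimensional ℝ V]
        [MeasurableSpace V] [BorelSpace V]
        [NormedAddCommGroup Z] [InnerProductSpace ℝ Z] [FiniteDimensional ℝ Z]
        [MeasurableSpace Z] [BorelSpace Z]
        (D : HTypeXray.HTypeAlgebra V Z),
        1 < Module.finrank ℝ Z →
        ∀ R : ℝ, 0 < R → ∀ lam₀ : Z, ‖lam₀‖ = R → ∀ f : V × Z → ℂ, Integrable f →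
          D.XrayVanishes f (HTypeXray.sphericalCap ε lam₀) →
          f ∈ D.truncatedL1 {mu : Z | mu ≠ 0 ∧ ‖mu‖ ≤ c * R ^ 2}) := by
  constructor
  · intro ε hε
    obtain ⟨C, hC, hCM⟩ := HTypeXray.exists_prime_mul_near ε hε
    refine ⟨2 * C, by positivity, ?_⟩
    intro V Z _ _ _ _ _ _ _ _ _ _ D _ R hR f hf hx
    refine ⟨hf, fun μ hμ hnot => ?_⟩
    have hμ0 : 0 < ‖μ‖ := norm_pos_iff.2 hμ
    have hlt : 2 * C * R ^ 2 < ‖μ‖ := by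
      by_contra hle
      exact hnot ⟨hμ, not_lt.1 hle⟩
    obtain ⟨p, d, hp, hp2, hd, hdp, hle, hge⟩ := hCM (‖μ‖ / (2 * R ^ 2))
      (by rw [lt_div_iff₀ (by positivity)]; linarith)
    have hm : d * p ≠ 0 := Nat.mul_ne_zero hd.ne' hp.ne_zero
    have hm0 : (0 : ℝ) < (d * p : ℕ) := by exact_mod_cast Nat.pos_of_ne_zero hm
    -- The length of the charge parallel to `μ` that is resonant for `m = dp`. The bounds `m ≤ |μ| /
    -- (2R²) ≤ m(1+ε)` place it in `[R, R(1+ε)]`.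
    set t := Real.sqrt (‖μ‖ / (2 * (d * p : ℕ))) with ht
    have ht0 : 0 < t := Real.sqrt_pos.2 (by positivity)
    have ht2 : t ^ 2 = ‖μ‖ / (2 * (d * p : ℕ)) := Real.sq_sqrt (by positivity)
    refine D.fourier_eq_zero_of_parallel hf hμ hm
      (HTypeXray.laguerre_sum_ne_zero hp hp2 hdp) ht0 (by rw [ht2]; field_simp)
      fun ν hν => hx ν hν _ ?_
    rw [Set.mem_ofPred_eq, norm_smul, Real.norm_of_nonneg (by positivity),
      div_mul_cancel₀ _ hμ0.ne']
    rw [le_div_iff₀ (by positivity)] at hle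
    rw [div_le_iff₀ (by positivity)] at hge
    constructor
    · refine le_of_sq_le_sq ?_ ht0.le
      rw [ht2, le_div_iff₀ (by positivity)]
      linarith
    · refine le_of_sq_le_sq ?_ (by positivity)
      rw [ht2, div_le_iff₀ (by positivity)]
      -- The slack `(1+ε)² - (1+ε) = ε(1+ε)`: only a factor `1 + ε` is needed for the square `t²`.
      have h1 : 0 ≤ (d * p : ℕ) * R ^ 2 * (ε * (1 + ε)) := by positivity
      nlinarith
  · intro ε hε
    set t := min ε 1 / 2 with ht
    have hmin : 0 < min ε 1 := lt_min hε one_pos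
    have ht0 : 0 < t := by positivity
    have ht1 : t ≤ 1 := by linarith [min_le_right ε 1]
    have htε : t < ε := by linarith [min_le_left ε 1]
    have hδ : 0 < 1 - Real.cos t := by
      have := Real.cos_lt_cos_of_nonneg_of_le_pi le_rfl (by linarith [Real.pi_gt_three]) ht0
      rw [Real.cos_zero] at this
      linarith
    -- With `M = |μ| / (2R²)`, the inequality `|μ| > c R²` reads `M (1 - cos t) > 2`: the resonance
    -- index sweeps an open interval of length more than `2`.
    refine ⟨4 / (1 - Real.cos t), by positivity, ?_⟩
    intro V Z _ _ _ _ _ _ _ _ _ _ D hdim R hR lam₀ hlam₀ f hf hx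
    refine ⟨hf, fun μ hμ hnot => ?_⟩
    have hμ0 : 0 < ‖μ‖ := norm_pos_iff.2 hμ
    have hlt : 4 / (1 - Real.cos t) * R ^ 2 < ‖μ‖ := by
      by_contra hle
      exact hnot ⟨hμ, not_lt.1 hle⟩
    have hl0 : lam₀ ≠ 0 := norm_pos_iff.1 (hlam₀ ▸ hR)
    have hω : ‖R⁻¹ • lam₀‖ = 1 := by rw [← hlam₀]; exact norm_smul_inv_norm hl0
    have hσ : ‖‖μ‖⁻¹ • μ‖ = 1 := norm_smul_inv_norm hμ
    obtain ⟨a, b, ha, hb, hab, hval⟩ := HTypeXray.exists_interval_on_cap hdim ht0.le ht1 htε hσ hω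
    set M := ‖μ‖ / (2 * R ^ 2) with hM
    have hM0 : 0 < M := by positivity
    have hMδ : 2 < M * (b - a) := by
      refine lt_of_lt_of_le ?_ (mul_le_mul_of_nonneg_left hab hM0.le)
      rw [div_mul_eq_mul_div, div_lt_iff₀ hδ] at hlt
      rw [hM, div_mul_eq_mul_div, lt_div_iff₀ (by positivity)]
      linarith
    have key : ∀ k : ℤ, M * a < k → k < M * b → ∃ lam : Z, ‖lam‖ = R ∧
        inner ℝ μ lam = 2 * k * R ^ 3 ∧ (inner ℝ μ lam) ^ 2 < (‖μ‖ * R) ^ 2 ∧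
        ∀ ν : V, ‖ν‖ = 1 → ∀ᵐ g : V × Z, D.xray f ν lam g = 0 := fun k hk1 hk2 => by
      have h1 : a < k / M := by rw [lt_div_iff₀ hM0]; linarith
      have h2 : k / M < b := by rw [div_lt_iff₀ hM0]; linarith
      obtain ⟨η, hη, hηω, hin⟩ := hval _ h1 h2
      have hn : ‖R • η‖ = R := by rw [norm_smul, hη, Real.norm_of_nonneg hR.le, mul_one]
      have hin' : inner ℝ μ (R • η) = ‖μ‖ * R * (k / M) := by
        rw [← hin, inner_smul_right, inner_smul_left]
        simp only [conj_trivial]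
        field_simp
      refine ⟨R • η, hn, ?_, ?_, fun ν hν => hx ν hν _
        ⟨norm_pos_iff.1 (hn.symm ▸ hR), by rw [hn, hlam₀], ?_⟩⟩
      · rw [hin', hM]; field_simp
      -- The value `k / M` lies strictly between `a ≥ -1` and `b ≤ 1`, so the charge is not parallel
      -- to `μ`.
      · rw [hin', mul_pow]
        have h3 : (k / M : ℝ) ^ 2 < 1 := by
          rw [sq_lt_one_iff_abs_lt_one, abs_lt]
          constructor <;> linarith
        exact mul_lt_of_lt_one_right (by positivity) h3
      · have h4 : R • η - lam₀ = R • (η - R⁻¹ • lam₀) := by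
          rw [smul_sub, smul_inv_smul₀ hR.ne']
        rw [h4, norm_smul, Real.norm_of_nonneg hR.le, hlam₀, mul_comm]
        exact mul_lt_mul_of_pos_right hηω hR
    have hfl := Int.lt_floor_add_one (M * a)
    have hfl' := Int.floor_le (M * a)
    have hMab : M * (b - a) = M * b - M * a := mul_sub _ _ _
    -- The first two integers strictly above `M a`; the second is at most `M a + 2 < M b`.
    obtain ⟨lam, hl, hi, hs, hv⟩ := key (⌊M * a⌋ + 1) (by push_cast; exact hfl)
      (by push_cast; linarith)
    obtain ⟨lam', hl', hi', hs', hv'⟩ := key (⌊M * a⌋ + 1 + 1) (by push_cast; linarith)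
      (by push_cast; linarith)
    exact D.fourier_eq_zero_of_consecutive hf hμ hR hl hl' hi hi' hs hs' hv hv'
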